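/- Let $d\ge 1$, $s\in(0,1)$, $\alpha:=1-2s$, and let $\Omega\subset\mathbb{R}^d$ be a bounded open set (for example a bounded polyhedral Lipschitz domain). Let $$\|u\|_{H^s(\mathbb{R}^d)}^2=\|u\|_{L^2(\mathbb{R}^d)}^2+\int_{\mathbb{R}^d}\int_{\mathbb{R}^d}\frac{|u(x)-u(y)|^2}{|x-y|^{d+2s}}\,dx\,dy ,$$ let $H^s(\mathbb{R}^d)$ be the space of real-valued $u\in L^2(\mathbb{R}^d)$ for which this is finite, let $H^s_0(\mathbb{R}^d;\Omega):=\{u\in H^s(\mathbb{R}^d): u=0 \text{ a.e. on }\mathbb{R}^d\setminus\overline\Omega\}$ with the norm of $H^s(\mathbb{R}^d)$, and let $H^{-s}(\Omega)$ be the dual space of $H^s_0(\mathbb{R}^d;\Omega)$ with the dual norm. Let $\mathbb{R}^{d+1}_+=\mathbb{R}^d\times(0,\infty)$, $\|w\|_{L^2_\alpha}^2=\int_{\mathbb{R}^{d+1}_+}x_{d+1}^{\alpha}|w|^2\,dx$, and let $\mathcal B^1_\alpha(\mathbb{R}^{d+1}_+)$ be the space of all distributions on $\mathbb{R}^{d+1}_+$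 whose gradient lies in $L^2_\alpha(\mathbb{R}^{d+1}_+)$. Let $\operatorname{tr}$ be the trace operator on $\mathcal B^1_\alpha(\mathbb{R}^{d+1}_+)$, that is, the extension of $\varphi\mapsto\varphi(\cdot,0)$ by continuity from functions smooth up to the boundary (with respect to convergence in $L^2_\alpha$ on bounded sets together with convergence of the gradients in $L^2_\alpha(\mathbb{R}^{d+1}_+)$, and convergence of the traces in $L^2_{\rm loc}(\mathbb{R}^d)$). For $u\in H^s(\mathbb{R}^d)$ let $$\mathcal L u=\operatorname*{argmin}\{\|\nabla U\|_{L^2_\alpha(\mathbb{R}^{d+1}_+)} : U\in\mathcal B^1_\alpha(\mathbb{R}^{d+1}_+),\ \operatorname{tr}U=u\}$$ be the harmonic (minimum norm) extension. Then: 1. For every $u\in H^s(\mathbb{R}^d)$ this minimizer exists and is unique, so that $\mathcal L u$ is well defined. 2. Every $f\in L^2(\Omega)$ defines an element of $H^{-s}(\Omega)$ by $\langle f,v\rangle=\int_\Omega f v\,dx$. 3. There is a constant $C>0$, independent of $f$, such that for every $f\in H^{-s}(\Omega)$ there is exactly one $u\in H^s_0(\mathbb{R}^d;\Omega)$ with $$\int_{\mathbb{R}^{d+1}_+}x_{d+1}^{1-2s}\,\nabla\mathcal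 L u\cdot\nabla\mathcal L v\,dx=\langle f,v\rangle\qquad\text{for all } v\in H^s_0(\mathbb{R}^d;\Omega),$$ and this $u$ satisfies $\|u\|_{H^s(\mathbb{R}^d)}\le C\,\|f\|_{H^{-s}(\Omega)}$. -/

import Mathlib

open MeasureTheory Filter Topology TopologicalSpace
open scoped ENNReal Distributions LineDeriv Gradient

noncomputable section

/-! ### Fractional Sobolev spaces on `ℝ^d` -/

/-- `ℝ^d` with the Euclidean norm. -/
abbrev Rd (d : ℕ) : Type := EuclideanSpace ℝ (Fin d)

/-- The squared Sobolev-Slobodecki seminorm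
`|u|²_{H^s(ℝ^d)} = ∫∫ |u(x) - u(y)|² / |x - y|^{d+2s} dx dy`, with values in `[0, ∞]`. -/
def slobodeckijSq {d : ℕ} (s : ℝ) (u : Rd d → ℝ) : ℝ≥0∞ :=
  ∫⁻ x, ∫⁻ y, ENNReal.ofReal (|u x - u y| ^ 2 / ‖x - y‖ ^ ((d : ℝ) + 2 * s))

/-- The quotient `(u(x) - u(y)) / |x - y|^{(d+2s)/2}`, whose `L²(ℝ^d × ℝ^d)` norm is the
Sobolev-Slobodecki seminorm. -/
def slobodeckijQuot {d : ℕ} (s : ℝ) (u : Rd d → ℝ) (p : Rd d × Rd d) : ℝ :=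
  (u p.1 - u p.2) / ‖p.1 - p.2‖ ^ (((d : ℝ) + 2 * s) / 2)

theorem slobodeckijSq_congr {d : ℕ} (s : ℝ) {u v : Rd d → ℝ} (h : u =ᵐ[volume] v) :
    slobodeckijSq s u = slobodeckijSq s v := by
  unfold slobodeckijSq
  refine lintegral_congr_ae ?_
  filter_upwards [h] with x hx
  refine lintegral_congr_ae ?_
  filter_upwards [h] with y hy
  rw [hx, hy]

theorem measurable_slobodeckijQuot {d : ℕ} (s : ℝ) {u : Rd d → ℝ} (hu : Measurable u) :
    Measurable (slobodeckijQuot s u) := by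
  unfold slobodeckijQuot
  fun_prop

theorem slobodeckijSq_eq {d : ℕ} (s : ℝ) {u : Rd d → ℝ} (hu : Measurable u) :
    slobodeckijSq s u = eLpNorm (slobodeckijQuot s u) 2 (volume.prod volume) ^ 2 := by
  have hm := measurable_slobodeckijQuot s hu
  have h1 : ∀ p, ‖slobodeckijQuot s u p‖ₑ ^ 2 =
      ENNReal.ofReal (|u p.1 - u p.2| ^ 2 / ‖p.1 - p.2‖ ^ ((d : ℝ) + 2 * s)) := by
    intro p
    rw [Real.enorm_eq_ofReal_abs, ← ENNReal.ofReal_pow (abs_nonneg _)]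
    congr 1
    unfold slobodeckijQuot
    rw [abs_div, div_pow, abs_of_nonneg (Real.rpow_nonneg (norm_nonneg _) _),
      ← Real.rpow_mul_natCast (norm_nonneg _)]
    congr 2
    push_cast
    ring
  have h2 := eLpNorm_nnreal_pow_eq_lintegral (f := slobodeckijQuot s u)
    (μ := (volume : Measure (Rd d)).prod volume) (p := 2) two_ne_zero
  have h3 : eLpNorm (slobodeckijQuot s u) 2 (volume.prod volume) ^ 2 =
      ∫⁻ p, ‖slobodeckijQuot s u p‖ₑ ^ 2 ∂((volume : Measure (Rd d)).prod volume) := by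
    simpa using h2
  rw [h3, lintegral_prod _ (by fun_prop)]
  simp only [h1]
  rfl

/-- The Sobolev-Slobodecki norm
`‖u‖_{H^s(ℝ^d)} = (‖u‖²_{L²(ℝ^d)} + |u|²_{H^s(ℝ^d)})^{1/2}`. -/
def sobolevNorm {d : ℕ} (s : ℝ) (u : Lp ℝ 2 (volume : Measure (Rd d))) : ℝ :=
  √(‖u‖ ^ 2 + (slobodeckijSq s u).toReal)

/-- The triangle inequality for the Sobolev-Slobodecki seminorm. -/
theorem slobodeckijSq_add_le {d : ℕ} (s : ℝ) (u v : Lp ℝ 2 (volume : Measure (Rd d))) :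
    eLpNorm (slobodeckijQuot s (u + v : Lp ℝ 2 (volume : Measure (Rd d)))) 2
        (volume.prod volume) ≤
      eLpNorm (slobodeckijQuot s u) 2 (volume.prod volume) +
        eLpNorm (slobodeckijQuot s v) 2 (volume.prod volume) := by
  have hu := (Lp.stronglyMeasurable u).measurable
  have hv := (Lp.stronglyMeasurable v).measurable
  have h : eLpNorm (slobodeckijQuot s (u + v : Lp ℝ 2 (volume : Measure (Rd d)))) 2
      (volume.prod volume) =
      eLpNorm (slobodeckijQuot s (⇑u + ⇑v)) 2 (volume.prod volume) := by
    have h2 := slobodeckijSq_congr s (Lp.coeFn_add u v)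
    rw [slobodeckijSq_eq s (Lp.stronglyMeasurable _).measurable,
      slobodeckijSq_eq s (hu.add hv)] at h2
    exact (ENNReal.pow_right_strictMono two_ne_zero).injective h2
  rw [h]
  have h3 : slobodeckijQuot s (⇑u + ⇑v) = slobodeckijQuot s u + slobodeckijQuot s v := by
    funext p
    simp only [slobodeckijQuot, Pi.add_apply]
    ring
  rw [h3]
  exact eLpNorm_add_le (measurable_slobodeckijQuot s hu).aestronglyMeasurable
    (measurable_slobodeckijQuot s hv).aestronglyMeasurable one_le_two

theorem slobodeckijSq_smul {d : ℕ} (s : ℝ) (c : ℝ) (u : Lp ℝ 2 (volume : Measure (Rd d))) :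
    slobodeckijSq s (c • u : Lp ℝ 2 (volume : Measure (Rd d))) =
      ENNReal.ofReal (c ^ 2) * slobodeckijSq s u := by
  rw [slobodeckijSq_congr s (Lp.coeFn_smul c u)]
  have hu := (Lp.stronglyMeasurable u).measurable
  rw [slobodeckijSq_eq s hu, slobodeckijSq_eq s (hu.const_smul c)]
  have h3 : slobodeckijQuot s (c • ⇑u) = c • slobodeckijQuot s u := by
    funext p
    simp only [slobodeckijQuot, Pi.smul_apply, smul_eq_mul]
    ring
  rw [h3, eLpNorm_const_smul, mul_pow, Real.enorm_eq_ofReal_abs,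
    ← ENNReal.ofReal_pow (abs_nonneg _), sq_abs]

/-- The Sobolev space `H^s(ℝ^d) = {u ∈ L²(ℝ^d) : |u|_{H^s(ℝ^d)} < ∞}`. -/
def sobolevHs (d : ℕ) (s : ℝ) : Submodule ℝ (Lp ℝ 2 (volume : Measure (Rd d))) where
  carrier := {u | slobodeckijSq s u < ⊤}
  zero_mem' := by
    have h := slobodeckijSq_smul s 0 (0 : Lp ℝ 2 (volume : Measure (Rd d)))
    simp only [smul_zero] at h
    change slobodeckijSq s (0 : Lp ℝ 2 (volume : Measure (Rd d))) < ⊤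
    rw [h]
    simp
  add_mem' := by
    intro u v hu hv
    simp only [Set.mem_ofPred_eq] at hu hv ⊢
    rw [slobodeckijSq_eq s (Lp.stronglyMeasurable _).measurable] at hu hv ⊢
    have hu' : eLpNorm (slobodeckijQuot s u) 2 (volume.prod volume) < ⊤ := by
      by_contra hcon
      simp [not_lt_top_iff.mp hcon] at hu
    have hv' : eLpNorm (slobodeckijQuot s v) 2 (volume.prod volume) < ⊤ := by
      by_contra hcon
      simp [not_lt_top_iff.mp hcon] at hv
    exact ENNReal.pow_lt_top
      ((slobodeckijSq_add_le s u v).trans_lt (ENNReal.add_lt_top.mpr ⟨hu', hv'⟩))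
  smul_mem' := by
    intro c u hu
    simp only [Set.mem_ofPred_eq] at hu ⊢
    rw [slobodeckijSq_smul]
    exact ENNReal.mul_lt_top ENNReal.ofReal_lt_top hu

/-- `H^s_0(ℝ^d; Ω) = {u ∈ H^s(ℝ^d) : u = 0 a.e. on ℝ^d \ closure Ω}`, as a subspace of
`L²(ℝ^d)`. -/
def hsZeroSubmodule {d : ℕ} (s : ℝ) (Ω : Set (Rd d)) :
    Submodule ℝ (Lp ℝ 2 (volume : Measure (Rd d))) where
  carrier := {u | u ∈ sobolevHs d s ∧ ∀ᵐ x, x ∉ closure Ω → u x = 0}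
  zero_mem' := by
    refine ⟨zero_mem _, ?_⟩
    filter_upwards [Lp.coeFn_zero ℝ 2 (volume : Measure (Rd d))] with x hx _
    exact hx
  add_mem' := by
    rintro u v ⟨hu, hu'⟩ ⟨hv, hv'⟩
    refine ⟨add_mem hu hv, ?_⟩
    filter_upwards [Lp.coeFn_add u v, hu', hv'] with x hx h1 h2 h
    exact hx.trans (by simp [h1 h, h2 h])
  smul_mem' := by
    rintro c u ⟨hu, hu'⟩
    refine ⟨Submodule.smul_mem _ c hu, ?_⟩
    filter_upwards [Lp.coeFn_smul c u, hu'] with x hx h1 h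
    exact hx.trans (by simp [h1 h])

/-- The space `H^s_0(ℝ^d; Ω)`, which carries the norm of `H^s(ℝ^d)` (not that of `L²(ℝ^d)`). -/
def HsZero {d : ℕ} (s : ℝ) (Ω : Set (Rd d)) : Type := ↥(hsZeroSubmodule s Ω)

namespace HsZero

variable {d : ℕ} {s : ℝ} {Ω : Set (Rd d)}

/-- The underlying element of `L²(ℝ^d)`. -/
def toL2 (u : HsZero s Ω) : Lp ℝ 2 (volume : Measure (Rd d)) := Subtype.val u

instance : CoeFun (HsZero s Ω) (fun _ => Rd d → ℝ) := ⟨fun u => u.toL2⟩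

instance : AddCommGroup (HsZero s Ω) := inferInstanceAs (AddCommGroup ↥(hsZeroSubmodule s Ω))

instance : Module ℝ (HsZero s Ω) := inferInstanceAs (Module ℝ ↥(hsZeroSubmodule s Ω))

/-- The norm on `H^s_0(ℝ^d; Ω)` is `‖u‖_{H^s(ℝ^d)}`. -/
instance : Norm (HsZero s Ω) := ⟨fun u => sobolevNorm s u.toL2⟩

theorem norm_def (u : HsZero s Ω) : ‖u‖ = sobolevNorm s u.toL2 := rfl

theorem toL2_injective : Function.Injective (toL2 : HsZero s Ω → _) := Subtype.val_injective

theorem toL2_add (u v : HsZero s Ω) : (u + v).toL2 = u.toL2 + v.toL2 := rfl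

theorem toL2_smul (c : ℝ) (u : HsZero s Ω) : (c • u).toL2 = c • u.toL2 := rfl

theorem slobodeckijSq_lt_top (u : HsZero s Ω) : slobodeckijSq s u < ⊤ := u.2.1

theorem norm_eq (u : HsZero s Ω) :
    ‖u‖ = ‖WithLp.toLp 2 ((‖u.toL2‖,
      (eLpNorm (slobodeckijQuot s u) 2 (volume.prod volume)).toReal) : ℝ × ℝ)‖ := by
  rw [norm_def, sobolevNorm, WithLp.prod_norm_eq_of_L2,
    slobodeckijSq_eq s (Lp.stronglyMeasurable _).measurable]
  simp

theorem normedSpaceCore : NormedSpace.Core ℝ (HsZero s Ω) where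
  norm_nonneg u := Real.sqrt_nonneg _
  norm_smul c u := by
    rw [norm_def, norm_def, toL2_smul, sobolevNorm, sobolevNorm, slobodeckijSq_smul, norm_smul,
      ENNReal.toReal_mul, ENNReal.toReal_ofReal (sq_nonneg c), mul_pow, Real.norm_eq_abs, sq_abs,
      ← mul_add, Real.sqrt_mul (sq_nonneg c), Real.sqrt_sq_eq_abs]
  norm_triangle u v := by
    have fin : ∀ w : HsZero s Ω, eLpNorm (slobodeckijQuot s w) 2 (volume.prod volume) ≠ ⊤ := by
      intro w hw
      have h := w.slobodeckijSq_lt_top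
      rw [slobodeckijSq_eq s (Lp.stronglyMeasurable _).measurable, hw] at h
      simp at h
    have h1 : ‖(u + v).toL2‖ ≤ ‖u.toL2‖ + ‖v.toL2‖ := norm_add_le _ _
    have h2 : (eLpNorm (slobodeckijQuot s (u + v : HsZero s Ω)) 2 (volume.prod volume)).toReal ≤
        (eLpNorm (slobodeckijQuot s u) 2 (volume.prod volume)).toReal +
        (eLpNorm (slobodeckijQuot s v) 2 (volume.prod volume)).toReal := by
      rw [← ENNReal.toReal_add (fin u) (fin v)]
      exact ENNReal.toReal_mono (ENNReal.add_ne_top.mpr ⟨fin u, fin v⟩)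
        (slobodeckijSq_add_le s u.toL2 v.toL2)
    rw [norm_eq, norm_eq u, norm_eq v]
    refine le_trans ?_ (norm_add_le _ _)
    rw [WithLp.prod_norm_eq_of_L2, WithLp.prod_norm_eq_of_L2]
    simp only [WithLp.add_fst, WithLp.add_snd, Real.norm_eq_abs, sq_abs]
    refine Real.sqrt_le_sqrt (add_le_add (pow_le_pow_left₀ (norm_nonneg _) h1 2)
      (pow_le_pow_left₀ ENNReal.toReal_nonneg h2 2))
  norm_eq_zero_iff u := by
    constructor
    · intro h
      apply toL2_injective
      rw [norm_def, sobolevNorm, Real.sqrt_eq_zero (by positivity)] at h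
      have h0 : ‖u.toL2‖ ^ 2 = 0 :=
        le_antisymm (by linarith [ENNReal.toReal_nonneg (a := slobodeckijSq s u)]) (sq_nonneg _)
      exact norm_eq_zero.mp (pow_eq_zero_iff two_ne_zero |>.mp h0)
    · rintro rfl
      have h := slobodeckijSq_smul s 0 (0 : Lp ℝ 2 (volume : Measure (Rd d)))
      have h0 : (0 : HsZero s Ω).toL2 = 0 := rfl
      simp only [smul_zero] at h
      rw [norm_def, sobolevNorm, h0, h]
      simp

instance : NormedAddCommGroup (HsZero s Ω) := NormedAddCommGroup.ofCore normedSpaceCore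

instance : NormedSpace ℝ (HsZero s Ω) := NormedSpace.ofCore normedSpaceCore

end HsZero

/-! ### The Beppo-Levi space on the half-space -/

/-- The open half-space `ℝ^{d+1}_+ = ℝ^d × (0, ∞)`; a point is written `p = (x, x_{d+1})`. -/
def halfSpace (d : ℕ) : Opens (Rd d × ℝ) :=
  ⟨{p | 0 < p.2}, isOpen_lt continuous_const continuous_snd⟩

/-- The values of gradients on the half-space: `ℝ^d × ℝ` with the Euclidean inner product. -/
abbrev GradVec (d : ℕ) : Type := WithLp 2 (Rd d × ℝ)

/-- The measure `x_{d+1}^α dx` on the half-space; `L²_α(ℝ^{d+1}_+)` is `L²` of this measure. -/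
def weightedMeasure (d : ℕ) (α : ℝ) : Measure (Rd d × ℝ) :=
  (volume.restrict (halfSpace d : Set (Rd d × ℝ))).withDensity
    (fun p => ENNReal.ofReal (p.2 ^ α))

/-- The distribution `T` on the half-space is the locally integrable function `w`. -/
def Represents {d : ℕ} (T : 𝓓'(halfSpace d, ℝ)) (w : Rd d × ℝ → ℝ) : Prop :=
  LocallyIntegrableOn w (halfSpace d : Set (Rd d × ℝ)) ∧
    ∀ φ : 𝓓(halfSpace d, ℝ), T φ = ∫ p, φ p * w p

/-- The vector field `G` is the distributional gradient of `T`. -/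
def IsGradient {d : ℕ} (T : 𝓓'(halfSpace d, ℝ)) (G : Rd d × ℝ → GradVec d) : Prop :=
  ∀ v : Rd d × ℝ, Represents (∂_{v} T) (fun p => inner ℝ (G p) (WithLp.toLp 2 v))

/-- The Beppo-Levi space `B¹_α(ℝ^{d+1}_+)` of all distributions on the half-space with gradient
in `L²_α(ℝ^{d+1}_+)`. -/
def MemBeppoLevi {d : ℕ} (α : ℝ) (T : 𝓓'(halfSpace d, ℝ)) : Prop :=
  ∃ G, IsGradient T G ∧ MemLp G 2 (weightedMeasure d α)

open scoped Classical in
/-- The gradient of a distribution, as a function (unique almost everywhere on the half-space);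
zero if the gradient is not a locally integrable function. -/
def distGrad {d : ℕ} (T : 𝓓'(halfSpace d, ℝ)) : Rd d × ℝ → GradVec d :=
  if h : ∃ G, IsGradient T G then h.choose else 0

/-- The classical gradient `(∇_x φ, ∂_{d+1} φ)`. -/
def classicalGrad {d : ℕ} (φ : Rd d × ℝ → ℝ) (p : Rd d × ℝ) : GradVec d :=
  WithLp.toLp 2 (∇ (fun x => φ (x, p.2)) p.1, deriv (fun t => φ (p.1, t)) p.2)

/-- `tr T = g`, where `tr` is the continuous extension to `B¹_α(ℝ^{d+1}_+)` of the classical trace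
`φ ↦ φ(·, 0)` on functions that are smooth up to the boundary: there are smooth `φ_n` with
`φ_n → T` in `B¹_α(ℝ^{d+1}_+)`, that is, in `L²_α` on bounded sets and with convergence of the
gradients in `L²_α(ℝ^{d+1}_+)`, such that `φ_n(·, 0) → g` in `L²_loc(ℝ^d)`. -/
def IsTrace {d : ℕ} (α : ℝ) (T : 𝓓'(halfSpace d, ℝ)) (g : Rd d → ℝ) : Prop :=
  ∃ w : Rd d × ℝ → ℝ, Represents T w ∧
    ∃ φ : ℕ → Rd d × ℝ → ℝ,
      (∀ n, ContDiff ℝ ((⊤ : ℕ∞) : WithTop ℕ∞) (φ n)) ∧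
      (∀ n, MemLp (classicalGrad (φ n)) 2 (weightedMeasure d α)) ∧
      (∀ R : ℝ, Tendsto (fun n => eLpNorm (fun p => φ n p - w p) 2
        ((weightedMeasure d α).restrict (Metric.ball 0 R))) atTop (𝓝 0)) ∧
      Tendsto (fun n => eLpNorm (fun p => classicalGrad (φ n) p - distGrad T p) 2
        (weightedMeasure d α)) atTop (𝓝 0) ∧
      (∀ R : ℝ, Tendsto (fun n => eLpNorm (fun x => φ n (x, 0) - g x) 2
        (volume.restrict (Metric.ball 0 R))) atTop (𝓝 0))

/-! ### The harmonic extension and the bilinear form -/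

/-- `T` minimizes `‖∇T‖_{L²_α(ℝ^{d+1}_+)}`, `α = 1 - 2s`, among all elements of
`B¹_α(ℝ^{d+1}_+)` with trace `u`. -/
def IsMinNormExtension {d : ℕ} (s : ℝ) (u : Rd d → ℝ) (T : 𝓓'(halfSpace d, ℝ)) : Prop :=
  MemBeppoLevi (1 - 2 * s) T ∧ IsTrace (1 - 2 * s) T u ∧
    ∀ T' : 𝓓'(halfSpace d, ℝ), MemBeppoLevi (1 - 2 * s) T' → IsTrace (1 - 2 * s) T' u →
      eLpNorm (distGrad T) 2 (weightedMeasure d (1 - 2 * s)) ≤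
        eLpNorm (distGrad T') 2 (weightedMeasure d (1 - 2 * s))

open scoped Classical in
/-- The minimum norm (or harmonic) extension `ℒ u`. -/
def harmonicExtension {d : ℕ} (s : ℝ) (u : Rd d → ℝ) : 𝓓'(halfSpace d, ℝ) :=
  if h : ∃ T, IsMinNormExtension s u T then h.choose else 0

/-- The bilinear form `∫_{ℝ^{d+1}_+} x_{d+1}^{1-2s} ∇ℒu · ∇ℒv dx`. -/
def extensionForm {d : ℕ} (s : ℝ) (u v : Rd d → ℝ) : ℝ :=
  ∫ p in (halfSpace d : Set (Rd d × ℝ)), p.2 ^ (1 - 2 * s) *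
    inner ℝ (distGrad (harmonicExtension s u) p) (distGrad (harmonicExtension s v) p)

/-- `u ∈ H^s_0(ℝ^d; Ω)` solves the variational problem with right-hand side `f ∈ H^{-s}(Ω)`:
`∫_{ℝ^{d+1}_+} x_{d+1}^{1-2s} ∇ℒu · ∇ℒv dx = ⟨f, v⟩` for all `v ∈ H^s_0(ℝ^d; Ω)`. Here
`H^{-s}(Ω)` is the dual space of `H^s_0(ℝ^d; Ω)`. -/
def IsSolution {d : ℕ} {s : ℝ} {Ω : Set (Rd d)} (f : StrongDual ℝ (HsZero s Ω))
    (u : HsZero s Ω) : Prop :=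
  ∀ v : HsZero s Ω, extensionForm s u v = f v

end

/-! ### The weighted measure -/

/-! The proof moves the minimization over distributions into a Hilbert space and then applies the
Riesz representation theorem.

Reduction. A Beppo-Levi distribution with gradient `G` and trace `g` is the function `g(x) + ∫₀ᵗ
G_{d+1}(x, τ) dτ`; the integral exists for almost every `x` because `α < 1`. The distributions with
a trace in `L²(ℝ^d)` are therefore encoded by the pairs `(G, g)` in `gradTrace`, a closed subspace
of `L²_α × L²(ℝ^d)`. Minimizing `‖G‖` for fixed `g` amounts to removing from `G` its projection onto
the gradients of trace zero. So a minimizer exists as soon as one admissible `G` does, it is unique,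
and it depends linearly on `g` (`isMinNormExtension_iff`, `isMinGrad_iff`).

An admissible gradient for `u ∈ H^s`. Averaging `u` at scale `√(t² + ε²)` gives a function smooth up
to the boundary whose energy is at most a multiple of `|u|²_{H^s}`, uniformly in `ε`
(`exists_lintegral_smoothExt_le`), and whose trace tends to `u` in `L²` as `ε → 0`. A convexity
argument yields a gradient with trace exactly `u` (`exists_gradTrace`).

Coercivity. For smooth `φ`, the values at `(x, 0)` and `(x + h, 0)` are compared along the path
through height `‖h‖`. Hardy's inequality controls the vertical legs and the horizontal gradient
controls the middle one, which bounds `|φ(·, 0)|_{H^s}` by the energy; Fatou's lemma extends this to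
`gradTrace` (`exists_slobodeckijSq_le`). As `Ω` is bounded, a fractional Poincaré inequality adds
the `L²` norm.

Conclusion. The linear map `A u = ∇ℒu` satisfies `‖u‖ ≤ C ‖A u‖`, and its range is closed
(`isClosed_range_minGrad`). The form is `⟪A u, A v⟫`, so the Riesz theorem on the range, applied to
`f ∘ A⁻¹`, gives the solution. Testing with `u` itself gives the bound with constant `C²`. -/

theorem halfSpace_eq_prod (d : ℕ) :
    (halfSpace d : Set (Rd d × ℝ)) = Set.univ ×ˢ Set.Ioi (0 : ℝ) := by
  ext p
  simp [halfSpace]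

theorem measurableSet_halfSpace (d : ℕ) : MeasurableSet (halfSpace d : Set (Rd d × ℝ)) :=
  (halfSpace d).isOpen.measurableSet

theorem lintegral_weightedMeasure {d : ℕ} (α : ℝ) {f : Rd d × ℝ → ℝ≥0∞} (hf : Measurable f) :
    ∫⁻ p, f p ∂weightedMeasure d α =
      ∫⁻ x, ∫⁻ t in Set.Ioi (0 : ℝ), ENNReal.ofReal (t ^ α) * f (x, t) := by
  rw [weightedMeasure, lintegral_withDensity_eq_lintegral_mul _ (by fun_prop) hf,
    halfSpace_eq_prod, Measure.volume_eq_prod, ← Measure.prod_restrict, lintegral_prod]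
  · simp
  · exact Measurable.aemeasurable (by fun_prop)

theorem lintegral_weightedMeasure_ball {d : ℕ} (α R : ℝ) {f : Rd d × ℝ → ℝ≥0∞}
    (hf : Measurable f) :
    ∫⁻ p in Metric.ball 0 R, f p ∂weightedMeasure d α =
      ∫⁻ x in Metric.ball 0 R, ∫⁻ t in Set.Ioo 0 R, ENNReal.ofReal (t ^ α) * f (x, t) := by
  rw [← lintegral_indicator measurableSet_ball,
    lintegral_weightedMeasure α (hf.indicator measurableSet_ball),
    ← lintegral_indicator measurableSet_ball]
  refine lintegral_congr fun x => ?_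
  -- The product carries the maximum norm, so a ball is a cylinder and its part in the half-space is
  -- `ball 0 R × (0, R)`.
  have hb : (Metric.ball 0 R : Set (Rd d × ℝ)) = Metric.ball 0 R ×ˢ Metric.ball 0 R :=
    (ball_prod_same _ _ _).symm
  by_cases hx : x ∈ Metric.ball 0 R
  · rw [Set.indicator_of_mem hx, ← lintegral_indicator measurableSet_Ioi,
      ← lintegral_indicator measurableSet_Ioo]
    refine lintegral_congr fun t => ?_
    by_cases ht : 0 < t
    · by_cases htR : t < R
      · have : t ∈ Metric.ball 0 R := by simp [abs_of_pos ht, htR]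
        rw [Set.indicator_of_mem (show t ∈ Set.Ioi 0 from ht), Set.indicator_of_mem,
          Set.indicator_of_mem (show t ∈ Set.Ioo 0 R from ⟨ht, htR⟩)]
        rw [hb]; exact ⟨hx, this⟩
      · have : t ∉ Metric.ball 0 R := by simpa [abs_of_pos ht] using htR
        rw [Set.indicator_of_notMem (s := Set.Ioo 0 R) (fun h => htR h.2),
          Set.indicator_of_mem (show t ∈ Set.Ioi 0 from ht), Set.indicator_of_notMem, mul_zero]
        rw [hb]; exact fun h => this h.2
    · rw [Set.indicator_of_notMem (s := Set.Ioo 0 R) (fun h => ht h.1),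
        Set.indicator_of_notMem (s := Set.Ioi 0) ht]
  · rw [Set.indicator_of_notMem hx]
    have : ∀ t, (Metric.ball (0 : Rd d × ℝ) R).indicator f (x, t) = 0 := fun t =>
      Set.indicator_of_notMem (by rw [hb]; exact fun h => hx h.1) _
    simp [this]

/-- The density `t ^ α` is positive on the half-space, so the two measures have the same null sets.
-/
theorem ae_weightedMeasure_iff {d : ℕ} (α : ℝ) {P : Rd d × ℝ → Prop} :
    (∀ᵐ p ∂weightedMeasure d α, P p) ↔
      ∀ᵐ p ∂volume.restrict (halfSpace d : Set (Rd d × ℝ)), P p := by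
  rw [weightedMeasure, ae_withDensity_iff (by fun_prop)]
  refine eventually_congr ?_
  filter_upwards [ae_restrict_mem (measurableSet_halfSpace d)] with p hp
  have : ENNReal.ofReal (p.2 ^ α) ≠ 0 := by
    simpa using Real.rpow_pos_of_pos hp α
  simp [this]

theorem eLpNorm_two_sq {X F : Type*} [MeasurableSpace X] [NormedAddCommGroup F]
    (μ : Measure X) (f : X → F) : eLpNorm f 2 μ ^ 2 = ∫⁻ x, ‖f x‖ₑ ^ 2 ∂μ := by
  simpa using eLpNorm_nnreal_pow_eq_lintegral (f := f) (μ := μ) (p := 2) two_ne_zero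

/-! ### Classical gradients -/

/-- Linearity, continuity and norm bounds for `classicalGrad` are all derived from the Fréchet
derivative through this identity. -/
theorem inner_classicalGrad {d : ℕ} {φ : Rd d × ℝ → ℝ} {p : Rd d × ℝ}
    (hφ : DifferentiableAt ℝ φ p) (v : Rd d × ℝ) :
    inner ℝ (classicalGrad φ p) (WithLp.toLp 2 v) = fderiv ℝ φ p v := by
  have h1 : HasFDerivAt (fun x => φ (x, p.2)) ((fderiv ℝ φ p).comp (.inl ℝ _ _)) p.1 :=
    HasFDerivAt.comp (g := φ) (f := fun x => (x, p.2)) p.1 hφ.hasFDerivAt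
      (hasFDerivAt_prodMk_left p.1 p.2)
  have h2 : HasFDerivAt (fun t => φ (p.1, t)) ((fderiv ℝ φ p).comp (.inr ℝ _ _)) p.2 :=
    HasFDerivAt.comp (g := φ) (f := fun t => (p.1, t)) p.2 hφ.hasFDerivAt
      (hasFDerivAt_prodMk_right p.1 p.2)
  rw [classicalGrad, WithLp.prod_inner_apply, h2.hasDerivAt.deriv, gradient, h1.fderiv]
  simp only [InnerProductSpace.toDual_symm_apply]
  have : v = (v.1, 0) + v.2 • (0, 1) := by ext <;> simp
  conv_rhs => rw [this, map_add, map_smul]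
  simp

theorem hasDerivAt_snd_of_differentiableAt {d : ℕ} {φ : Rd d × ℝ → ℝ} {x : Rd d} {t : ℝ}
    (hφ : DifferentiableAt ℝ φ (x, t)) :
    HasDerivAt (fun τ => φ (x, τ)) (classicalGrad φ (x, t)).snd t := by
  have h2 : HasFDerivAt (fun t => φ (x, t)) ((fderiv ℝ φ (x, t)).comp (.inr ℝ _ _)) t :=
    HasFDerivAt.comp (g := φ) (f := fun t => (x, t)) t hφ.hasFDerivAt
      (hasFDerivAt_prodMk_right x t)
  exact h2.differentiableAt.hasDerivAt

/-- Apply the derivative to the gradient itself. The maximum norm on `Rd d × ℝ` is at most the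
Euclidean norm, which gives the inequality in this direction. -/
theorem norm_classicalGrad_le {d : ℕ} {φ : Rd d × ℝ → ℝ} {p : Rd d × ℝ}
    (hφ : DifferentiableAt ℝ φ p) : ‖classicalGrad φ p‖ ≤ ‖fderiv ℝ φ p‖ := by
  have h := inner_classicalGrad hφ (WithLp.ofLp (classicalGrad φ p))
  rw [WithLp.toLp_ofLp, real_inner_self_eq_norm_sq] at h
  have h1 : ‖WithLp.ofLp (classicalGrad φ p)‖ ≤ ‖classicalGrad φ p‖ := by
    rw [Prod.norm_def, WithLp.prod_norm_eq_of_L2]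
    refine max_le ?_ ?_ <;> refine Real.le_sqrt_of_sq_le ?_ <;> simp [sq_nonneg]
  have h2 : ‖classicalGrad φ p‖ ^ 2 ≤ ‖fderiv ℝ φ p‖ * ‖classicalGrad φ p‖ := by
    rw [h]
    exact (le_abs_self _).trans ((fderiv ℝ φ p).le_opNorm _ |>.trans (by gcongr))
  by_contra hc
  push Not at hc
  nlinarith [norm_nonneg (fderiv ℝ φ p)]

theorem classicalGrad_eq {d : ℕ} {φ : Rd d × ℝ → ℝ} (hφ : Differentiable ℝ φ) :
    classicalGrad φ = fun p => WithLp.toLp 2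
      ((InnerProductSpace.toDual ℝ (Rd d)).symm ((fderiv ℝ φ p).comp (.inl ℝ _ _)),
        fderiv ℝ φ p (0, 1)) := by
  funext p
  refine ext_inner_right ℝ fun v => ?_
  have h := inner_classicalGrad (hφ p) (WithLp.ofLp v)
  rw [WithLp.toLp_ofLp] at h
  rw [h, WithLp.prod_inner_apply]
  simp only [InnerProductSpace.toDual_symm_apply]
  have : WithLp.ofLp v = (v.fst, 0) + v.snd • (0, 1) := by ext <;> simp
  rw [this, map_add, map_smul]
  simp

theorem continuous_classicalGrad {d : ℕ} {φ : Rd d × ℝ → ℝ}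
    (hφ : ContDiff ℝ ((⊤ : ℕ∞) : WithTop ℕ∞) φ) : Continuous (classicalGrad φ) := by
  have h1 : Continuous (fderiv ℝ φ) := hφ.continuous_fderiv (by simp)
  rw [classicalGrad_eq (hφ.differentiable (by simp))]
  fun_prop

theorem classicalGrad_add {d : ℕ} {φ ψ : Rd d × ℝ → ℝ} (hφ : Differentiable ℝ φ)
    (hψ : Differentiable ℝ ψ) :
    classicalGrad (φ + ψ) = classicalGrad φ + classicalGrad ψ := by
  funext p
  refine ext_inner_right ℝ fun v => ?_
  have h := inner_classicalGrad ((hφ.add hψ) p) (WithLp.ofLp v)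
  rw [fderiv_add (hφ p) (hψ p)] at h
  rw [Pi.add_apply, inner_add_left]
  simpa [← inner_classicalGrad (hφ p), ← inner_classicalGrad (hψ p)] using h

theorem classicalGrad_smul {d : ℕ} {φ : Rd d × ℝ → ℝ} (hφ : Differentiable ℝ φ) (c : ℝ) :
    classicalGrad (c • φ) = c • classicalGrad φ := by
  funext p
  refine ext_inner_right ℝ fun v => ?_
  have h := inner_classicalGrad ((hφ.const_smul c) p) (WithLp.ofLp v)
  rw [fderiv_const_smul (hφ p)] at h
  rw [Pi.smul_apply, real_inner_smul_left]
  simpa [← inner_classicalGrad (hφ p)] using h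

/-! ### Smooth functions with square integrable gradient -/

/-- The functions that are smooth up to the boundary and have a gradient in `L²_α`. -/
def smoothFun (d : ℕ) (α : ℝ) : Submodule ℝ (Rd d × ℝ → ℝ) where
  carrier := {φ | ContDiff ℝ ((⊤ : ℕ∞) : WithTop ℕ∞) φ ∧
    MemLp (classicalGrad φ) 2 (weightedMeasure d α)}
  zero_mem' := by
    refine ⟨contDiff_const, ?_⟩
    have h := classicalGrad_smul (d := d) (φ := 0) (differentiable_const 0) 0
    rw [zero_smul, zero_smul] at h
    rw [h]
    exact MemLp.zero
  add_mem' := by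
    rintro φ ψ ⟨hφ, hφ'⟩ ⟨hψ, hψ'⟩
    refine ⟨hφ.add hψ, ?_⟩
    rw [classicalGrad_add (hφ.differentiable (by simp)) (hψ.differentiable (by simp))]
    exact hφ'.add hψ'
  smul_mem' := by
    rintro c φ ⟨hφ, hφ'⟩
    refine ⟨hφ.const_smul c, ?_⟩
    rw [classicalGrad_smul (hφ.differentiable (by simp))]
    exact hφ'.const_smul c

/-- The space `L²_α(ℝ^{d+1}_+)` of vector fields. -/
abbrev GradL2 (d : ℕ) (α : ℝ) : Type := Lp (GradVec d) 2 (weightedMeasure d α)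

/-- The gradient as a map into `L²_α`. -/
noncomputable def gradL {d : ℕ} {α : ℝ} : smoothFun d α →ₗ[ℝ] GradL2 d α where
  toFun φ := φ.2.2.toLp _
  map_add' φ ψ := by
    rw [← MemLp.toLp_add]
    exact MemLp.toLp_congr _ _ (Eventually.of_forall fun p => congrFun (classicalGrad_add
      (φ.2.1.differentiable (by simp)) (ψ.2.1.differentiable (by simp))) p)
  map_smul' c φ := by
    rw [RingHom.id_apply, ← MemLp.toLp_const_smul]
    exact MemLp.toLp_congr _ _ (Eventually.of_forall fun p => congrFun (classicalGrad_smul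
      (φ.2.1.differentiable (by simp)) c) p)

theorem coeFn_gradL {d : ℕ} {α : ℝ} (φ : smoothFun d α) :
    gradL φ =ᵐ[weightedMeasure d α] classicalGrad φ := φ.2.2.coeFn_toLp

theorem enorm_gradL_sub {d : ℕ} {α : ℝ} (φ : smoothFun d α) (G : GradL2 d α) :
    ‖gradL φ - G‖ₑ =
      eLpNorm (fun p => classicalGrad φ p - G p) 2 (weightedMeasure d α) := by
  rw [Lp.enorm_def]
  refine eLpNorm_congr_ae ?_
  filter_upwards [Lp.coeFn_sub (gradL φ) G, coeFn_gradL φ] with p h1 h2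
  rw [h1, Pi.sub_apply, h2]

/-! ### One-dimensional estimates -/

theorem lintegral_mul_sq_le {X : Type*} [MeasurableSpace X] (μ : Measure X) {f g : X → ℝ≥0∞}
    (hf : AEMeasurable f μ) (hg : AEMeasurable g μ) :
    (∫⁻ x, f x * g x ∂μ) ^ 2 ≤ (∫⁻ x, f x ^ 2 ∂μ) * ∫⁻ x, g x ^ 2 ∂μ := by
  have h := ENNReal.lintegral_mul_le_Lp_mul_Lq μ Real.HolderConjugate.two_two hf hg
  simp only [Pi.mul_apply, ENNReal.rpow_two] at h
  calc (∫⁻ x, f x * g x ∂μ) ^ 2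
      ≤ ((∫⁻ x, f x ^ 2 ∂μ) ^ (1 / (2 : ℝ)) * (∫⁻ x, g x ^ 2 ∂μ) ^ (1 / (2 : ℝ))) ^ 2 := by
        gcongr
    _ = _ := by
        rw [mul_pow, ← ENNReal.rpow_two, ← ENNReal.rpow_mul, ← ENNReal.rpow_two,
          ← ENNReal.rpow_mul]
        norm_num

theorem lintegral_rpow_Ioo {r t : ℝ} (hr : -1 < r) (ht : 0 ≤ t) :
    ∫⁻ τ in Set.Ioo 0 t, ENNReal.ofReal (τ ^ r) = ENNReal.ofReal (t ^ (r + 1) / (r + 1)) := by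
  have h := integral_rpow (a := 0) (b := t) (r := r) (Or.inl hr)
  rw [intervalIntegral.integral_of_le ht, Real.zero_rpow (by linarith), sub_zero] at h
  rw [← h, Measure.restrict_congr_set Ioo_ae_eq_Ioc, ofReal_integral_eq_lintegral_ofReal]
  · exact (intervalIntegral.intervalIntegrable_rpow' hr).1
  · filter_upwards [ae_restrict_mem measurableSet_Ioc] with τ hτ
    exact Real.rpow_nonneg hτ.1.le _

theorem lintegral_rpow_Ioi {r c : ℝ} (hr : r < -1) (hc : 0 < c) :
    ∫⁻ τ in Set.Ioi c, ENNReal.ofReal (τ ^ r) =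
      ENNReal.ofReal (c ^ (r + 1) / (-(r + 1))) := by
  rw [← ofReal_integral_eq_lintegral_ofReal (integrableOn_Ioi_rpow_of_lt hr hc),
    integral_Ioi_rpow_of_lt hr hc, neg_div, div_neg]
  filter_upwards [ae_restrict_mem measurableSet_Ioi] with τ hτ
  exact Real.rpow_nonneg (hc.le.trans (le_of_lt hτ)) _

/-- The weighted Cauchy-Schwarz inequality behind the inequalities of Hardy and Poincaré. -/
theorem sq_lintegral_Ioo_le {β t : ℝ} (hβ : β < 1) (ht : 0 ≤ t) {f : ℝ → ℝ≥0∞}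
    (hf : AEMeasurable f (volume.restrict (Set.Ioo 0 t))) :
    (∫⁻ τ in Set.Ioo 0 t, f τ) ^ 2 ≤ ENNReal.ofReal (t ^ (1 - β) / (1 - β)) *
      ∫⁻ τ in Set.Ioo 0 t, ENNReal.ofReal (τ ^ β) * f τ ^ 2 := by
  -- Split `f = τ^(-β/2) · τ^(β/2) f`; the squared first factor `τ^(-β)` is integrable at `0`
  -- because `β < 1`.
  have h := lintegral_mul_sq_le (volume.restrict (Set.Ioo 0 t))
    (f := fun τ => ENNReal.ofReal (τ ^ (-β / 2))) (g := fun τ => ENNReal.ofReal (τ ^ (β / 2)) * f τ)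
    (by fun_prop) (by fun_prop)
  have e1 : ∫⁻ τ in Set.Ioo 0 t, ENNReal.ofReal (τ ^ (-β / 2)) *
      (ENNReal.ofReal (τ ^ (β / 2)) * f τ) = ∫⁻ τ in Set.Ioo 0 t, f τ := by
    refine setLIntegral_congr_fun measurableSet_Ioo fun τ hτ => ?_
    rw [← mul_assoc, ← ENNReal.ofReal_mul (Real.rpow_nonneg hτ.1.le _), ← Real.rpow_add hτ.1,
      neg_div, neg_add_cancel, Real.rpow_zero, ENNReal.ofReal_one, one_mul]
  have e2 : ∫⁻ τ in Set.Ioo 0 t, ENNReal.ofReal (τ ^ (-β / 2)) ^ 2 =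
      ENNReal.ofReal (t ^ (1 - β) / (1 - β)) := by
    rw [show (1 : ℝ) - β = -β + 1 by ring, ← lintegral_rpow_Ioo (by linarith) ht]
    refine setLIntegral_congr_fun measurableSet_Ioo fun τ hτ => ?_
    rw [← ENNReal.ofReal_pow (Real.rpow_nonneg hτ.1.le _), ← Real.rpow_mul_natCast hτ.1.le]
    congr 2; push_cast; ring
  have e3 : ∫⁻ τ in Set.Ioo 0 t, (ENNReal.ofReal (τ ^ (β / 2)) * f τ) ^ 2 =
      ∫⁻ τ in Set.Ioo 0 t, ENNReal.ofReal (τ ^ β) * f τ ^ 2 := by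
    refine setLIntegral_congr_fun measurableSet_Ioo fun τ hτ => ?_
    rw [mul_pow, ← ENNReal.ofReal_pow (Real.rpow_nonneg hτ.1.le _),
      ← Real.rpow_mul_natCast hτ.1.le]
    congr 3; push_cast; ring
  rwa [e1, e2, e3] at h

theorem ENNReal.add_sq_le_two_mul (a b : ℝ≥0∞) : (a + b) ^ 2 ≤ 2 * a ^ 2 + 2 * b ^ 2 := by
  have h := ENNReal.rpow_add_le_mul_rpow_add_rpow a b (p := 2) (by norm_num)
  simp only [ENNReal.rpow_two] at h
  refine h.trans_eq ?_
  norm_num [mul_add]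

/-! ### Primitives in the last variable -/

/-- The function with boundary values `g` and last partial derivative `G_{d+1}`. -/
noncomputable def primitive {d : ℕ} (G : Rd d × ℝ → GradVec d) (g : Rd d → ℝ) (p : Rd d × ℝ) :
    ℝ :=
  g p.1 + ∫ τ in Set.Ioo 0 p.2, (G (p.1, τ)).snd

theorem measurable_primitive {d : ℕ} {G : Rd d × ℝ → GradVec d} {g : Rd d → ℝ}
    (hG : Measurable G) (hg : Measurable g) : Measurable (primitive G g) := by
  unfold primitive
  have hS : Measurable (fun v : GradVec d => v.snd) :=
    (WithLp.prod_continuous_ofLp 2 _ _).snd.measurable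
  -- The domain of integration depends on the point, so the integral is rewritten over all of `ℝ`
  -- with a jointly measurable indicator.
  have h : StronglyMeasurable (fun q : (Rd d × ℝ) × ℝ =>
      {q : (Rd d × ℝ) × ℝ | 0 < q.2 ∧ q.2 < q.1.2}.indicator
        (fun q => (G (q.1.1, q.2)).snd) q) := by
    refine Measurable.stronglyMeasurable (Measurable.indicator (by fun_prop) ?_)
    exact (measurableSet_lt measurable_const measurable_snd).inter
      (measurableSet_lt measurable_snd (by fun_prop))
  have h2 := h.integral_prod_right' (ν := (volume : Measure ℝ))
  have e : (fun p : Rd d × ℝ => ∫ τ in Set.Ioo 0 p.2, (G (p.1, τ)).snd) = fun p =>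
      ∫ τ, {q : (Rd d × ℝ) × ℝ | 0 < q.2 ∧ q.2 < q.1.2}.indicator
        (fun q => (G (q.1.1, q.2)).snd) (p, τ) := by
    funext p
    rw [← integral_indicator measurableSet_Ioo]
    rfl
  exact (hg.comp measurable_fst).add (e ▸ h2.measurable)

/-- By Tonelli almost every vertical slice of `G` has finite weighted energy, and for `α < 1`
Cauchy-Schwarz makes it integrable down to height `0`. The exceptional set of `x` is the same for
all `t`. -/
theorem ae_integrableOn_snd {d : ℕ} {α : ℝ} (hα : α < 1) {G : Rd d × ℝ → GradVec d}
    (hG : Measurable G) (hG2 : MemLp G 2 (weightedMeasure d α)) :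
    ∀ᵐ x : Rd d, ∀ t : ℝ, IntegrableOn (fun τ => (G (x, τ)).snd) (Set.Ioo 0 t) := by
  have hS : Measurable (fun v : GradVec d => v.snd) :=
    (WithLp.prod_continuous_ofLp 2 _ _).snd.measurable
  have h1 : ∫⁻ x, ∫⁻ t in Set.Ioi (0 : ℝ), ENNReal.ofReal (t ^ α) * ‖G (x, t)‖ₑ ^ 2 ≠ ⊤ := by
    rw [← lintegral_weightedMeasure α (f := fun p => ‖G p‖ₑ ^ 2) (by fun_prop), ← eLpNorm_two_sq]
    exact ENNReal.pow_ne_top hG2.2.ne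
  have hm : Measurable fun x =>
      ∫⁻ t in Set.Ioi (0 : ℝ), ENNReal.ofReal (t ^ α) * ‖G (x, t)‖ₑ ^ 2 := by
    refine Measurable.lintegral_prod_right' (f := fun q : Rd d × ℝ =>
      ENNReal.ofReal (q.2 ^ α) * ‖G q‖ₑ ^ 2) (by fun_prop)
  filter_upwards [ae_lt_top hm h1] with x hx t
  refine ⟨Measurable.aestronglyMeasurable (by fun_prop), ?_⟩
  rcases le_or_gt t 0 with ht | ht
  · simp [HasFiniteIntegral, Set.Ioo_eq_empty (not_lt.mpr ht)]
  have h2 : (∫⁻ τ in Set.Ioo 0 t, ‖(G (x, τ)).snd‖ₑ) ^ 2 < ⊤ := by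
    refine (sq_lintegral_Ioo_le hα ht.le (Measurable.aemeasurable (by fun_prop))).trans_lt
      (ENNReal.mul_lt_top ENNReal.ofReal_lt_top (lt_of_le_of_lt ?_ hx))
    refine (lintegral_mono_set Set.Ioo_subset_Ioi_self).trans (lintegral_mono fun τ => ?_)
    gcongr
    exact WithLp.enorm_snd_le ..
  by_contra hc
  rw [HasFiniteIntegral, not_lt, top_le_iff] at hc
  rw [hc] at h2
  simp at h2

theorem continuous_lineSlice {d : ℕ} {φ : Rd d × ℝ → ℝ}
    (hφ : ContDiff ℝ ((⊤ : ℕ∞) : WithTop ℕ∞) φ) (x : Rd d) :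
    Continuous (fun τ => (classicalGrad φ (x, τ)).snd) :=
  ((WithLp.prod_continuous_ofLp 2 _ _).snd.comp (continuous_classicalGrad hφ)).comp
    (by fun_prop)

theorem primitive_classicalGrad {d : ℕ} {φ : Rd d × ℝ → ℝ}
    (hφ : ContDiff ℝ ((⊤ : ℕ∞) : WithTop ℕ∞) φ) {x : Rd d} {t : ℝ} (ht : 0 ≤ t) :
    φ (x, t) = φ (x, 0) + ∫ τ in Set.Ioo 0 t, (classicalGrad φ (x, τ)).snd := by
  have h := intervalIntegral.integral_eq_sub_of_hasDerivAt (a := 0) (b := t)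
    (f := fun τ => φ (x, τ)) (fun τ _ => hasDerivAt_snd_of_differentiableAt
      (hφ.differentiable (by simp) (x, τ))) ((continuous_lineSlice hφ x).intervalIntegrable _ _)
  rw [intervalIntegral.integral_of_le ht, ← Measure.restrict_congr_set Ioo_ae_eq_Ioc] at h
  rw [h]; ring

/-- At `(x, t)` the difference is the error of the trace plus `∫₀ᵗ` of the error of the last
derivative. The latter is bounded by weighted Cauchy-Schwarz, with constant `R^(1-α)/(1-α)`; the
outer factor is `∫₀ᴿ t^α dt`. Convergence of gradients and traces therefore forces convergence in
`L²_α` on bounded sets. -/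
theorem eLpNorm_sub_primitive_sq_le {d : ℕ} {α : ℝ} (hα0 : -1 < α) (hα1 : α < 1) {R : ℝ}
    (hR : 0 < R) {φ : Rd d × ℝ → ℝ} (hφ : ContDiff ℝ ((⊤ : ℕ∞) : WithTop ℕ∞) φ)
    {G : Rd d × ℝ → GradVec d} (hG : Measurable G) (hG2 : MemLp G 2 (weightedMeasure d α))
    {g : Rd d → ℝ} (hg : Measurable g) :
    eLpNorm (fun p => φ p - primitive G g p) 2
        ((weightedMeasure d α).restrict (Metric.ball 0 R)) ^ 2 ≤
      ENNReal.ofReal (R ^ (α + 1) / (α + 1)) *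
        (2 * eLpNorm (fun x => φ (x, 0) - g x) 2 (volume.restrict (Metric.ball 0 R)) ^ 2 +
          2 * (ENNReal.ofReal (R ^ (1 - α) / (1 - α)) *
            eLpNorm (fun p => classicalGrad φ p - G p) 2 (weightedMeasure d α) ^ 2)) := by
  have hS : Measurable (fun v : GradVec d => v.snd) :=
    (WithLp.prod_continuous_ofLp 2 _ _).snd.measurable
  have hP := measurable_primitive hG hg
  have hφm : Measurable φ := hφ.continuous.measurable
  have hφg : Measurable (classicalGrad φ) := (continuous_classicalGrad hφ).measurable
  simp only [eLpNorm_two_sq]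
  rw [lintegral_weightedMeasure_ball α R (by fun_prop), lintegral_weightedMeasure α (by fun_prop)]
  set N : Rd d → ℝ≥0∞ := fun x => ∫⁻ t in Set.Ioi (0 : ℝ),
    ENNReal.ofReal (t ^ α) * ‖classicalGrad φ (x, t) - G (x, t)‖ₑ ^ 2 with hN
  have hNm : Measurable N := by
    refine Measurable.lintegral_prod_right' (f := fun q : Rd d × ℝ =>
      ENNReal.ofReal (q.2 ^ α) * ‖classicalGrad φ q - G q‖ₑ ^ 2) (by fun_prop)
  set c := ENNReal.ofReal (R ^ (1 - α) / (1 - α))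
  have key : ∀ᵐ x : Rd d, ∀ t ∈ Set.Ioo 0 R, ‖φ (x, t) - primitive G g (x, t)‖ₑ ^ 2 ≤
      2 * ‖φ (x, 0) - g x‖ₑ ^ 2 + 2 * (c * N x) := by
    filter_upwards [ae_integrableOn_snd hα1 hG hG2] with x hx t ht
    have hint : IntegrableOn (fun τ => (classicalGrad φ (x, τ)).snd) (Set.Ioo 0 t) :=
      ((continuous_lineSlice hφ x).integrableOn_Icc).mono_set Set.Ioo_subset_Icc_self
    have e : φ (x, t) - primitive G g (x, t) = (φ (x, 0) - g x) +
        ∫ τ in Set.Ioo 0 t, (classicalGrad φ (x, τ) - G (x, τ)).snd := by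
      have h := integral_sub hint (hx t)
      simp only [WithLp.sub_snd]
      rw [h, primitive_classicalGrad hφ ht.1.le, primitive]
      ring
    rw [e]
    refine (pow_le_pow_left' (enorm_add_le _ _) 2).trans
      ((ENNReal.add_sq_le_two_mul _ _).trans ?_)
    gcongr
    refine (pow_le_pow_left' (enorm_integral_le_lintegral_enorm _) 2).trans ?_
    refine (sq_lintegral_Ioo_le hα1 ht.1.le (Measurable.aemeasurable (by fun_prop))).trans ?_
    have h1α : 0 < 1 - α := by linarith
    refine mul_le_mul' (ENNReal.ofReal_le_ofReal ?_) ?_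
    · gcongr
      · exact ht.1.le
      · exact ht.2.le
    · refine (lintegral_mono_set Set.Ioo_subset_Ioi_self).trans (lintegral_mono fun τ => ?_)
      gcongr
      exact WithLp.enorm_snd_le ..
  calc ∫⁻ x in Metric.ball 0 R, ∫⁻ t in Set.Ioo 0 R,
        ENNReal.ofReal (t ^ α) * ‖φ (x, t) - primitive G g (x, t)‖ₑ ^ 2
      ≤ ∫⁻ x in Metric.ball 0 R, ∫⁻ t in Set.Ioo 0 R,
        ENNReal.ofReal (t ^ α) * (2 * ‖φ (x, 0) - g x‖ₑ ^ 2 + 2 * (c * N x)) := by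
        refine lintegral_mono_ae ?_
        filter_upwards [ae_restrict_of_ae key] with x hx
        refine setLIntegral_mono' measurableSet_Ioo fun t ht => ?_
        gcongr
        exact hx t ht
    _ = ∫⁻ x in Metric.ball 0 R, ENNReal.ofReal (R ^ (α + 1) / (α + 1)) *
        (2 * ‖φ (x, 0) - g x‖ₑ ^ 2 + 2 * (c * N x)) := by
        refine lintegral_congr fun x => ?_
        rw [lintegral_mul_const _ (by fun_prop), lintegral_rpow_Ioo hα0 hR.le]
    _ = ENNReal.ofReal (R ^ (α + 1) / (α + 1)) *
        (2 * (∫⁻ x in Metric.ball 0 R, ‖φ (x, 0) - g x‖ₑ ^ 2) +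
          2 * (c * ∫⁻ x in Metric.ball 0 R, N x)) := by
        rw [lintegral_const_mul _ (by fun_prop), lintegral_add_left (by fun_prop),
          lintegral_const_mul _ (by fun_prop), lintegral_const_mul _ (by fun_prop),
          lintegral_const_mul _ (by fun_prop)]
    _ ≤ _ := by
        gcongr
        exact Measure.restrict_le_self

/-! ### Pairs of a gradient and a trace -/

/-- The closure of the pairs `(∇φ, φ(·, 0))`, where `φ` is smooth up to the boundary, with respect
to convergence in `L²_α` of the gradients and in `L²_loc` of the traces. -/
def gradTrace (d : ℕ) (α : ℝ) :
    Submodule ℝ (GradL2 d α × Lp ℝ 2 (volume : Measure (Rd d))) where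
  -- A single `φ` has to approximate both components, but it may depend on `ε` and `R`. In this form
  -- without sequences, closedness is a triangle inequality.
  carrier := {q | ∀ ε : ℝ≥0∞, ε ≠ 0 → ∀ R : ℝ, ∃ φ : smoothFun d α, ‖gradL φ - q.1‖ₑ ≤ ε ∧
    eLpNorm (fun x => φ.1 (x, 0) - q.2 x) 2 (volume.restrict (Metric.ball 0 R)) ≤ ε}
  zero_mem' := by
    intro ε _ R
    refine ⟨0, by simp, ?_⟩
    have : eLpNorm (fun x => (0 : smoothFun d α).1 (x, 0) -
        (0 : Lp ℝ 2 (volume : Measure (Rd d))) x) 2 (volume.restrict (Metric.ball 0 R)) =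
        eLpNorm (0 : Rd d → ℝ) 2 (volume.restrict (Metric.ball 0 R)) := by
      refine eLpNorm_congr_ae (ae_restrict_of_ae ?_)
      filter_upwards [Lp.coeFn_zero ℝ 2 (volume : Measure (Rd d))] with x hx
      rw [hx]
      simp
    exact (this.trans eLpNorm_zero).le.trans zero_le
  add_mem' := by
    rintro ⟨G, g⟩ ⟨G', g'⟩ h h' ε hε R
    obtain ⟨φ, h1, h2⟩ := h (ε / 2) (by simpa using hε) R
    obtain ⟨φ', h1', h2'⟩ := h' (ε / 2) (by simpa using hε) R
    refine ⟨φ + φ', ?_, ?_⟩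
    · rw [map_add, Prod.fst_add, add_sub_add_comm]
      exact (enorm_add_le _ _).trans ((add_le_add h1 h1').trans_eq (ENNReal.add_halves ε))
    · have : eLpNorm (fun x => (φ + φ').1 (x, 0) -
          (g + g' : Lp ℝ 2 (volume : Measure (Rd d))) x) 2 (volume.restrict (Metric.ball 0 R)) =
          eLpNorm ((fun x => φ.1 (x, 0) - g x) + fun x => φ'.1 (x, 0) - g' x) 2
            (volume.restrict (Metric.ball 0 R)) := by
        refine eLpNorm_congr_ae (ae_restrict_of_ae ?_)
        filter_upwards [Lp.coeFn_add g g'] with x hx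
        rw [hx]
        simp only [Submodule.coe_add, Pi.add_apply]
        ring
      refine this.le.trans ((eLpNorm_add_le ?_ ?_ one_le_two).trans
        ((add_le_add h2 h2').trans_eq (ENNReal.add_halves ε)))
      · exact (Continuous.aestronglyMeasurable (by have := φ.2.1.continuous; fun_prop)).sub
          (Lp.stronglyMeasurable g).aestronglyMeasurable
      · exact (Continuous.aestronglyMeasurable (by have := φ'.2.1.continuous; fun_prop)).sub
          (Lp.stronglyMeasurable g').aestronglyMeasurable
  smul_mem' := by
    rintro c ⟨G, g⟩ h ε hε R
    -- For `c = 0` the tolerance is `⊤`, and `0 * ⊤ = 0` keeps the final estimate valid.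
    obtain ⟨φ, h1, h2⟩ := h (ε / ‖c‖ₑ) (by simp [hε, ENNReal.div_eq_zero_iff]) R
    refine ⟨c • φ, ?_, ?_⟩
    · rw [map_smul, Prod.smul_fst, ← smul_sub, enorm_smul]
      exact (mul_le_mul_right h1 _).trans ENNReal.mul_div_le
    · have : eLpNorm (fun x => (c • φ).1 (x, 0) -
          (c • g : Lp ℝ 2 (volume : Measure (Rd d))) x) 2 (volume.restrict (Metric.ball 0 R)) =
          eLpNorm (c • fun x => φ.1 (x, 0) - g x) 2 (volume.restrict (Metric.ball 0 R)) := by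
        refine eLpNorm_congr_ae (ae_restrict_of_ae ?_)
        filter_upwards [Lp.coeFn_smul c g] with x hx
        rw [hx]
        simp only [Submodule.coe_smul, Pi.smul_apply, smul_eq_mul]
        ring
      refine this.le.trans ?_
      rw [eLpNorm_const_smul]
      exact (mul_le_mul_right h2 _).trans ENNReal.mul_div_le

theorem isClosed_gradTrace (d : ℕ) (α : ℝ) :
    IsClosed (gradTrace d α : Set (GradL2 d α × Lp ℝ 2 (volume : Measure (Rd d)))) := by
  refine isClosed_of_closure_subset ?_
  rintro ⟨G, g⟩ hq ε hε R
  obtain ⟨⟨G', g'⟩, hq', hd⟩ := EMetric.mem_closure_iff.mp hq (ε / 2)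
    (pos_iff_ne_zero.mpr (by simpa using hε))
  obtain ⟨φ, h1, h2⟩ := hq' (ε / 2) (by simpa using hε) R
  rw [Prod.edist_eq, max_lt_iff] at hd
  refine ⟨φ, ?_, ?_⟩
  · rw [← edist_eq_enorm_sub] at h1 ⊢
    rw [edist_comm G] at hd
    exact (edist_triangle _ G' _).trans ((add_le_add h1 hd.1.le).trans_eq (ENNReal.add_halves ε))
  · have h3 : eLpNorm (fun x => g' x - g x) 2 (volume.restrict (Metric.ball 0 R)) ≤ ε / 2 := by
      have h4 := hd.2.le
      rw [edist_comm, edist_eq_enorm_sub, Lp.enorm_def, eLpNorm_congr_ae (Lp.coeFn_sub g' g)] at h4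
      exact (eLpNorm_mono_measure _ Measure.restrict_le_self).trans h4
    have e : (fun x => φ.1 (x, 0) - g x) =
        (fun x => φ.1 (x, 0) - g' x) + fun x => g' x - g x := by
      funext x
      simp
    change eLpNorm (fun x => φ.1 (x, 0) - g x) 2 (volume.restrict (Metric.ball 0 R)) ≤ ε
    rw [e]
    refine (eLpNorm_add_le ?_ ?_ one_le_two).trans
      ((add_le_add h2 h3).trans_eq (ENNReal.add_halves ε))
    · exact (Continuous.aestronglyMeasurable (by have := φ.2.1.continuous; fun_prop)).sub
        (Lp.stronglyMeasurable g').aestronglyMeasurable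
    · exact (Lp.stronglyMeasurable g').aestronglyMeasurable.sub
        (Lp.stronglyMeasurable g).aestronglyMeasurable

/-- A diagonal choice: `φ n` is taken for tolerance `1/(n+1)` and radius `n`, and every fixed ball
is eventually contained in the ball of radius `n`. This is the form that matches `IsTrace`. -/
theorem mem_gradTrace_iff {d : ℕ} {α : ℝ} {G : GradL2 d α}
    {g : Lp ℝ 2 (volume : Measure (Rd d))} :
    (G, g) ∈ gradTrace d α ↔ ∃ φ : ℕ → smoothFun d α,
      Tendsto (fun n => eLpNorm (fun p => classicalGrad (φ n) p - G p) 2 (weightedMeasure d α))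
        atTop (𝓝 0) ∧
      ∀ R : ℝ, Tendsto (fun n => eLpNorm (fun x => (φ n).1 (x, 0) - g x) 2
        (volume.restrict (Metric.ball 0 R))) atTop (𝓝 0) := by
  have hε : ∀ n : ℕ, ((n : ℝ≥0∞) + 1)⁻¹ ≠ 0 := fun n =>
    ENNReal.inv_ne_zero.mpr (by simp)
  have hlim : Tendsto (fun n : ℕ => ((n : ℝ≥0∞) + 1)⁻¹) atTop (𝓝 0) := by
    have h := (tendsto_add_atTop_iff_nat 1).mpr ENNReal.tendsto_inv_nat_nhds_zero
    simpa using h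
  constructor
  · intro h
    choose φ h1 h2 using fun n : ℕ => h ((n : ℝ≥0∞) + 1)⁻¹ (hε n) n
    refine ⟨φ, ?_, fun R => ?_⟩
    · simp only [← enorm_gradL_sub]
      exact tendsto_of_tendsto_of_tendsto_of_le_of_le tendsto_const_nhds hlim
        (fun n => zero_le) h1
    · refine tendsto_of_tendsto_of_tendsto_of_le_of_le' tendsto_const_nhds hlim
        (Eventually.of_forall fun n => zero_le) ?_
      filter_upwards [eventually_ge_atTop ⌈R⌉₊] with n hn
      refine (eLpNorm_mono_measure _ (Measure.restrict_mono (Metric.ball_subset_ball ?_)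
        le_rfl)).trans (h2 n)
      exact (Nat.le_ceil R).trans (by exact_mod_cast hn)
  · rintro ⟨φ, h1, h2⟩ ε hε R
    have hε' : 0 < ε := pos_iff_ne_zero.mpr hε
    obtain ⟨n, hn1, hn2⟩ := ((h1.eventually (ge_mem_nhds hε')).and
      ((h2 R).eventually (ge_mem_nhds hε'))).exists
    refine ⟨φ n, ?_, hn2⟩
    rw [enorm_gradL_sub]
    exact hn1

/-- Approximating functions converge in `L²_α` on bounded sets to the primitive. -/
theorem tendsto_primitive {d : ℕ} {α : ℝ} (hα0 : -1 < α) (hα1 : α < 1) {G : GradL2 d α}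
    {g : Lp ℝ 2 (volume : Measure (Rd d))} {φ : ℕ → Rd d × ℝ → ℝ}
    (hφ : ∀ n, ContDiff ℝ ((⊤ : ℕ∞) : WithTop ℕ∞) (φ n))
    (h1 : Tendsto (fun n => eLpNorm (fun p => classicalGrad (φ n) p - G p) 2 (weightedMeasure d α))
        atTop (𝓝 0))
    (h2 : ∀ R : ℝ, Tendsto (fun n => eLpNorm (fun x => φ n (x, 0) - g x) 2
        (volume.restrict (Metric.ball 0 R))) atTop (𝓝 0)) (R : ℝ) :
    Tendsto (fun n => eLpNorm (fun p => φ n p - primitive G g p) 2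
        ((weightedMeasure d α).restrict (Metric.ball 0 R))) atTop (𝓝 0) := by
  rcases le_or_gt R 0 with hR | hR
  · simp [Metric.ball_eq_empty.mpr hR]
  have hsq : Tendsto (fun n => eLpNorm (fun p => φ n p - primitive G g p) 2
        ((weightedMeasure d α).restrict (Metric.ball 0 R)) ^ 2) atTop (𝓝 0) := by
    refine tendsto_of_tendsto_of_tendsto_of_le_of_le tendsto_const_nhds ?_ (fun n => zero_le)
      (fun n => eLpNorm_sub_primitive_sq_le hα0 hα1 hR (hφ n) (Lp.stronglyMeasurable G).measurable
        (Lp.memLp G) (Lp.stronglyMeasurable g).measurable)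
    have h3 := (ENNReal.Tendsto.const_mul (a := 2) (ENNReal.Tendsto.pow (n := 2) (h2 R))
      (Or.inr (by simp))).add (ENNReal.Tendsto.const_mul (a := 2) (ENNReal.Tendsto.const_mul
        (a := ENNReal.ofReal (R ^ (1 - α) / (1 - α))) (ENNReal.Tendsto.pow (n := 2) h1)
          (Or.inr (by simp))) (Or.inr (by simp)))
    have h4 := ENNReal.Tendsto.const_mul (a := ENNReal.ofReal (R ^ (α + 1) / (α + 1))) h3
      (Or.inr (by simp))
    simpa using h4
  have h5 := hsq.ennrpow_const (1 / 2)
  simp only [← ENNReal.rpow_two, ← ENNReal.rpow_mul] at h5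
  simpa using h5

/-! ### Local integrability and test functions -/

/-- A compact subset of the open half-space stays away from the boundary, so `t ^ α` has a positive
minimum on it and Lebesgue measure is dominated there by a multiple of the weighted measure.
Cauchy-Schwarz on the set of finite volume passes from `L²` to `L¹`. -/
theorem exists_eLpNorm_one_le {d : ℕ} (α : ℝ) {K : Set (Rd d × ℝ)} (hK : IsCompact K)
    (hKH : K ⊆ halfSpace d) :
    ∃ C : ℝ≥0∞, C ≠ ⊤ ∧ ∃ R : ℝ, ∀ (F : Type) [NormedAddCommGroup F] (f : Rd d × ℝ → F),
      AEStronglyMeasurable f (volume.restrict K) →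
      eLpNorm f 1 (volume.restrict K) ≤
        C * eLpNorm f 2 ((weightedMeasure d α).restrict (Metric.ball 0 R)) := by
  obtain ⟨R, hR⟩ := hK.isBounded.subset_ball (0 : Rd d × ℝ)
  obtain ⟨c, hc0, hc⟩ : ∃ c : ℝ, 0 < c ∧ ∀ p ∈ K, c ≤ p.2 ^ α := by
    rcases K.eq_empty_or_nonempty with rfl | hne
    · exact ⟨1, one_pos, by simp⟩
    · have hcont : ContinuousOn (fun p : Rd d × ℝ => p.2 ^ α) K := fun p hp =>
        (continuous_snd.continuousAt.rpow_const (Or.inl (ne_of_gt (hKH hp)))).continuousWithinAt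
      obtain ⟨p, hp, hmin⟩ := hK.exists_isMinOn hne hcont
      exact ⟨p.2 ^ α, Real.rpow_pos_of_pos (hKH hp) α, fun q hq => hmin hq⟩
  set a : ℝ≥0∞ := ENNReal.ofReal c
  have ha : a ≠ 0 := by simpa [a] using hc0
  have hle : volume.restrict K ≤ a⁻¹ • (weightedMeasure d α).restrict (Metric.ball 0 R) := by
    refine Measure.le_iff.mpr fun S hS => ?_
    have h1 : a * volume (S ∩ K) ≤ weightedMeasure d α (S ∩ K) := by
      have hSK : MeasurableSet (S ∩ K) := hS.inter hK.measurableSet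
      rw [weightedMeasure, withDensity_apply _ hSK, Measure.restrict_restrict hSK,
        Set.inter_eq_left.mpr (Set.inter_subset_right.trans hKH), ← setLIntegral_const]
      exact setLIntegral_mono' hSK fun p hp => ENNReal.ofReal_le_ofReal (hc p hp.2)
    rw [Measure.restrict_apply hS, Measure.smul_apply, Measure.restrict_apply hS, smul_eq_mul,
      mul_comm, ← div_eq_mul_inv,
      ENNReal.le_div_iff_mul_le (Or.inl ha) (Or.inl ENNReal.ofReal_ne_top), mul_comm]
    exact h1.trans (measure_mono (Set.inter_subset_inter_right _ hR))
  refine ⟨volume K ^ (1 / 2 : ℝ) * a⁻¹ ^ (1 / 2 : ℝ), ?_, R, fun F _ f hf => ?_⟩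
  · exact ENNReal.mul_ne_top (ENNReal.rpow_ne_top_of_nonneg (by norm_num) hK.measure_ne_top)
      (ENNReal.rpow_ne_top_of_nonneg (by norm_num) (ENNReal.inv_ne_top.mpr ha))
  · have h1 := eLpNorm_le_eLpNorm_mul_rpow_measure_univ (p := 1) (q := 2) one_le_two hf
    rw [Measure.restrict_apply_univ] at h1
    refine h1.trans ?_
    have h2 := eLpNorm_mono_measure (p := 2) f hle
    rw [eLpNorm_smul_measure_of_ne_top (by simp)] at h2
    rw [mul_comm, mul_assoc]
    norm_num at h2 ⊢
    gcongr

theorem locallyIntegrableOn_halfSpace {d : ℕ} (α : ℝ) {F : Type} [NormedAddCommGroup F]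
    {f : Rd d × ℝ → F} (hf : AEStronglyMeasurable f (volume.restrict (halfSpace d)))
    (h : ∀ R, eLpNorm f 2 ((weightedMeasure d α).restrict (Metric.ball 0 R)) ≠ ⊤) :
    LocallyIntegrableOn f (halfSpace d : Set (Rd d × ℝ)) := by
  rw [locallyIntegrableOn_iff (halfSpace d).isOpen.isLocallyClosed]
  intro K hKH hK
  obtain ⟨C, hC, R, hCR⟩ := exists_eLpNorm_one_le α hK hKH
  have hfK : AEStronglyMeasurable f (volume.restrict K) := hf.mono_measure
    (Measure.restrict_mono hKH le_rfl)
  rw [IntegrableOn, ← memLp_one_iff_integrable]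
  exact ⟨hfK, (hCR F f hfK).trans_lt (ENNReal.mul_lt_top hC.lt_top (h R).lt_top)⟩

/-- Pairing with a fixed test function is continuous for convergence in `L²_α` on bounded sets: `C`
and `R` depend on `ψ` alone. -/
theorem exists_enorm_integral_le {d : ℕ} (α : ℝ) (ψ : 𝓓(halfSpace d, ℝ)) :
    ∃ C : ℝ≥0∞, C ≠ ⊤ ∧ ∃ R : ℝ, ∀ f : Rd d × ℝ → ℝ,
      AEStronglyMeasurable f (volume.restrict (halfSpace d)) →
      ‖∫ p, ψ p * f p‖ₑ ≤
        C * eLpNorm f 2 ((weightedMeasure d α).restrict (Metric.ball 0 R)) := by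
  obtain ⟨C, hC, R, hCR⟩ := exists_eLpNorm_one_le α ψ.hasCompactSupport.isCompact
    ψ.tsupport_subset
  obtain ⟨M, hM⟩ := ψ.continuous.bounded_above_of_compact_support ψ.hasCompactSupport
  refine ⟨ENNReal.ofReal M * C, ENNReal.mul_ne_top ENNReal.ofReal_ne_top hC, R, fun f hf => ?_⟩
  have h1 : ∫ p, ψ p * f p = ∫ p in tsupport ψ, ψ p * f p := by
    refine (setIntegral_eq_integral_of_forall_compl_eq_zero fun p hp => ?_).symm
    rw [image_eq_zero_of_notMem_tsupport hp, zero_mul]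
  rw [h1]
  refine (enorm_integral_le_lintegral_enorm _).trans ?_
  calc ∫⁻ p in tsupport ψ, ‖ψ p * f p‖ₑ
      ≤ ∫⁻ p in tsupport ψ, ENNReal.ofReal M * ‖f p‖ₑ := by
        refine lintegral_mono fun p => ?_
        simp only [enorm_mul]
        gcongr
        rw [← ofReal_norm]
        exact ENNReal.ofReal_le_ofReal (hM p)
    _ = ENNReal.ofReal M * eLpNorm f 1 (volume.restrict (tsupport ψ)) := by
        rw [lintegral_const_mul' _ _ ENNReal.ofReal_ne_top, eLpNorm_one_eq_lintegral_enorm]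
    _ ≤ _ := by
        rw [mul_assoc]
        gcongr
        exact hCR ℝ f (hf.mono_measure (Measure.restrict_mono ψ.tsupport_subset le_rfl))

theorem integrable_testFunction_mul {d : ℕ} {f : Rd d × ℝ → ℝ}
    (hf : LocallyIntegrableOn f (halfSpace d : Set (Rd d × ℝ))) (ψ : 𝓓(halfSpace d, ℝ)) :
    Integrable (fun p => ψ p * f p) :=
  ψ.integrable_bilin (ContinuousLinearMap.mul ℝ ℝ) hf

/-- Limits in `L²_α` on bounded sets are unique as distributions. This later identifies the function
representing `T` with the primitive of its gradient. -/
theorem integral_testFunction_eq_of_tendsto {d : ℕ} (α : ℝ) (ψ : 𝓓(halfSpace d, ℝ))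
    {f g : Rd d × ℝ → ℝ} {φ : ℕ → Rd d × ℝ → ℝ}
    (hφ : ∀ n, AEStronglyMeasurable (φ n) (volume.restrict (halfSpace d)))
    (hf : LocallyIntegrableOn f (halfSpace d : Set (Rd d × ℝ)))
    (hg : LocallyIntegrableOn g (halfSpace d : Set (Rd d × ℝ)))
    (h1 : ∀ R : ℝ, Tendsto (fun n => eLpNorm (fun p => φ n p - f p) 2
      ((weightedMeasure d α).restrict (Metric.ball 0 R))) atTop (𝓝 0))
    (h2 : ∀ R : ℝ, Tendsto (fun n => eLpNorm (fun p => φ n p - g p) 2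
      ((weightedMeasure d α).restrict (Metric.ball 0 R))) atTop (𝓝 0)) :
    ∫ p, ψ p * f p = ∫ p, ψ p * g p := by
  obtain ⟨C, hC, R, hCR⟩ := exists_enorm_integral_le α ψ
  have hac : ∀ R : ℝ, (weightedMeasure d α).restrict (Metric.ball 0 R) ≪
      volume.restrict (halfSpace d : Set (Rd d × ℝ)) := fun R =>
    (Measure.absolutelyContinuous_of_le Measure.restrict_le_self).trans
      (withDensity_absolutelyContinuous _ _)
  have hzero : eLpNorm (fun p => f p - g p) 2
      ((weightedMeasure d α).restrict (Metric.ball 0 R)) = 0 := by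
    refine le_antisymm (ge_of_tendsto' ((h2 R).add (h1 R) |>.trans_eq (by simp)) fun n => ?_)
      zero_le
    have e : (fun p => f p - g p) = (fun p => φ n p - g p) - fun p => φ n p - f p := by
      funext p
      simp
    rw [e]
    exact eLpNorm_sub_le (((hφ n).sub hg.aestronglyMeasurable).mono_ac (hac R))
      (((hφ n).sub hf.aestronglyMeasurable).mono_ac (hac R)) one_le_two
  have h3 := hCR _ (hf.aestronglyMeasurable.sub hg.aestronglyMeasurable)
  have h4 : ∫ p, ψ p * (f p - g p) = 0 := by
    rw [← enorm_eq_zero]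
    refine le_antisymm (h3.trans_eq ?_) zero_le
    rw [show f - g = fun p => f p - g p from rfl, hzero, mul_zero]
  simp only [mul_sub] at h4
  rw [integral_sub (integrable_testFunction_mul hf ψ) (integrable_testFunction_mul hg ψ)] at h4
  linarith

theorem tendsto_integral_testFunction {d : ℕ} (α : ℝ) (ψ : 𝓓(halfSpace d, ℝ))
    {f : Rd d × ℝ → ℝ} {φ : ℕ → Rd d × ℝ → ℝ}
    (hφ : ∀ n, LocallyIntegrableOn (φ n) (halfSpace d : Set (Rd d × ℝ)))
    (hf : LocallyIntegrableOn f (halfSpace d : Set (Rd d × ℝ)))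
    (h1 : ∀ R : ℝ, Tendsto (fun n => eLpNorm (fun p => φ n p - f p) 2
      ((weightedMeasure d α).restrict (Metric.ball 0 R))) atTop (𝓝 0)) :
    Tendsto (fun n => ∫ p, ψ p * φ n p) atTop (𝓝 (∫ p, ψ p * f p)) := by
  obtain ⟨C, hC, R, hCR⟩ := exists_enorm_integral_le α ψ
  rw [tendsto_iff_edist_tendsto_0]
  refine tendsto_of_tendsto_of_tendsto_of_le_of_le tendsto_const_nhds (h := fun n => C *
    eLpNorm (fun p => φ n p - f p) 2 ((weightedMeasure d α).restrict (Metric.ball 0 R))) ?_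
    (fun n => zero_le) (fun n => ?_)
  · simpa using ENNReal.Tendsto.const_mul (h1 R) (Or.inr hC)
  · rw [edist_eq_enorm_sub, ← integral_sub (integrable_testFunction_mul (hφ n) ψ)
      (integrable_testFunction_mul hf ψ)]
    simp only [← mul_sub]
    exact hCR _ ((hφ n).aestronglyMeasurable.sub hf.aestronglyMeasurable)

/-! ### Uniqueness of gradients -/

/-- The fundamental lemma of the calculus of variations, applied to `f - g`. -/
theorem Represents.ae_eq {d : ℕ} {T : 𝓓'(halfSpace d, ℝ)} {f g : Rd d × ℝ → ℝ}
    (hf : Represents T f) (hg : Represents T g) :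
    ∀ᵐ p ∂volume.restrict (halfSpace d : Set (Rd d × ℝ)), f p = g p := by
  have h := (halfSpace d).isOpen.ae_eq_zero_of_integral_contDiff_smul_eq_zero (hf.1.sub hg.1)
    fun ψ h1 h2 h3 => by
      have e1 := hf.2 ⟨ψ, h1, h2, h3⟩
      have e2 := hg.2 ⟨ψ, h1, h2, h3⟩
      have e3 := integral_sub (integrable_testFunction_mul hf.1 ⟨ψ, h1, h2, h3⟩)
        (integrable_testFunction_mul hg.1 ⟨ψ, h1, h2, h3⟩)
      rw [← e1, ← e2, sub_self] at e3
      rw [← e3]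
      simp only [smul_eq_mul, Pi.sub_apply, mul_sub]
      rfl
  rw [ae_restrict_iff' (measurableSet_halfSpace d)]
  filter_upwards [h] with p hp hpH
  exact sub_eq_zero.mp (hp hpH)

theorem IsGradient.ae_eq {d : ℕ} {T : 𝓓'(halfSpace d, ℝ)} {G G' : Rd d × ℝ → GradVec d}
    (hG : IsGradient T G) (hG' : IsGradient T G') (α : ℝ) : G =ᵐ[weightedMeasure d α] G' := by
  rw [Filter.EventuallyEq, ae_weightedMeasure_iff]
  -- The null set in `IsGradient` depends on the direction, so only the `d + 1` coordinate
  -- directions are used.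
  have h1 : ∀ᵐ p ∂volume.restrict (halfSpace d : Set (Rd d × ℝ)), ∀ i : Fin d,
      inner ℝ (G p) (WithLp.toLp 2 (EuclideanSpace.single i (1 : ℝ), (0 : ℝ))) =
      inner ℝ (G' p) (WithLp.toLp 2 (EuclideanSpace.single i (1 : ℝ), (0 : ℝ))) :=
    ae_all_iff.mpr fun i => (hG _).ae_eq (hG' _)
  filter_upwards [h1, (hG (0, 1)).ae_eq (hG' (0, 1))] with p h2 h3
  simp only [WithLp.prod_inner_apply, EuclideanSpace.inner_single_right] at h2 h3
  have e1 : (G p).fst = (G' p).fst := by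
    ext i
    simpa using h2 i
  have e2 : (G p).snd = (G' p).snd := by simpa using h3
  refine WithLp.ofLp_injective 2 (Prod.ext e1 e2)

/-- Uniqueness almost everywhere makes the choice in `distGrad` harmless. -/
theorem IsGradient.distGrad_ae_eq {d : ℕ} {T : 𝓓'(halfSpace d, ℝ)} {G : Rd d × ℝ → GradVec d}
    (hG : IsGradient T G) (α : ℝ) : distGrad T =ᵐ[weightedMeasure d α] G := by
  have h : ∃ G, IsGradient T G := ⟨G, hG⟩
  rw [distGrad, dif_pos h]
  exact h.choose_spec.ae_eq hG α

/-! ### Distributions given by primitives -/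

theorem locallyIntegrableOn_of_continuous {d : ℕ} {f : Rd d × ℝ → ℝ} (hf : Continuous f) :
    LocallyIntegrableOn f (halfSpace d : Set (Rd d × ℝ)) :=
  hf.locallyIntegrable.locallyIntegrableOn _

theorem eLpNorm_ball_ne_top {d : ℕ} {α : ℝ} (hα : -1 < α) {f : Rd d × ℝ → ℝ} (hf : Continuous f)
    (R : ℝ) : eLpNorm f 2 ((weightedMeasure d α).restrict (Metric.ball 0 R)) ≠ ⊤ := by
  -- Balls have finite weighted measure because `α > -1` makes `t ^ α` integrable at `0`.
  have hfin : (weightedMeasure d α) (Metric.ball 0 R) < ⊤ := by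
    rcases le_or_gt R 0 with hR | hR
    · simp [Metric.ball_eq_empty.mpr hR]
    have h := lintegral_weightedMeasure_ball (d := d) α R (f := fun _ => 1) measurable_const
    simp only [lintegral_const, mul_one, one_mul, Measure.restrict_apply_univ] at h
    rw [h, lintegral_rpow_Ioo hα hR.le]
    exact ENNReal.mul_lt_top ENNReal.ofReal_lt_top measure_ball_lt_top
  have : IsFiniteMeasure ((weightedMeasure d α).restrict (Metric.ball 0 R)) :=
    ⟨by simpa using hfin⟩
  obtain ⟨M, hM⟩ := (isCompact_closedBall (0 : Rd d × ℝ) R).exists_bound_of_continuousOn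
    hf.continuousOn
  refine (MemLp.of_bound hf.aestronglyMeasurable M ?_).2.ne
  filter_upwards [ae_restrict_mem measurableSet_ball] with p hp
  exact hM p (Metric.ball_subset_closedBall hp)

/-- Write the primitive as a smooth approximant minus their difference: the approximant is bounded
on balls, and the difference has `L²_α` norm below `1` once `n` is large. -/
theorem locallyIntegrableOn_primitive {d : ℕ} {α : ℝ} (hα0 : -1 < α) (hα1 : α < 1)
    {G : GradL2 d α} {g : Lp ℝ 2 (volume : Measure (Rd d))} (h : (G, g) ∈ gradTrace d α) :
    LocallyIntegrableOn (primitive G g) (halfSpace d : Set (Rd d × ℝ)) := by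
  obtain ⟨φ, h1, h2⟩ := mem_gradTrace_iff.mp h
  have hm := measurable_primitive (Lp.stronglyMeasurable G).measurable
    (Lp.stronglyMeasurable g).measurable
  refine locallyIntegrableOn_halfSpace α hm.aestronglyMeasurable fun R => ?_
  have h3 := tendsto_primitive hα0 hα1 (fun n => (φ n).2.1) h1 h2 R
  obtain ⟨n, hn⟩ := (h3.eventually (gt_mem_nhds (show (0 : ℝ≥0∞) < 1 by simp))).exists
  have hc := (φ n).2.1.continuous
  have e : primitive G g = (φ n).1 - fun p => (φ n).1 p - primitive G g p := by
    funext p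
    simp
  rw [e]
  refine ((eLpNorm_sub_le hc.aestronglyMeasurable
    (hc.measurable.sub hm).aestronglyMeasurable one_le_two).trans_lt
      (ENNReal.add_lt_top.mpr ⟨(eLpNorm_ball_ne_top hα0 hc R).lt_top, ?_⟩)).ne
  exact hn.trans (by simp)

/-- The distribution on the half-space given by a locally integrable function. -/
noncomputable def distOfFun {d : ℕ} (w : Rd d × ℝ → ℝ) : 𝓓'(halfSpace d, ℝ) :=
  (TestFunction.integralAgainstBilinCLM (ContinuousLinearMap.mul ℝ ℝ) volume w :
    𝓓(halfSpace d, ℝ) →L[ℝ] ℝ)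

theorem represents_distOfFun {d : ℕ} {w : Rd d × ℝ → ℝ}
    (hw : LocallyIntegrableOn w (halfSpace d : Set (Rd d × ℝ))) : Represents (distOfFun w) w :=
  ⟨hw, fun _ => TestFunction.integralAgainstBilinCLM_eq_integral hw⟩

/-- Integration by parts; the test function is supported inside the open half-space, so there is no
boundary term. -/
theorem integral_lineDeriv_mul {d : ℕ} (ψ : 𝓓(halfSpace d, ℝ)) {φ : Rd d × ℝ → ℝ}
    (hφ : ContDiff ℝ ((⊤ : ℕ∞) : WithTop ℕ∞) φ) (v : Rd d × ℝ) :
    ∫ p, (-∂_{v} ψ) p * φ p =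
      ∫ p, ψ p * inner ℝ (classicalGrad φ p) (WithLp.toLp 2 v) := by
  have hdψ : Differentiable ℝ ψ := ψ.contDiff.differentiable (by simp)
  have hdφ : Differentiable ℝ φ := hφ.differentiable (by simp)
  have e : ∀ p, (∂_{v} ψ) p = fderiv ℝ ψ p v := fun p => by
    rw [TestFunction.lineDerivOp_eq_lineDerivCLM (𝕜 := ℝ),
      TestFunction.lineDerivCLM_apply_of_le (by simp), (hdψ p).lineDeriv_eq_fderiv]
  have hc : Continuous fun p => fderiv ℝ φ p v :=
    (hφ.continuous_fderiv (by simp)).clm_apply continuous_const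
  have i1 := integrable_testFunction_mul (locallyIntegrableOn_of_continuous hφ.continuous) (∂_{v} ψ)
  have i2 := integrable_testFunction_mul (locallyIntegrableOn_of_continuous hc) ψ
  have i3 := integrable_testFunction_mul (locallyIntegrableOn_of_continuous hφ.continuous) ψ
  simp only [e] at i1
  have : (volume : Measure (Rd d × ℝ)).IsAddHaarMeasure := by
    rw [Measure.volume_eq_prod]; infer_instance
  have h := integral_mul_fderiv_eq_neg_fderiv_mul_of_integrable i1 i2 i3 (fun p _ => hdψ p)
    (fun p _ => hdφ p)
  simp only [inner_classicalGrad (hdφ _)]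
  rw [h, ← integral_neg]
  refine integral_congr_ae (Eventually.of_forall fun p => ?_)
  simp only [neg_apply, e, neg_mul]

/-! ### Beppo-Levi distributions with a trace -/

theorem eLpNorm_inner_le {X F : Type*} [MeasurableSpace X] [NormedAddCommGroup F]
    [InnerProductSpace ℝ F] (μ : Measure X) (f : X → F) (v : F) :
    eLpNorm (fun x => inner ℝ (f x) v) 2 μ ≤ ‖v‖ₑ * eLpNorm f 2 μ := by
  have h := eLpNorm_le_nnreal_smul_eLpNorm_of_ae_le_mul (μ := μ) (f := fun x => inner ℝ (f x) v)
    (g := f) (c := ‖v‖₊) (p := 2) (Eventually.of_forall fun x => by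
      rw [mul_comm]
      exact nnnorm_inner_le_nnnorm _ _)
  simpa [ENNReal.smul_def, enorm] using h

theorem locallyIntegrableOn_inner {d : ℕ} {α : ℝ} (G : GradL2 d α) (v : GradVec d) :
    LocallyIntegrableOn (fun p => inner ℝ (G p) v) (halfSpace d : Set (Rd d × ℝ)) := by
  have hG := (Lp.stronglyMeasurable G).measurable
  refine locallyIntegrableOn_halfSpace α
    (Measurable.aestronglyMeasurable (by fun_prop)) fun R => ?_
  refine ((eLpNorm_inner_le _ G v).trans_lt (ENNReal.mul_lt_top enorm_lt_top ?_)).ne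
  exact (eLpNorm_mono_measure _ Measure.restrict_le_self).trans_lt (Lp.memLp G).2

/-- Only the last component of `G` enters the primitive. The horizontal derivatives are nevertheless
correct because `G` is a limit of gradients of smooth functions: both sides of the integration by
parts formula for `φ n` converge. -/
theorem isGradient_distOfFun_primitive {d : ℕ} {α : ℝ} (hα0 : -1 < α) (hα1 : α < 1)
    {G : GradL2 d α} {g : Lp ℝ 2 (volume : Measure (Rd d))} (h : (G, g) ∈ gradTrace d α) :
    IsGradient (distOfFun (primitive G g)) G := by
  intro v
  refine ⟨locallyIntegrableOn_inner G _, fun ψ => ?_⟩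
  obtain ⟨φ, h1, h2⟩ := mem_gradTrace_iff.mp h
  have hli := locallyIntegrableOn_primitive hα0 hα1 h
  rw [Distribution.lineDerivOp_apply_apply, (represents_distOfFun hli).2]
  have hc : ∀ n, Continuous fun p =>
      inner ℝ (classicalGrad (φ n).1 p) (WithLp.toLp 2 v : GradVec d) := fun n => by
    have := continuous_classicalGrad (φ n).2.1
    fun_prop
  have l1 := tendsto_integral_testFunction α (-∂_{v} ψ)
    (fun n => locallyIntegrableOn_of_continuous (φ n).2.1.continuous) hli
    (tendsto_primitive hα0 hα1 (fun n => (φ n).2.1) h1 h2)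
  have l2 := tendsto_integral_testFunction α ψ
    (fun n => locallyIntegrableOn_of_continuous (hc n))
    (locallyIntegrableOn_inner G (WithLp.toLp 2 v)) fun R => by
      have h3 := ENNReal.Tendsto.const_mul h1
        (Or.inr (enorm_ne_top (x := (WithLp.toLp 2 v : GradVec d))))
      rw [mul_zero] at h3
      refine tendsto_of_tendsto_of_tendsto_of_le_of_le tendsto_const_nhds h3 (fun n => zero_le)
        fun n => ?_
      simp only [← inner_sub_left]
      exact (eLpNorm_inner_le _ _ _).trans
        (mul_le_mul_right (eLpNorm_mono_measure _ Measure.restrict_le_self) _)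
  simp only [integral_lineDeriv_mul ψ (φ _).2.1 v] at l1
  exact tendsto_nhds_unique l1 l2

theorem memBeppoLevi_distOfFun_primitive {d : ℕ} {α : ℝ} (hα0 : -1 < α) (hα1 : α < 1)
    {G : GradL2 d α} {g : Lp ℝ 2 (volume : Measure (Rd d))} (h : (G, g) ∈ gradTrace d α) :
    MemBeppoLevi α (distOfFun (primitive G g)) :=
  ⟨G, isGradient_distOfFun_primitive hα0 hα1 h, Lp.memLp G⟩

theorem isTrace_distOfFun_primitive {d : ℕ} {α : ℝ} (hα0 : -1 < α) (hα1 : α < 1)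
    {G : GradL2 d α} {g : Lp ℝ 2 (volume : Measure (Rd d))} (h : (G, g) ∈ gradTrace d α) :
    IsTrace α (distOfFun (primitive G g)) g := by
  obtain ⟨φ, h1, h2⟩ := mem_gradTrace_iff.mp h
  refine ⟨primitive G g, represents_distOfFun (locallyIntegrableOn_primitive hα0 hα1 h),
    fun n => (φ n).1, fun n => (φ n).2.1, fun n => (φ n).2.2,
    tendsto_primitive hα0 hα1 (fun n => (φ n).2.1) h1 h2, ?_, h2⟩
  refine h1.congr fun n => eLpNorm_congr_ae ?_
  filter_upwards [(isGradient_distOfFun_primitive hα0 hα1 h).distGrad_ae_eq α] with p hp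
  rw [hp]

/-- The smooth functions in `IsTrace` converge on bounded sets both to the function representing `T`
and to the primitive, so the two agree. A distribution with a trace is thus determined by its
gradient and its trace. -/
theorem exists_gradTrace_of_isTrace {d : ℕ} {α : ℝ} (hα0 : -1 < α) (hα1 : α < 1)
    {T : 𝓓'(halfSpace d, ℝ)} {g : Lp ℝ 2 (volume : Measure (Rd d))} (hT : MemBeppoLevi α T)
    (htr : IsTrace α T g) :
    ∃ G : GradL2 d α, distGrad T =ᵐ[weightedMeasure d α] G ∧ (G, g) ∈ gradTrace d α ∧
      T = distOfFun (primitive G g) := by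
  obtain ⟨G₀, hG₀, hG₀'⟩ := hT
  obtain ⟨w, hw, φ, hφ, hφ', h1, h2, h3⟩ := htr
  have hG : distGrad T =ᵐ[weightedMeasure d α] hG₀'.toLp G₀ :=
    (hG₀.distGrad_ae_eq α).trans hG₀'.coeFn_toLp.symm
  have h2' : Tendsto (fun n => eLpNorm (fun p => classicalGrad (φ n) p - hG₀'.toLp G₀ p) 2
      (weightedMeasure d α)) atTop (𝓝 0) := by
    refine h2.congr fun n => eLpNorm_congr_ae ?_
    filter_upwards [hG] with p hp
    rw [hp]
  have hmem : (hG₀'.toLp G₀, g) ∈ gradTrace d α :=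
    mem_gradTrace_iff.mpr ⟨fun n => ⟨φ n, hφ n, hφ' n⟩, h2', h3⟩
  have hli := locallyIntegrableOn_primitive hα0 hα1 hmem
  refine ⟨hG₀'.toLp G₀, hG, hmem, ?_⟩
  ext ψ
  rw [hw.2 ψ, (represents_distOfFun hli).2 ψ]
  exact integral_testFunction_eq_of_tendsto α ψ
    (fun n => (hφ n).continuous.aestronglyMeasurable) hw.1 hli h1
    (tendsto_primitive hα0 hα1 hφ h2' h3)

/-! ### The minimum norm extension in terms of gradients -/

/-- `G` is the gradient of minimal norm with trace `g`. -/
def IsMinGrad {d : ℕ} {α : ℝ} (g : Lp ℝ 2 (volume : Measure (Rd d))) (G : GradL2 d α) : Prop :=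
  (G, g) ∈ gradTrace d α ∧ ∀ G' : GradL2 d α, (G', g) ∈ gradTrace d α → ‖G‖ ≤ ‖G'‖

theorem enorm_eq_of_ae_eq {d : ℕ} {α : ℝ} {T : 𝓓'(halfSpace d, ℝ)} {G : GradL2 d α}
    (h : distGrad T =ᵐ[weightedMeasure d α] G) :
    eLpNorm (distGrad T) 2 (weightedMeasure d α) = ENNReal.ofReal ‖G‖ := by
  rw [ofReal_norm, Lp.enorm_def, eLpNorm_congr_ae h]

/-- The two previous constructions are inverse to each other and preserve the norm of the gradient.
The minimization therefore takes place in the Hilbert space `GradL2`. -/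
theorem isMinNormExtension_iff {d : ℕ} {s : ℝ} (hs0 : 0 < s) (hs1 : s < 1)
    {g : Lp ℝ 2 (volume : Measure (Rd d))} {T : 𝓓'(halfSpace d, ℝ)} :
    IsMinNormExtension s g T ↔
      ∃ G : GradL2 d (1 - 2 * s), IsMinGrad g G ∧ T = distOfFun (primitive G g) := by
  have hα0 : -1 < 1 - 2 * s := by linarith
  have hα1 : 1 - 2 * s < 1 := by linarith
  constructor
  · rintro ⟨h1, h2, h3⟩
    obtain ⟨G, hG, hmem, hT⟩ := exists_gradTrace_of_isTrace hα0 hα1 h1 h2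
    refine ⟨G, ⟨hmem, fun G' hG' => ?_⟩, hT⟩
    have h4 := h3 _ (memBeppoLevi_distOfFun_primitive hα0 hα1 hG')
      (isTrace_distOfFun_primitive hα0 hα1 hG')
    rwa [enorm_eq_of_ae_eq hG, enorm_eq_of_ae_eq ((isGradient_distOfFun_primitive hα0 hα1
      hG').distGrad_ae_eq _), ENNReal.ofReal_le_ofReal_iff (norm_nonneg _)] at h4
  · rintro ⟨G, ⟨hmem, hmin⟩, rfl⟩
    refine ⟨memBeppoLevi_distOfFun_primitive hα0 hα1 hmem,
      isTrace_distOfFun_primitive hα0 hα1 hmem, fun T' h1 h2 => ?_⟩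
    obtain ⟨G', hG', hmem', -⟩ := exists_gradTrace_of_isTrace hα0 hα1 h1 h2
    rw [enorm_eq_of_ae_eq hG', enorm_eq_of_ae_eq ((isGradient_distOfFun_primitive hα0 hα1
      hmem).distGrad_ae_eq _)]
    exact ENNReal.ofReal_le_ofReal (hmin G' hmem')

/-! ### Minimal gradients -/

/-- The gradients with trace zero. -/
noncomputable def zeroTraceGrad (d : ℕ) (α : ℝ) : Submodule ℝ (GradL2 d α) :=
  (gradTrace d α).comap (LinearMap.inl ℝ _ _)

theorem isClosed_zeroTraceGrad (d : ℕ) (α : ℝ) :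
    IsClosed (zeroTraceGrad d α : Set (GradL2 d α)) :=
  (isClosed_gradTrace d α).preimage (f := fun G : GradL2 d α =>
    ((G, 0) : GradL2 d α × Lp ℝ 2 (volume : Measure (Rd d)))) (by fun_prop)

noncomputable instance (d : ℕ) (α : ℝ) : (zeroTraceGrad d α).HasOrthogonalProjection :=
  have : CompleteSpace (zeroTraceGrad d α) := (isClosed_zeroTraceGrad d α).completeSpace_coe
  inferInstance

theorem mem_zeroTraceGrad {d : ℕ} {α : ℝ} {G : GradL2 d α} :
    G ∈ zeroTraceGrad d α ↔ (G, 0) ∈ gradTrace d α := Iff.rfl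

theorem sub_mem_zeroTraceGrad {d : ℕ} {α : ℝ} {g : Lp ℝ 2 (volume : Measure (Rd d))}
    {G G' : GradL2 d α} (h : (G, g) ∈ gradTrace d α) (h' : (G', g) ∈ gradTrace d α) :
    G - G' ∈ zeroTraceGrad d α := by
  have := (gradTrace d α).sub_mem h h'
  rwa [Prod.mk_sub_mk, sub_self] at this

/-- Two gradients with the same trace differ by an element of `zeroTraceGrad`. If `G` is minimal,
removing its projection `P` keeps the trace, and Pythagoras forces `P = 0`; conversely Pythagoras
shows that an orthogonal `G` is minimal. Orthogonality is a linear condition, which is where the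
linearity of the extension comes from. -/
theorem isMinGrad_iff {d : ℕ} {α : ℝ} {g : Lp ℝ 2 (volume : Measure (Rd d))} {G : GradL2 d α} :
    IsMinGrad g G ↔ (G, g) ∈ gradTrace d α ∧ G ∈ (zeroTraceGrad d α)ᗮ := by
  constructor
  · rintro ⟨h1, h2⟩
    refine ⟨h1, ?_⟩
    set P : GradL2 d α := (zeroTraceGrad d α).starProjection G with hP
    have hPm : P ∈ zeroTraceGrad d α := Submodule.starProjection_apply_mem _ _
    have h3 := (gradTrace d α).sub_mem h1 (mem_zeroTraceGrad.mp hPm)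
    rw [Prod.mk_sub_mk, sub_zero] at h3
    have hort : G - P ∈ (zeroTraceGrad d α)ᗮ := Submodule.sub_starProjection_mem_orthogonal G
    have h4 := h2 _ h3
    have h5 : ‖G‖ * ‖G‖ = ‖G - P‖ * ‖G - P‖ + ‖P‖ * ‖P‖ := by
      have h6 := norm_add_sq_eq_norm_sq_add_norm_sq_of_inner_eq_zero (G - P) P
        (Submodule.inner_left_of_mem_orthogonal hPm hort)
      rwa [sub_add_cancel] at h6
    have h6 : P = 0 := by
      rw [← norm_eq_zero]
      nlinarith [norm_nonneg (G - P), norm_nonneg P, norm_nonneg G]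
    rwa [h6, sub_zero] at hort
  · rintro ⟨h1, h2⟩
    refine ⟨h1, fun G' hG' => ?_⟩
    have h3 := sub_mem_zeroTraceGrad hG' h1
    have h6 := norm_add_sq_eq_norm_sq_add_norm_sq_of_inner_eq_zero (G' - G) G
        (Submodule.inner_right_of_mem_orthogonal h3 h2)
    rw [sub_add_cancel] at h6
    nlinarith [norm_nonneg (G' - G), norm_nonneg G', norm_nonneg G]

theorem IsMinGrad.unique {d : ℕ} {α : ℝ} {g : Lp ℝ 2 (volume : Measure (Rd d))}
    {G G' : GradL2 d α} (h : IsMinGrad g G) (h' : IsMinGrad g G') : G = G' := by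
  rw [isMinGrad_iff] at h h'
  have h1 := sub_mem_zeroTraceGrad h.1 h'.1
  have h2 := Submodule.sub_mem _ h.2 h'.2
  rw [← sub_eq_zero, ← inner_self_eq_zero (𝕜 := ℝ)]
  exact Submodule.inner_right_of_mem_orthogonal h1 h2

theorem exists_isMinGrad {d : ℕ} {α : ℝ} {g : Lp ℝ 2 (volume : Measure (Rd d))}
    {G : GradL2 d α} (h : (G, g) ∈ gradTrace d α) : ∃ G' : GradL2 d α, IsMinGrad g G' := by
  set P : GradL2 d α := (zeroTraceGrad d α).starProjection G with hP
  have hPm : P ∈ zeroTraceGrad d α := Submodule.starProjection_apply_mem _ _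
  have h3 := (gradTrace d α).sub_mem h (mem_zeroTraceGrad.mp hPm)
  rw [Prod.mk_sub_mk, sub_zero] at h3
  exact ⟨G - P, isMinGrad_iff.mpr ⟨h3, Submodule.sub_starProjection_mem_orthogonal G⟩⟩

theorem IsMinGrad.add {d : ℕ} {α : ℝ} {g g' : Lp ℝ 2 (volume : Measure (Rd d))}
    {G G' : GradL2 d α} (h : IsMinGrad g G) (h' : IsMinGrad g' G') :
    IsMinGrad (g + g') (G + G') := by
  rw [isMinGrad_iff] at h h' ⊢
  have h1 := (gradTrace d α).add_mem h.1 h'.1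
  rw [Prod.mk_add_mk] at h1
  exact ⟨h1, Submodule.add_mem _ h.2 h'.2⟩

theorem IsMinGrad.smul {d : ℕ} {α : ℝ} {g : Lp ℝ 2 (volume : Measure (Rd d))}
    {G : GradL2 d α} (h : IsMinGrad g G) (c : ℝ) : IsMinGrad (c • g) (c • G) := by
  rw [isMinGrad_iff] at h ⊢
  have h1 := (gradTrace d α).smul_mem c h.1
  rw [Prod.smul_mk] at h1
  exact ⟨h1, Submodule.smul_mem _ c h.2⟩

/-! ### Hardy's inequality and polar coordinates -/

/-- Polar coordinates for a nonnegative radial function, with no integrability assumption. -/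
theorem lintegral_fun_norm {E : Type*} [NormedAddCommGroup E] [NormedSpace ℝ E]
    [FiniteDimensional ℝ E] [MeasurableSpace E] [BorelSpace E] [Nontrivial E] (μ : Measure E)
    [μ.IsAddHaarMeasure] {F : ℝ → ℝ≥0∞} (hF : Measurable F) :
    ∫⁻ x, F ‖x‖ ∂μ = μ.toSphere Set.univ *
      ∫⁻ t in Set.Ioi (0 : ℝ), ENNReal.ofReal (t ^ (Module.finrank ℝ E - 1)) * F t := by
  have h1 := μ.measurePreserving_homeomorphUnitSphereProd.lintegral_comp_emb
    (Homeomorph.measurableEmbedding _) (fun p => F p.2)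
  simp only [homeomorphUnitSphereProd_apply_snd_coe] at h1
  rw [lintegral_subtype_comap (measurableSet_singleton (0 : E)).compl (fun x => F ‖x‖),
    restrict_compl_singleton] at h1
  have h2 := lintegral_prod (μ := μ.toSphere)
    (ν := Measure.volumeIoiPow (Module.finrank ℝ E - 1))
    (fun p : Metric.sphere (0 : E) 1 × Set.Ioi (0 : ℝ) => F p.2) (by fun_prop)
  simp only [lintegral_const] at h2
  rw [h1, h2, mul_comm, Measure.volumeIoiPow,
    lintegral_withDensity_eq_lintegral_mul _ (by fun_prop) (by fun_prop),
    ← lintegral_subtype_comap measurableSet_Ioi]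
  rfl

/-- The weighted inequality of Hardy. -/
theorem lintegral_hardy {s : ℝ} (hs : 0 < s) {f : ℝ → ℝ≥0∞} (hf : Measurable f) :
    ∫⁻ t in Set.Ioi (0 : ℝ), ENNReal.ofReal (t ^ (-1 - 2 * s)) *
        (∫⁻ τ in Set.Ioo 0 t, f τ) ^ 2 ≤
      ENNReal.ofReal (1 / s ^ 2) *
        ∫⁻ τ in Set.Ioi (0 : ℝ), ENNReal.ofReal (τ ^ (1 - 2 * s)) * f τ ^ 2 := by
  have h1 : ∀ t ∈ Set.Ioi (0 : ℝ), ENNReal.ofReal (t ^ (-1 - 2 * s)) *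
      (∫⁻ τ in Set.Ioo 0 t, f τ) ^ 2 ≤ ∫⁻ τ in Set.Ioi (0 : ℝ), (Set.Ioi τ).indicator
        (fun t => ENNReal.ofReal (t ^ (-1 - s) / s) * (ENNReal.ofReal (τ ^ (1 - s)) * f τ ^ 2))
          t := by
    intro t (ht : 0 < t)
    -- The exponent `1 - s` lies strictly between `1 - 2s` and `1`: below `1` for Cauchy-Schwarz,
    -- above `1 - 2s` so that after Tonelli the remaining `t^(-1-s)/s` is integrable at infinity,
    -- with integral `τ^(-s)/s²` over `(τ, ∞)`.
    have h2 := sq_lintegral_Ioo_le (β := 1 - s) (by linarith) ht.le (f := f) hf.aemeasurable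
    calc ENNReal.ofReal (t ^ (-1 - 2 * s)) * (∫⁻ τ in Set.Ioo 0 t, f τ) ^ 2
        ≤ ENNReal.ofReal (t ^ (-1 - 2 * s)) * (ENNReal.ofReal (t ^ (1 - (1 - s)) / (1 - (1 - s))) *
          ∫⁻ τ in Set.Ioo 0 t, ENNReal.ofReal (τ ^ (1 - s)) * f τ ^ 2) := by gcongr
      _ = ∫⁻ τ in Set.Ioo 0 t, ENNReal.ofReal (t ^ (-1 - s) / s) *
          (ENNReal.ofReal (τ ^ (1 - s)) * f τ ^ 2) := by
          rw [lintegral_const_mul _ (by fun_prop), ← mul_assoc,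
            ← ENNReal.ofReal_mul (Real.rpow_nonneg ht.le _), ← mul_div_assoc, ← Real.rpow_add ht]
          congr 3 <;> ring_nf
      _ = _ := by
          rw [← lintegral_indicator measurableSet_Ioo, ← lintegral_indicator measurableSet_Ioi]
          refine lintegral_congr fun τ => ?_
          by_cases h0 : 0 < τ <;> by_cases h1 : τ < t <;> simp [Set.indicator, h0, h1]
  refine (setLIntegral_mono' measurableSet_Ioi h1).trans ?_
  rw [lintegral_lintegral_swap]
  · rw [← lintegral_const_mul _ (by fun_prop)]
    refine setLIntegral_mono' measurableSet_Ioi fun τ (hτ : 0 < τ) => ?_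
    rw [lintegral_indicator measurableSet_Ioi, Measure.restrict_restrict measurableSet_Ioi,
      Set.inter_eq_left.mpr (Set.Ioi_subset_Ioi hτ.le), lintegral_mul_const _ (by fun_prop)]
    have e : ∫⁻ t in Set.Ioi τ, ENNReal.ofReal (t ^ (-1 - s) / s) =
        ENNReal.ofReal (τ ^ (-s) / s ^ 2) := by
      simp_rw [div_eq_mul_inv _ s, ENNReal.ofReal_mul' (inv_nonneg.mpr hs.le)]
      rw [lintegral_mul_const _ (by fun_prop), lintegral_rpow_Ioi (by linarith) hτ,
        ← ENNReal.ofReal_mul' (inv_nonneg.mpr hs.le)]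
      congr 1
      rw [show -1 - s + 1 = -s by ring, neg_neg]
      field_simp
    rw [e, ← mul_assoc, ← mul_assoc, ← ENNReal.ofReal_mul (by positivity),
      ← ENNReal.ofReal_mul (by positivity)]
    refine le_of_eq ?_
    congr 2
    rw [div_mul_eq_mul_div, ← Real.rpow_add hτ, div_mul_eq_mul_div, one_mul]
    ring_nf
  · have : Measurable fun q : ℝ × ℝ => {q : ℝ × ℝ | q.2 < q.1}.indicator (fun q =>
        ENNReal.ofReal (q.1 ^ (-1 - s) / s) * (ENNReal.ofReal (q.2 ^ (1 - s)) * f q.2 ^ 2)) q :=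
      Measurable.indicator (by fun_prop) (measurableSet_lt measurable_snd measurable_fst)
    exact this.aemeasurable

/-! ### The trace inequality -/

/-- The fundamental theorem of calculus along the horizontal segment at height `t`, followed by
Cauchy-Schwarz on the unit interval. -/
theorem enorm_sub_sq_le_lintegral {d : ℕ} {φ : Rd d × ℝ → ℝ}
    (hφ : ContDiff ℝ ((⊤ : ℕ∞) : WithTop ℕ∞) φ) (x h : Rd d) (t : ℝ) :
    ‖φ (x, t) - φ (x + h, t)‖ₑ ^ 2 ≤
      ‖h‖ₑ ^ 2 * ∫⁻ θ in Set.Ioo (0 : ℝ) 1, ‖classicalGrad φ (x + θ • h, t)‖ₑ ^ 2 := by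
  have hd : Differentiable ℝ φ := hφ.differentiable (by simp)
  have hder : ∀ θ : ℝ, HasDerivAt (fun θ : ℝ => φ (x + θ • h, t))
      (inner ℝ (classicalGrad φ (x + θ • h, t)) (WithLp.toLp 2 (h, (0 : ℝ)))) θ := by
    intro θ
    rw [inner_classicalGrad (hd _)]
    have h1 : HasDerivAt (fun θ : ℝ => (x + θ • h, t)) (h, (0 : ℝ)) θ := by
      have := ((hasDerivAt_id θ).smul_const h).const_add x
      simpa using this.prodMk (hasDerivAt_const θ t)
    exact (hd (x + θ • h, t)).hasFDerivAt.comp_hasDerivAt θ h1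
  have hcg : Continuous (fun θ : ℝ => classicalGrad φ (x + θ • h, t)) :=
    (continuous_classicalGrad hφ).comp (by fun_prop)
  have hcm := hcg.measurable
  have hc : Continuous (fun θ : ℝ =>
      inner ℝ (classicalGrad φ (x + θ • h, t)) (WithLp.toLp 2 (h, (0 : ℝ)) : GradVec d)) := by
    fun_prop
  have hI := intervalIntegral.integral_eq_sub_of_hasDerivAt (a := 0) (b := 1)
    (fun θ _ => hder θ) (hc.intervalIntegrable _ _)
  rw [intervalIntegral.integral_of_le zero_le_one, ← Measure.restrict_congr_set Ioo_ae_eq_Ioc,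
    one_smul, zero_smul, add_zero] at hI
  have hh : ‖(WithLp.toLp 2 (h, (0 : ℝ)) : GradVec d)‖ₑ = ‖h‖ₑ := by
    simp [enorm]
  rw [enorm_sub_rev, ← hI]
  calc ‖∫ θ in Set.Ioo (0 : ℝ) 1,
        inner ℝ (classicalGrad φ (x + θ • h, t)) (WithLp.toLp 2 (h, (0 : ℝ)) : GradVec d)‖ₑ ^ 2
      ≤ (∫⁻ θ in Set.Ioo (0 : ℝ) 1, ‖h‖ₑ * ‖classicalGrad φ (x + θ • h, t)‖ₑ) ^ 2 := by
        gcongr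
        refine (enorm_integral_le_lintegral_enorm _).trans (lintegral_mono fun θ => ?_)
        rw [← hh, mul_comm]
        exact ENNReal.coe_le_coe.mpr ((nnnorm_inner_le_nnnorm (𝕜 := ℝ) _ _).trans_eq rfl)
    _ = ‖h‖ₑ ^ 2 * (∫⁻ θ in Set.Ioo (0 : ℝ) 1, ‖classicalGrad φ (x + θ • h, t)‖ₑ) ^ 2 := by
        rw [lintegral_const_mul _ hcm.enorm, mul_pow]
    _ ≤ _ := by
        gcongr
        have := sq_lintegral_Ioo_le (β := 0) (t := 1) (by norm_num) zero_le_one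
          (f := fun θ => ‖classicalGrad φ (x + θ • h, t)‖ₑ) hcm.enorm.aemeasurable
        simpa using this

theorem lintegral_enorm_sub_translate_le {d : ℕ} {φ : Rd d × ℝ → ℝ}
    (hφ : ContDiff ℝ ((⊤ : ℕ∞) : WithTop ℕ∞) φ) (h : Rd d) (t : ℝ) :
    ∫⁻ x, ‖φ (x, t) - φ (x + h, t)‖ₑ ^ 2 ≤
      ‖h‖ₑ ^ 2 * ∫⁻ x, ‖classicalGrad φ (x, t)‖ₑ ^ 2 := by
  have hcg : Measurable (classicalGrad φ) := (continuous_classicalGrad hφ).measurable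
  refine (lintegral_mono fun x => enorm_sub_sq_le_lintegral hφ x h t).trans ?_
  rw [lintegral_const_mul' _ _ (by simp)]
  refine mul_le_mul_right ?_ _
  rw [lintegral_lintegral_swap (Measurable.aemeasurable (by fun_prop))]
  have : ∀ θ : ℝ, ∫⁻ x, ‖classicalGrad φ (x + θ • h, t)‖ₑ ^ 2 =
      ∫⁻ x, ‖classicalGrad φ (x, t)‖ₑ ^ 2 := fun θ =>
    lintegral_add_right_eq_self (fun x => ‖classicalGrad φ (x, t)‖ₑ ^ 2) (θ • h)
  simp [this]

/-- Hardy's inequality on each vertical line, integrated over `x`. -/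
theorem lintegral_hardy_smooth {d : ℕ} {s : ℝ} (hs : 0 < s) {φ : Rd d × ℝ → ℝ}
    (hφ : ContDiff ℝ ((⊤ : ℕ∞) : WithTop ℕ∞) φ) :
    ∫⁻ t in Set.Ioi (0 : ℝ), ENNReal.ofReal (t ^ (-1 - 2 * s)) *
        ∫⁻ x, ‖φ (x, t) - φ (x, 0)‖ₑ ^ 2 ≤
      ENNReal.ofReal (1 / s ^ 2) * ∫⁻ p, ‖classicalGrad φ p‖ₑ ^ 2
        ∂weightedMeasure d (1 - 2 * s) := by
  have hcg : Measurable (classicalGrad φ) := (continuous_classicalGrad hφ).measurable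
  have hφm : Measurable φ := hφ.continuous.measurable
  rw [lintegral_weightedMeasure _ (by fun_prop)]
  simp_rw [← lintegral_const_mul' (ENNReal.ofReal (_ ^ (-1 - 2 * s))) _ ENNReal.ofReal_ne_top]
  rw [lintegral_lintegral_swap (Measurable.aemeasurable (by fun_prop)), ← lintegral_const_mul' _ _ ENNReal.ofReal_ne_top]
  refine lintegral_mono fun x => ?_
  refine le_trans ?_ (lintegral_hardy hs (f := fun τ => ‖classicalGrad φ (x, τ)‖ₑ)
    (by fun_prop))
  refine setLIntegral_mono' measurableSet_Ioi fun t ht => ?_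
  gcongr
  rw [primitive_classicalGrad hφ (le_of_lt ht), add_sub_cancel_left]
  refine (enorm_integral_le_lintegral_enorm _).trans (lintegral_mono fun τ => ?_)
  exact WithLp.enorm_snd_le ..

/-- Go from `(x, 0)` up to height `t`, across by `h`, and down to `(x + h, 0)`. By translation
invariance the two vertical legs have the same integral, hence `6 = 2 + 4`. -/
theorem lintegral_enorm_sub_trace_le {d : ℕ} {φ : Rd d × ℝ → ℝ}
    (hφ : ContDiff ℝ ((⊤ : ℕ∞) : WithTop ℕ∞) φ) (h : Rd d) (t : ℝ) :
    ∫⁻ x, ‖φ (x, 0) - φ (x + h, 0)‖ₑ ^ 2 ≤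
      6 * (∫⁻ x, ‖φ (x, t) - φ (x, 0)‖ₑ ^ 2) +
        4 * (‖h‖ₑ ^ 2 * ∫⁻ x, ‖classicalGrad φ (x, t)‖ₑ ^ 2) := by
  have hφm : Measurable φ := hφ.continuous.measurable
  have key : ∀ x, ‖φ (x, 0) - φ (x + h, 0)‖ₑ ^ 2 ≤ 2 * ‖φ (x, t) - φ (x, 0)‖ₑ ^ 2 +
      (4 * ‖φ (x, t) - φ (x + h, t)‖ₑ ^ 2 + 4 * ‖φ (x + h, t) - φ (x + h, 0)‖ₑ ^ 2) := by
    intro x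
    have e : φ (x, 0) - φ (x + h, 0) = (φ (x, 0) - φ (x, t)) +
        ((φ (x, t) - φ (x + h, t)) + (φ (x + h, t) - φ (x + h, 0))) := by ring
    rw [e, enorm_sub_rev (φ (x, t)) (φ (x, 0))]
    refine (pow_le_pow_left' (enorm_add_le _ _) 2).trans
      ((ENNReal.add_sq_le_two_mul _ _).trans ?_)
    gcongr
    calc 2 * ‖φ (x, t) - φ (x + h, t) + (φ (x + h, t) - φ (x + h, 0))‖ₑ ^ 2
        ≤ 2 * (2 * ‖φ (x, t) - φ (x + h, t)‖ₑ ^ 2 +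
          2 * ‖φ (x + h, t) - φ (x + h, 0)‖ₑ ^ 2) := by
          gcongr
          exact (pow_le_pow_left' (enorm_add_le _ _) 2).trans (ENNReal.add_sq_le_two_mul _ _)
      _ = _ := by ring
  refine (lintegral_mono key).trans ?_
  rw [lintegral_add_left (by fun_prop), lintegral_add_left (by fun_prop),
    lintegral_const_mul _ (by fun_prop), lintegral_const_mul _ (by fun_prop),
    lintegral_const_mul _ (by fun_prop),
    lintegral_add_right_eq_self (fun x => ‖φ (x, t) - φ (x, 0)‖ₑ ^ 2) h]
  calc _ = 6 * (∫⁻ x, ‖φ (x, t) - φ (x, 0)‖ₑ ^ 2) +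
        4 * ∫⁻ x, ‖φ (x, t) - φ (x + h, t)‖ₑ ^ 2 := by ring
    _ ≤ _ := by
      gcongr
      exact lintegral_enorm_sub_translate_le hφ h t

theorem ofReal_slobodeckij_integrand {d : ℕ} (s : ℝ) (a b : ℝ) {h : Rd d} (hh : h ≠ 0) :
    ENNReal.ofReal (|a - b| ^ 2 / ‖h‖ ^ ((d : ℝ) + 2 * s)) =
      ENNReal.ofReal (‖h‖ ^ (-((d : ℝ) + 2 * s))) * ‖a - b‖ₑ ^ 2 := by
  rw [div_eq_inv_mul, Real.rpow_neg (norm_nonneg _), ENNReal.ofReal_mul (by positivity),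
    Real.enorm_eq_ofReal_abs, ENNReal.ofReal_pow (abs_nonneg _)]

theorem slobodeckijSq_eq_translate {d : ℕ} (s : ℝ) {u : Rd d → ℝ} (hu : Measurable u) :
    slobodeckijSq s u =
      ∫⁻ h : Rd d, ENNReal.ofReal (‖h‖ ^ (-((d : ℝ) + 2 * s))) *
        ∫⁻ x, ‖u x - u (x + h)‖ₑ ^ 2 := by
  have e : slobodeckijSq s u = ∫⁻ x, ∫⁻ h : Rd d, ENNReal.ofReal (‖h‖ ^ (-((d : ℝ) + 2 * s))) *
      ‖u x - u (x + h)‖ₑ ^ 2 := by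
    unfold slobodeckijSq
    refine lintegral_congr fun x => ?_
    rw [← lintegral_add_left_eq_self _ x]
    refine lintegral_congr fun h => ?_
    rw [sub_add_cancel_left, norm_neg]
    -- At `h = 0` the value of the kernel is irrelevant, since the difference of `u` vanishes on
    -- both sides.
    by_cases hh : h = 0
    · simp [hh]
    · exact ofReal_slobodeckij_integrand s _ _ hh
  rw [e, lintegral_lintegral_swap (Measurable.aemeasurable (by fun_prop))]
  exact lintegral_congr fun h => lintegral_const_mul' _ _ ENNReal.ofReal_ne_top

/-- The trace inequality for smooth functions. -/
theorem slobodeckijSq_trace_le {d : ℕ} (hd : 1 ≤ d) {s : ℝ} (hs : 0 < s) :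
    ∃ C : ℝ≥0∞, C ≠ ⊤ ∧ ∀ φ : Rd d × ℝ → ℝ, ContDiff ℝ ((⊤ : ℕ∞) : WithTop ℕ∞) φ →
      slobodeckijSq s (fun x => φ (x, 0)) ≤
        C * ∫⁻ p, ‖classicalGrad φ p‖ₑ ^ 2 ∂weightedMeasure d (1 - 2 * s) := by
  have : Nonempty (Fin d) := ⟨⟨0, hd⟩⟩
  set c := (volume : Measure (Rd d)).toSphere Set.univ
  refine ⟨c * (6 * ENNReal.ofReal (1 / s ^ 2) + 4), ENNReal.mul_ne_top (measure_ne_top _ _)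
    (ENNReal.add_ne_top.mpr ⟨ENNReal.mul_ne_top (by simp) ENNReal.ofReal_ne_top, by simp⟩),
    fun φ hφ => ?_⟩
  have hcg : Measurable (classicalGrad φ) := (continuous_classicalGrad hφ).measurable
  have hφm : Measurable φ := hφ.continuous.measurable
  set A : ℝ → ℝ≥0∞ := fun t => ∫⁻ x, ‖φ (x, t) - φ (x, 0)‖ₑ ^ 2 with hA
  set B : ℝ → ℝ≥0∞ := fun t => ∫⁻ x, ‖classicalGrad φ (x, t)‖ₑ ^ 2 with hB
  have hAm : Measurable A := Measurable.lintegral_prod_right'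
    (f := fun q : ℝ × Rd d => ‖φ (q.2, q.1) - φ (q.2, 0)‖ₑ ^ 2) (by fun_prop)
  have hBm : Measurable B := Measurable.lintegral_prod_right'
    (f := fun q : ℝ × Rd d => ‖classicalGrad φ (q.2, q.1)‖ₑ ^ 2) (by fun_prop)
  have hBI : ∫⁻ t in Set.Ioi (0 : ℝ), ENNReal.ofReal (t ^ (1 - 2 * s)) * B t =
      ∫⁻ p, ‖classicalGrad φ p‖ₑ ^ 2 ∂weightedMeasure d (1 - 2 * s) := by
    rw [lintegral_weightedMeasure _ (by fun_prop)]
    simp_rw [hB, ← lintegral_const_mul' _ _ ENNReal.ofReal_ne_top]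
    exact lintegral_lintegral_swap (Measurable.aemeasurable (by fun_prop))
  calc slobodeckijSq s (fun x => φ (x, 0))
      = ∫⁻ h : Rd d, ENNReal.ofReal (‖h‖ ^ (-((d : ℝ) + 2 * s))) *
          ∫⁻ x, ‖φ (x, 0) - φ (x + h, 0)‖ₑ ^ 2 := slobodeckijSq_eq_translate s (by fun_prop)
    _ ≤ ∫⁻ h : Rd d, ENNReal.ofReal (‖h‖ ^ (-((d : ℝ) + 2 * s))) *
          (6 * A ‖h‖ + 4 * (ENNReal.ofReal ‖h‖ ^ 2 * B ‖h‖)) := by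
        refine lintegral_mono fun h => ?_
        gcongr
        rw [ofReal_norm]
        -- The height is chosen equal to `‖h‖`. The bound is then radial in `h`, and polar
        -- coordinates turn the kernel into `t^(-1-2s)`: the `A` term is Hardy's integral and the
        -- `B` term, with its factor `t²`, is the weighted energy.
        exact lintegral_enorm_sub_trace_le hφ h ‖h‖
    _ = c * ∫⁻ t in Set.Ioi (0 : ℝ), ENNReal.ofReal (t ^ (d - 1)) *
          (ENNReal.ofReal (t ^ (-((d : ℝ) + 2 * s))) *
            (6 * A t + 4 * (ENNReal.ofReal t ^ 2 * B t))) := by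
        rw [lintegral_fun_norm volume (F := fun t => ENNReal.ofReal (t ^ (-((d : ℝ) + 2 * s))) *
          (6 * A t + 4 * (ENNReal.ofReal t ^ 2 * B t))) (by fun_prop)]
        simp [c]
    _ = c * ∫⁻ t in Set.Ioi (0 : ℝ), (6 * (ENNReal.ofReal (t ^ (-1 - 2 * s)) * A t) +
          4 * (ENNReal.ofReal (t ^ (1 - 2 * s)) * B t)) := by
        congr 1
        refine setLIntegral_congr_fun measurableSet_Ioi fun t (ht : 0 < t) => ?_
        have e1 : ENNReal.ofReal (t ^ (d - 1)) * ENNReal.ofReal (t ^ (-((d : ℝ) + 2 * s))) =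
            ENNReal.ofReal (t ^ (-1 - 2 * s)) := by
          rw [← ENNReal.ofReal_mul (by positivity), ← Real.rpow_natCast, ← Real.rpow_add ht]
          congr 2
          push_cast [Nat.cast_sub hd]
          ring
        have e2 : ENNReal.ofReal (t ^ (1 - 2 * s)) =
            ENNReal.ofReal (t ^ (-1 - 2 * s)) * ENNReal.ofReal t ^ 2 := by
          rw [← ENNReal.ofReal_pow ht.le, ← ENNReal.ofReal_mul (by positivity),
            ← Real.rpow_natCast t 2, ← Real.rpow_add ht]
          congr 2
          push_cast
          ring
        rw [← mul_assoc, e1, e2]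
        ring
    _ = c * (6 * (∫⁻ t in Set.Ioi (0 : ℝ), ENNReal.ofReal (t ^ (-1 - 2 * s)) * A t) +
          4 * ∫⁻ t in Set.Ioi (0 : ℝ), ENNReal.ofReal (t ^ (1 - 2 * s)) * B t) := by
        rw [lintegral_add_left (by fun_prop), lintegral_const_mul _ (by fun_prop),
          lintegral_const_mul _ (by fun_prop)]
    _ ≤ c * (6 * (ENNReal.ofReal (1 / s ^ 2) * ∫⁻ p, ‖classicalGrad φ p‖ₑ ^ 2
          ∂weightedMeasure d (1 - 2 * s)) + 4 * ∫⁻ p, ‖classicalGrad φ p‖ₑ ^ 2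
          ∂weightedMeasure d (1 - 2 * s)) := by
        rw [hBI]
        gcongr
        exact lintegral_hardy_smooth hs hφ
    _ = _ := by ring

theorem eLpNorm_slobodeckijQuot_trace_le {d : ℕ} (hd : 1 ≤ d) {s : ℝ} (hs : 0 < s) :
    ∃ C : ℝ≥0∞, C ≠ ⊤ ∧ ∀ φ : Rd d × ℝ → ℝ, ContDiff ℝ ((⊤ : ℕ∞) : WithTop ℕ∞) φ →
      eLpNorm (slobodeckijQuot s fun x => φ (x, 0)) 2 (volume.prod volume) ≤
        C * eLpNorm (classicalGrad φ) 2 (weightedMeasure d (1 - 2 * s)) := by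
  obtain ⟨C, hC, h⟩ := slobodeckijSq_trace_le hd hs
  refine ⟨C ^ (1 / 2 : ℝ), ENNReal.rpow_ne_top_of_nonneg (by norm_num) hC, fun φ hφ => ?_⟩
  have h1 := h φ hφ
  rw [slobodeckijSq_eq s (by have := hφ.continuous; fun_prop), ← eLpNorm_two_sq] at h1
  refine (ENNReal.pow_le_pow_left_iff two_ne_zero).mp (h1.trans_eq ?_)
  rw [mul_pow, ← ENNReal.rpow_two (C ^ _), ← ENNReal.rpow_mul]
  norm_num

theorem iUnion_ball_prod_ball (E : Type*) [NormedAddCommGroup E] :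
    ⋃ n : ℕ, (Metric.ball (0 : E) n ×ˢ Metric.ball (0 : E) n) = Set.univ := by
  rw [Set.eq_univ_iff_forall]
  intro p
  obtain ⟨n, hn⟩ := exists_nat_gt (max ‖p.1‖ ‖p.2‖)
  rw [max_lt_iff] at hn
  exact Set.mem_iUnion.mpr ⟨n, by simpa using hn⟩

/-- The trace inequality. -/
theorem exists_slobodeckijSq_le {d : ℕ} (hd : 1 ≤ d) {s : ℝ} (hs : 0 < s) :
    ∃ C : ℝ≥0∞, C ≠ ⊤ ∧ ∀ (u : Lp ℝ 2 (volume : Measure (Rd d))) (G : GradL2 d (1 - 2 * s)),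
      (G, u) ∈ gradTrace d (1 - 2 * s) → slobodeckijSq s u ≤ C * ‖G‖ₑ ^ 2 := by
  obtain ⟨C, hC, hCφ⟩ := eLpNorm_slobodeckijQuot_trace_le hd hs
  refine ⟨C ^ 2, ENNReal.pow_ne_top hC, fun u G h => ?_⟩
  obtain ⟨φ, h1, h2⟩ := mem_gradTrace_iff.mp h
  have hu : Measurable u := (Lp.stronglyMeasurable u).measurable
  have hφm : ∀ n, Measurable fun x => (φ n).1 (x, 0) := fun n => by
    have := (φ n).2.1.continuous
    fun_prop
  have hb : Tendsto (fun n => C * (eLpNorm (fun p => classicalGrad (φ n) p - G p) 2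
      (weightedMeasure d (1 - 2 * s)) + ‖G‖ₑ)) atTop (𝓝 (C * ‖G‖ₑ)) := by
    have := ENNReal.Tendsto.const_mul (h1.add_const ‖G‖ₑ) (Or.inr hC)
    rwa [zero_add] at this
  have hR : ∀ R : ℝ, eLpNorm (slobodeckijQuot s u) 2
      ((volume.prod volume).restrict (Metric.ball 0 R ×ˢ Metric.ball 0 R)) ≤ C * ‖G‖ₑ := by
    intro R
    -- Traces converge only in `L²` on balls. On each ball a subsequence converges almost
    -- everywhere, so the difference quotients converge almost everywhere on the product of the ball
    -- with itself, and Fatou's lemma applies.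
    obtain ⟨ns, hns, hae⟩ := (tendstoInMeasure_of_tendsto_eLpNorm two_ne_zero
      (fun n => (hφm n).aestronglyMeasurable) hu.aestronglyMeasurable (h2 R)).exists_seq_tendsto_ae
    rw [← Measure.prod_restrict]
    set ν := (volume : Measure (Rd d)).restrict (Metric.ball 0 R)
    refine (Lp.eLpNorm_lim_le_liminf_eLpNorm (f := fun k =>
      slobodeckijQuot s fun x => (φ (ns k)).1 (x, 0))
      (fun k => (measurable_slobodeckijQuot s (hφm _)).aestronglyMeasurable) _ ?_).trans ?_
    · filter_upwards [(Measure.quasiMeasurePreserving_fst (μ := ν) (ν := ν)).ae hae,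
        (Measure.quasiMeasurePreserving_snd (μ := ν) (ν := ν)).ae hae] with p hp1 hp2
      exact (hp1.sub hp2).div_const _
    · rw [← (hb.comp hns.tendsto_atTop).liminf_eq]
      refine liminf_le_liminf (Eventually.of_forall fun k => ?_)
      rw [Measure.prod_restrict]
      refine (eLpNorm_mono_measure _ Measure.restrict_le_self).trans
        ((hCφ _ (φ (ns k)).2.1).trans (mul_le_mul_right ?_ _))
      rw [Lp.enorm_def]
      have e : classicalGrad (φ (ns k)).1 =
          (fun p => classicalGrad (φ (ns k)).1 p - G p) + G := by
        funext p
        simp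
      conv_lhs => rw [e]
      have hc := continuous_classicalGrad (φ (ns k)).2.1
      exact eLpNorm_add_le (hc.aestronglyMeasurable.sub
        (Lp.stronglyMeasurable G).aestronglyMeasurable)
        (Lp.stronglyMeasurable G).aestronglyMeasurable one_le_two
  rw [slobodeckijSq_eq s hu, eLpNorm_two_sq, ← setLIntegral_univ, ← iUnion_ball_prod_ball,
    setLIntegral_iUnion_of_directed]
  · refine iSup_le fun n => ?_
    rw [← eLpNorm_two_sq, ← mul_pow]
    exact pow_le_pow_left' (hR n) 2
  · refine directed_of_isDirected_le fun m n hmn => ?_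
    have : Metric.ball (0 : Rd d) m ⊆ Metric.ball 0 n :=
      Metric.ball_subset_ball (by exact_mod_cast hmn)
    exact Set.prod_mono this this

/-- The fractional inequality of Poincaré for functions with bounded support. -/
theorem exists_eLpNorm_sq_le_slobodeckijSq {d : ℕ} (hd : 1 ≤ d) {s : ℝ} (hs : 0 < s)
    {K : Set (Rd d)} (hK : Bornology.IsBounded K) :
    ∃ C : ℝ≥0∞, C ≠ ⊤ ∧ ∀ u : Rd d → ℝ, (∀ᵐ x, x ∉ K → u x = 0) →
      eLpNorm u 2 volume ^ 2 ≤ C * slobodeckijSq s u := by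
  have : Nonempty (Fin d) := ⟨⟨0, hd⟩⟩
  obtain ⟨R, hR0, hR⟩ := hK.subset_closedBall_lt 0 (0 : Rd d)
  -- The unit ball around `y₀` lies outside `K`, so `u` vanishes there, and its points are within `L
  -- = R + (R + 3)` of every point of `K`. Restricting the inner integral to this ball leaves `a |u
  -- x|²`.
  obtain ⟨y₀, hy₀⟩ := exists_norm_eq (Rd d) (c := R + 2) (by linarith)
  set L : ℝ := 2 * R + 3
  set a : ℝ≥0∞ := ENNReal.ofReal ((L ^ ((d : ℝ) + 2 * s))⁻¹) * volume (Metric.ball y₀ 1) with ha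
  have hL : 0 < L := by simp only [L]; linarith
  have ha0 : a ≠ 0 := mul_ne_zero (by simp; positivity)
    (Metric.measure_ball_pos volume y₀ one_pos).ne'
  have hatop : a ≠ ⊤ := ENNReal.mul_ne_top ENNReal.ofReal_ne_top measure_ball_lt_top.ne
  refine ⟨a⁻¹, ENNReal.inv_ne_top.mpr ha0, fun u hu => ?_⟩
  rw [mul_comm, ← div_eq_mul_inv, ENNReal.le_div_iff_mul_le (Or.inl ha0) (Or.inl hatop),
    eLpNorm_two_sq, ← lintegral_mul_const' _ _ hatop]
  unfold slobodeckijSq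
  refine lintegral_mono_ae ?_
  filter_upwards [hu] with x hx
  by_cases hxK : x ∈ K
  · have hxR : ‖x‖ ≤ R := by simpa using hR hxK
    calc ‖u x‖ₑ ^ 2 * a
        = ∫⁻ y in Metric.ball y₀ 1,
          ENNReal.ofReal ((L ^ ((d : ℝ) + 2 * s))⁻¹) * ‖u x‖ₑ ^ 2 := by
          rw [setLIntegral_const, ha]
          ring
      _ ≤ ∫⁻ y in Metric.ball y₀ 1,
          ENNReal.ofReal (|u x - u y| ^ 2 / ‖x - y‖ ^ ((d : ℝ) + 2 * s)) := by
          refine lintegral_mono_ae ?_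
          filter_upwards [ae_restrict_of_ae hu, ae_restrict_mem measurableSet_ball] with y hy hyb
          rw [Metric.mem_ball, dist_eq_norm] at hyb
          have h1 : R + 1 < ‖y‖ := by
            have := norm_sub_norm_le y₀ y
            rw [norm_sub_rev] at this
            linarith
          have h2 : ‖y‖ ≤ R + 3 := by
            have := norm_sub_norm_le y y₀
            linarith
          have hyK : y ∉ K := fun h => by
            have : ‖y‖ ≤ R := by simpa using hR h
            linarith
          have h3 : 0 < ‖x - y‖ := by
            have := norm_sub_norm_le y x
            rw [norm_sub_rev] at this
            linarith
          have h4 : ‖x - y‖ ≤ L := (norm_sub_le x y).trans (by simp only [L]; linarith)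
          rw [hy hyK, sub_zero, Real.enorm_eq_ofReal_abs, ← ENNReal.ofReal_pow (abs_nonneg _),
            ← ENNReal.ofReal_mul (by positivity), inv_mul_eq_div]
          gcongr
      _ ≤ _ := lintegral_mono' Measure.restrict_le_self le_rfl
  · rw [hx hxK]
    simp

/-- Coercivity: the trace inequality controls the seminorm and the Poincaré inequality the `L²`
norm. Membership of `u` in `H^s` is a conclusion here, not a hypothesis, which is needed for limits
in `isClosed_range_minGrad`. -/
theorem exists_eLpNorm_le_gradTrace {d : ℕ} (hd : 1 ≤ d) {s : ℝ} (hs : 0 < s)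
    {K : Set (Rd d)} (hK : Bornology.IsBounded K) :
    ∃ C : ℝ, 0 < C ∧ ∀ (u : Lp ℝ 2 (volume : Measure (Rd d))) (G : GradL2 d (1 - 2 * s)),
      (∀ᵐ x, x ∉ K → u x = 0) → (G, u) ∈ gradTrace d (1 - 2 * s) →
      slobodeckijSq s u < ⊤ ∧ ‖u‖ ≤ sobolevNorm s u ∧ sobolevNorm s u ≤ C * ‖G‖ := by
  obtain ⟨C₁, hC₁, h₁⟩ := exists_slobodeckijSq_le hd hs
  obtain ⟨C₂, hC₂, h₂⟩ := exists_eLpNorm_sq_le_slobodeckijSq hd hs hK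
  -- The summand `1` only makes the constant positive.
  refine ⟨√((C₂ * C₁).toReal + C₁.toReal) + 1, by positivity, fun u G hu h => ?_⟩
  have h3 := h₁ u G h
  have hfin : slobodeckijSq s u < ⊤ := h3.trans_lt
    (ENNReal.mul_lt_top hC₁.lt_top (ENNReal.pow_lt_top enorm_lt_top))
  have h3' : (slobodeckijSq s u).toReal ≤ C₁.toReal * ‖G‖ ^ 2 := by
    have := ENNReal.toReal_mono (ENNReal.mul_ne_top hC₁ (ENNReal.pow_ne_top enorm_ne_top)) h3
    simpa using this
  have h4 : ‖u‖ ^ 2 ≤ (C₂ * C₁).toReal * ‖G‖ ^ 2 := by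
    have h5 := (h₂ u hu).trans (mul_le_mul_right h3 C₂)
    rw [← Lp.enorm_def, ← mul_assoc] at h5
    have := ENNReal.toReal_mono (ENNReal.mul_ne_top (ENNReal.mul_ne_top hC₂ hC₁)
      (ENNReal.pow_ne_top enorm_ne_top)) h5
    simpa using this
  refine ⟨hfin, Real.le_sqrt_of_sq_le (le_add_of_nonneg_right ENNReal.toReal_nonneg), ?_⟩
  rw [sobolevNorm]
  calc √(‖u‖ ^ 2 + (slobodeckijSq s u).toReal)
      ≤ √(((C₂ * C₁).toReal + C₁.toReal) * ‖G‖ ^ 2) := by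
        refine Real.sqrt_le_sqrt ?_
        linarith
    _ = √((C₂ * C₁).toReal + C₁.toReal) * ‖G‖ := by
        rw [Real.sqrt_mul' _ (sq_nonneg _), Real.sqrt_sq (norm_nonneg _)]
    _ ≤ _ := by
        gcongr
        linarith

/-! ### The kernel of the extension by averages -/

/-- A bump function on the unit ball. -/
noncomputable def unitBump (d : ℕ) : ContDiffBump (0 : Rd d) where
  rIn := 1 / 2
  rOut := 1
  rIn_pos := by norm_num
  rIn_lt_rOut := by norm_num

/-- The mollifier `y ↦ r^{-d} η(y / r)`, as a function of `(r, y)`. -/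
noncomputable def scaledBump (d : ℕ) (p : ℝ × Rd d) : ℝ :=
  (p.1 ^ d)⁻¹ * (unitBump d).normed volume (p.1⁻¹ • p.2)

theorem scaledBump_eq_zero {d : ℕ} {p : ℝ × Rd d} (hp : 0 < p.1) (h : p.1 ≤ ‖p.2‖) :
    scaledBump d p = 0 := by
  have : p.1⁻¹ • p.2 ∉ Function.support ((unitBump d).normed volume) := by
    rw [ContDiffBump.support_normed_eq]
    simp only [unitBump, Metric.mem_ball, dist_zero_right, not_lt]
    rw [norm_smul, norm_inv, Real.norm_of_nonneg hp.le, ← div_eq_inv_mul, one_le_div hp]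
    exact h
  rw [scaledBump, Function.notMem_support.mp this, mul_zero]

theorem contDiffAt_scaledBump {d : ℕ} {p : ℝ × Rd d} (hp : 0 < p.1) :
    ContDiffAt ℝ ((⊤ : ℕ∞) : WithTop ℕ∞) (scaledBump d) p := by
  have hη : ContDiff ℝ ((⊤ : ℕ∞) : WithTop ℕ∞) ((unitBump d).normed volume) :=
    (unitBump d).contDiff_normed
  have h1 : ContDiffAt ℝ ((⊤ : ℕ∞) : WithTop ℕ∞) (fun p : ℝ × Rd d => p.1) p := contDiffAt_fst
  exact ((h1.pow d).inv (pow_pos hp d).ne').mul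
    (hη.contDiffAt.comp p ((h1.inv hp.ne').smul contDiffAt_snd))

/-- Homogeneity of degree `-d` in `(r, y)` jointly; it reduces derivative bounds at every scale to
the scale `r = 1`. -/
theorem scaledBump_smul {d : ℕ} {r : ℝ} (hr : 0 < r) (p : ℝ × Rd d) :
    scaledBump d p = (r ^ d)⁻¹ * scaledBump d (r⁻¹ • p) := by
  simp only [scaledBump, Prod.smul_fst, Prod.smul_snd, smul_eq_mul, mul_inv, inv_inv, mul_pow,
    inv_pow, ← mul_assoc]
  rw [inv_mul_cancel₀ (pow_pos hr d).ne', one_mul, smul_smul, mul_right_comm,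
    mul_inv_cancel₀ hr.ne', one_mul]

theorem integral_scaledBump {d : ℕ} {r : ℝ} (hr : 0 < r) :
    ∫ y, scaledBump d (r, y) = 1 := by
  simp only [scaledBump]
  rw [integral_const_mul, Measure.integral_comp_inv_smul_of_nonneg _ _ hr.le,
    (unitBump d).integral_normed]
  simp [hr.ne']

theorem exists_norm_scaledBump_le (d : ℕ) :
    ∃ M : ℝ, 0 ≤ M ∧ ∀ r : ℝ, 0 < r → ∀ y : Rd d, ‖scaledBump d (r, y)‖ ≤ M * (r ^ d)⁻¹ := by
  obtain ⟨M, hM⟩ := (unitBump d).continuous_normed (μ := volume)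
    |>.bounded_above_of_compact_support (unitBump d).hasCompactSupport_normed
  refine ⟨M, (norm_nonneg _).trans (hM 0), fun r hr y => ?_⟩
  rw [scaledBump, norm_mul, mul_comm, Real.norm_of_nonneg (by positivity : 0 ≤ (r ^ d)⁻¹)]
  gcongr
  exact hM _

theorem fderiv_scaledBump_smul {d : ℕ} {r : ℝ} (hr : 0 < r) (y : Rd d) :
    fderiv ℝ (scaledBump d) (r, y) =
      ((r ^ d)⁻¹ * r⁻¹) • fderiv ℝ (scaledBump d) (1, r⁻¹ • y) := by
  have h1 : DifferentiableAt ℝ (scaledBump d) (r⁻¹ • (r, y)) :=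
    (contDiffAt_scaledBump (by simp [hr.ne'])).differentiableAt (by simp)
  have h2 : HasFDerivAt (fun p : ℝ × Rd d => r⁻¹ • p)
      (r⁻¹ • ContinuousLinearMap.id ℝ (ℝ × Rd d)) (r, y) :=
    (hasFDerivAt_id _).const_smul r⁻¹
  have h3 := (h1.hasFDerivAt.comp (r, y) h2).const_mul (r ^ d)⁻¹
  have e : (fun p => (r ^ d)⁻¹ * (scaledBump d ∘ fun p : ℝ × Rd d => r⁻¹ • p) p) =
      scaledBump d := by
    funext p
    exact (scaledBump_smul hr p).symm
  rw [e] at h3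
  rw [h3.fderiv, Prod.smul_mk, smul_eq_mul, inv_mul_cancel₀ hr.ne', mul_smul]
  congr 1
  ext v <;> simp

/-- At `r = 1` the derivative is continuous in `y` and vanishes outside the closed unit ball, hence
is bounded. The derivative is homogeneous of degree `-(d + 1)`, which gives all other `r`. -/
theorem exists_norm_fderiv_scaledBump_le (d : ℕ) :
    ∃ M : ℝ, 0 ≤ M ∧ ∀ r : ℝ, 0 < r → ∀ y : Rd d,
      ‖fderiv ℝ (scaledBump d) (r, y)‖ ≤ M * (r ^ (d + 1))⁻¹ ∧
      (r < ‖y‖ → fderiv ℝ (scaledBump d) (r, y) = 0) := by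
  have hzero : ∀ y : Rd d, 1 < ‖y‖ → fderiv ℝ (scaledBump d) (1, y) = 0 := by
    intro y hy
    have : scaledBump d =ᶠ[𝓝 (1, y)] fun _ => 0 := by
      have ho : IsOpen {p : ℝ × Rd d | 0 < p.1 ∧ p.1 < ‖p.2‖} :=
        (isOpen_lt continuous_const continuous_fst).inter
          (isOpen_lt continuous_fst continuous_snd.norm)
      filter_upwards [ho.mem_nhds ⟨one_pos, hy⟩] with p hp
      exact scaledBump_eq_zero hp.1 hp.2.le
    rw [this.fderiv_eq, fderiv_const_apply]
  have hcont : Continuous fun y : Rd d => fderiv ℝ (scaledBump d) (1, y) := by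
    rw [continuous_iff_continuousAt]
    intro y
    have h1 : ContDiffAt ℝ 1 (scaledBump d) (1, y) :=
      (contDiffAt_scaledBump (by simp)).of_le (by exact_mod_cast le_top)
    exact ContinuousAt.comp (f := fun y : Rd d => ((1 : ℝ), y)) (h1.continuousAt_fderiv
      one_ne_zero) (by fun_prop)
  obtain ⟨M, hM⟩ := (isCompact_closedBall (0 : Rd d) 1).exists_bound_of_continuousOn
    hcont.continuousOn
  have hM0 : 0 ≤ M := (norm_nonneg _).trans (hM 0 (by simp))
  refine ⟨M, hM0, fun r hr y => ⟨?_, fun hy => ?_⟩⟩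
  · have h1 : ‖fderiv ℝ (scaledBump d) (1, r⁻¹ • y)‖ ≤ M := by
      rcases le_or_gt ‖r⁻¹ • y‖ 1 with h | h
      · exact hM _ (by simpa using h)
      · rw [hzero _ h, norm_zero]
        exact hM0
    rw [fderiv_scaledBump_smul hr, norm_smul, pow_succ, mul_inv, mul_comm M,
      Real.norm_of_nonneg (by positivity)]
    gcongr
  · rw [fderiv_scaledBump_smul hr, hzero, smul_zero]
    rwa [norm_smul, norm_inv, Real.norm_of_nonneg hr.le, ← div_eq_inv_mul, one_lt_div hr]

/-- A smooth and positive substitute for the distance to the boundary. -/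
noncomputable def smoothHeight (ε t : ℝ) : ℝ := √(t ^ 2 + ε ^ 2)

theorem smoothHeight_pos {ε : ℝ} (hε : 0 < ε) (t : ℝ) : 0 < smoothHeight ε t :=
  Real.sqrt_pos.mpr (by positivity)

theorem le_smoothHeight (ε t : ℝ) : t ≤ smoothHeight ε t :=
  Real.le_sqrt_of_sq_le (by nlinarith [sq_nonneg ε])

theorem smoothHeight_le {ε : ℝ} (hε : 0 < ε) (t : ℝ) : smoothHeight ε t ≤ |t| + ε := by
  rw [smoothHeight, Real.sqrt_le_left (by positivity)]
  nlinarith [abs_nonneg t, sq_abs t]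

theorem smoothHeight_zero {ε : ℝ} (hε : 0 < ε) : smoothHeight ε 0 = ε := by
  simp [smoothHeight, Real.sqrt_sq hε.le]

theorem contDiff_smoothHeight {ε : ℝ} (hε : 0 < ε) :
    ContDiff ℝ ((⊤ : ℕ∞) : WithTop ℕ∞) (smoothHeight ε) := by
  unfold smoothHeight
  exact ContDiff.sqrt (by fun_prop) fun t => by positivity

theorem norm_deriv_smoothHeight_le {ε : ℝ} (hε : 0 < ε) (t : ℝ) :
    ‖deriv (smoothHeight ε) t‖ ≤ 1 := by
  have h1 : HasDerivAt (fun t : ℝ => t ^ 2 + ε ^ 2) (2 * t) t := by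
    simpa using (hasDerivAt_pow 2 t).add_const (ε ^ 2)
  have h2 : deriv (smoothHeight ε) t = 2 * t / (2 * √(t ^ 2 + ε ^ 2)) :=
    (h1.sqrt (by positivity)).deriv
  have h3 := smoothHeight_pos hε t
  rw [smoothHeight] at h3
  rw [h2, mul_div_mul_left _ _ two_ne_zero, norm_div, Real.norm_of_nonneg h3.le,
    div_le_one h3]
  exact Real.abs_le_sqrt (by nlinarith [sq_nonneg ε])

/-- The kernel of the extension, as a function of the height and the horizontal variable. -/
noncomputable def extKernel (d : ℕ) (ε : ℝ) (t : ℝ) (y : Rd d) : ℝ :=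
  scaledBump d (smoothHeight ε t, y)

theorem contDiff_extKernel {d : ℕ} {ε : ℝ} (hε : 0 < ε) :
    ContDiff ℝ ((⊤ : ℕ∞) : WithTop ℕ∞) (fun q : ℝ × Rd d => extKernel d ε q.1 q.2) := by
  rw [contDiff_iff_contDiffAt]
  intro q
  exact (contDiffAt_scaledBump (p := (smoothHeight ε q.1, q.2))
    (smoothHeight_pos hε q.1)).comp (f := fun q : ℝ × Rd d => (smoothHeight ε q.1, q.2)) q
    (((contDiff_smoothHeight hε).comp contDiff_fst).prodMk contDiff_snd).contDiffAt

/-- The chain rule: `smoothHeight ε` has derivative at most `1` in absolute value, so the inner map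
does not increase the maximum norm, and the constant is independent of `ε`. -/
theorem exists_norm_fderiv_extKernel_le (d : ℕ) :
    ∃ M : ℝ, 0 ≤ M ∧ ∀ ε : ℝ, 0 < ε → ∀ (t : ℝ) (y : Rd d),
      ‖fderiv ℝ (fun q : ℝ × Rd d => extKernel d ε q.1 q.2) (t, y)‖ ≤
        M * (smoothHeight ε t ^ (d + 1))⁻¹ ∧
      (smoothHeight ε t < ‖y‖ →
        fderiv ℝ (fun q : ℝ × Rd d => extKernel d ε q.1 q.2) (t, y) = 0) := by
  obtain ⟨M, hM0, hM⟩ := exists_norm_fderiv_scaledBump_le d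
  refine ⟨M, hM0, fun ε hε t y => ?_⟩
  have hpos := smoothHeight_pos hε t
  have h1 : DifferentiableAt ℝ (scaledBump d) (smoothHeight ε t, y) :=
    (contDiffAt_scaledBump hpos).differentiableAt (by simp)
  have h2 : DifferentiableAt ℝ (smoothHeight ε) t :=
    (contDiff_smoothHeight hε).differentiable (by simp) t
  have h3 : HasFDerivAt (fun q : ℝ × Rd d => (smoothHeight ε q.1, q.2))
      (((fderiv ℝ (smoothHeight ε) t).comp (.fst ℝ ℝ (Rd d))).prod (.snd ℝ ℝ (Rd d))) (t, y) :=
    (HasFDerivAt.comp (g := smoothHeight ε) (f := Prod.fst) (t, y) h2.hasFDerivAt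
      hasFDerivAt_fst).prodMk hasFDerivAt_snd
  have h4 : fderiv ℝ (fun q : ℝ × Rd d => extKernel d ε q.1 q.2) (t, y) =
      (fderiv ℝ (scaledBump d) (smoothHeight ε t, y)).comp
        (((fderiv ℝ (smoothHeight ε) t).comp (.fst ℝ ℝ (Rd d))).prod (.snd ℝ ℝ (Rd d))) :=
    (h1.hasFDerivAt.comp (t, y) h3).fderiv
  rw [h4]
  obtain ⟨h5, h6⟩ := hM _ hpos y
  refine ⟨?_, fun hy => by rw [h6 hy, ContinuousLinearMap.zero_comp]⟩
  refine (ContinuousLinearMap.opNorm_comp_le _ _).trans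
    ((mul_le_of_le_one_right (norm_nonneg _) ?_).trans h5)
  refine ContinuousLinearMap.opNorm_le_bound _ zero_le_one fun v => ?_
  rw [one_mul, ContinuousLinearMap.prod_apply, Prod.norm_mk]
  refine max_le ?_ (norm_snd_le v)
  rw [ContinuousLinearMap.comp_apply]
  refine ((fderiv ℝ (smoothHeight ε) t).le_opNorm _).trans ?_
  rw [← norm_deriv_eq_norm_fderiv]
  exact (mul_le_of_le_one_left (norm_nonneg _) (norm_deriv_smoothHeight_le hε t)).trans
    (norm_fst_le v)

/-! ### The extension by averages -/

/-- The smooth extension `(x, t) ↦ (u * η_ρ)(x)`, where `ρ = √(t² + ε²)`. -/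
noncomputable def smoothExt {d : ℕ} (ε : ℝ) (u : Rd d → ℝ) (p : Rd d × ℝ) : ℝ :=
  convolution u (extKernel d ε p.2) (ContinuousLinearMap.mul ℝ ℝ) volume p.1

/-- Cauchy-Schwarz on the ball of radius `ρ`, whose volume supplies `ρ ^ d`. It is used with `w` the
derivative of the kernel, for the energy, and with `w` the kernel itself, for the trace. -/
theorem enorm_integral_smul_sq_le {d : ℕ} {F : Type*} [NormedAddCommGroup F] [NormedSpace ℝ F]
    {u : Rd d → ℝ} (hu : Measurable u) (x : Rd d) {ρ c : ℝ} (hρ : 0 ≤ ρ) (hc : 0 ≤ c)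
    {w : Rd d → F} (hw : ∀ z, ‖w z‖ ≤ c) (hw0 : ∀ z, ρ < ‖x - z‖ → w z = 0) :
    ‖∫ z, (u z - u x) • w z‖ₑ ^ 2 ≤ ENNReal.ofReal (c ^ 2 * ρ ^ d) *
      volume (Metric.ball (0 : Rd d) 1) *
        ∫⁻ z in Metric.closedBall x ρ, ‖u z - u x‖ₑ ^ 2 := by
  have h1 : ‖∫ z, (u z - u x) • w z‖ₑ ≤
      ENNReal.ofReal c * ∫⁻ z in Metric.closedBall x ρ, 1 * ‖u z - u x‖ₑ := by
    refine (enorm_integral_le_lintegral_enorm _).trans ?_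
    rw [← lintegral_const_mul' _ _ ENNReal.ofReal_ne_top,
      ← lintegral_indicator Metric.isClosed_closedBall.measurableSet]
    refine lintegral_mono fun z => ?_
    by_cases hz : z ∈ Metric.closedBall x ρ
    · rw [Set.indicator_of_mem hz, enorm_smul, one_mul, mul_comm]
      gcongr
      rw [← ofReal_norm]
      exact ENNReal.ofReal_le_ofReal (hw z)
    · rw [Set.indicator_of_notMem hz, hw0 z, smul_zero, enorm_zero]
      rwa [Metric.mem_closedBall, not_le, dist_comm, dist_eq_norm] at hz
  refine (pow_le_pow_left' h1 2).trans ?_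
  rw [mul_pow]
  refine (mul_le_mul_right (lintegral_mul_sq_le _ (by fun_prop) (by fun_prop)) _).trans_eq ?_
  rw [ENNReal.ofReal_mul (sq_nonneg c), ENNReal.ofReal_pow hc]
  simp only [one_pow, lintegral_const, one_mul, Measure.restrict_apply_univ]
  rw [Measure.addHaar_closedBall _ _ hρ]
  simp only [finrank_euclideanSpace, Fintype.card_fin]
  ring

theorem extKernel_eq_zero {d : ℕ} {ε : ℝ} (hε : 0 < ε) {t : ℝ} {y : Rd d}
    (h : smoothHeight ε t ≤ ‖y‖) : extKernel d ε t y = 0 :=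
  scaledBump_eq_zero (p := (smoothHeight ε t, y)) (smoothHeight_pos hε t) h

theorem continuous_extKernel {d : ℕ} {ε : ℝ} (hε : 0 < ε) (t : ℝ) :
    Continuous (extKernel d ε t) :=
  (contDiff_extKernel hε).continuous.comp (by fun_prop : Continuous fun y : Rd d => (t, y))

theorem hasCompactSupport_extKernel {d : ℕ} {ε : ℝ} (hε : 0 < ε) (t : ℝ) :
    HasCompactSupport (extKernel d ε t) :=
  HasCompactSupport.intro (isCompact_closedBall 0 (smoothHeight ε t)) fun y hy =>
    extKernel_eq_zero hε (by
      rw [Metric.mem_closedBall, dist_zero_right, not_le] at hy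
      exact hy.le)

theorem integral_extKernel_sub {d : ℕ} {ε : ℝ} (hε : 0 < ε) (t : ℝ) (x : Rd d) :
    ∫ z, extKernel d ε t (x - z) = 1 := by
  rw [integral_sub_left_eq_self (extKernel d ε t)]
  exact integral_scaledBump (smoothHeight_pos hε t)

/-- The kernel has mass one, so constants pass through. This puts differences `u z - u x` under the
integral. -/
theorem convolution_sub_const {d : ℕ} {ε : ℝ} (hε : 0 < ε) {u : Rd d → ℝ}
    (hu : LocallyIntegrable u) (c t : ℝ) (x : Rd d) :
    convolution (fun z => u z - c) (extKernel d ε t) (ContinuousLinearMap.mul ℝ ℝ) volume x =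
      smoothExt ε u (x, t) - c := by
  have h1 : Integrable fun z => u z * extKernel d ε t (x - z) :=
    (hasCompactSupport_extKernel hε t).convolutionExists_right (ContinuousLinearMap.mul ℝ ℝ) hu
      (continuous_extKernel hε t) x
  have h2 : Integrable fun z => c * extKernel d ε t (x - z) :=
    (((continuous_extKernel hε t).integrable_of_hasCompactSupport
      (hasCompactSupport_extKernel hε t)).comp_sub_left x).const_mul c
  have h3 := integral_sub h1 h2
  rw [integral_const_mul, integral_extKernel_sub hε, mul_one] at h3
  simp only [← sub_mul] at h3
  exact h3

/-- A common compact support for all heights near `t₀`, as required for differentiating a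
convolution with a parameter. -/
theorem extKernel_param {d : ℕ} {ε : ℝ} (hε : 0 < ε) (t₀ : ℝ) (p : ℝ) (y : Rd d)
    (hp : p ∈ Metric.ball t₀ 1) (hy : y ∉ Metric.closedBall (0 : Rd d) (|t₀| + 1 + ε)) :
    extKernel d ε p y = 0 := by
  refine extKernel_eq_zero hε ?_
  rw [Metric.mem_closedBall, dist_zero_right, not_le] at hy
  rw [Metric.mem_ball, Real.dist_eq] at hp
  have := abs_sub_abs_le_abs_sub p t₀
  linarith [smoothHeight_le hε p]

theorem contDiff_smoothExt {d : ℕ} {ε : ℝ} (hε : 0 < ε) {u : Rd d → ℝ}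
    (hu : LocallyIntegrable u) : ContDiff ℝ ((⊤ : ℕ∞) : WithTop ℕ∞) (smoothExt ε u) := by
  rw [contDiff_iff_contDiffAt]
  rintro ⟨x, t⟩
  have h := contDiffOn_convolution_right_with_param (n := ⊤) (μ := volume)
    (ContinuousLinearMap.mul ℝ ℝ) (g := extKernel d ε) Metric.isOpen_ball
    (isCompact_closedBall (0 : Rd d) (|t| + 1 + ε)) (extKernel_param hε t) hu
    (contDiff_extKernel hε).contDiffOn
  have h1 : ContDiffAt ℝ ((⊤ : ℕ∞) : WithTop ℕ∞) (fun q : ℝ × Rd d =>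
      convolution u (extKernel d ε q.1) (ContinuousLinearMap.mul ℝ ℝ) volume q.2) (t, x) :=
    h.contDiffAt ((Metric.isOpen_ball.prod isOpen_univ).mem_nhds
      ⟨Metric.mem_ball_self one_pos, Set.mem_univ x⟩)
  exact ContDiffAt.comp (f := fun p : Rd d × ℝ => (p.2, p.1)) (x, t) h1 (by fun_prop)

/-- The convolution of `u - u x`, with the constant `u x` frozen at the point of evaluation, is
differentiated under the integral sign; the constant does not change the derivative. The variables
are swapped because the parameter of the convolution comes first. -/
theorem hasFDerivAt_smoothExt_swap {d : ℕ} {ε : ℝ} (hε : 0 < ε) {u : Rd d → ℝ}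
    (hu : LocallyIntegrable u) (x : Rd d) (t : ℝ) :
    HasFDerivAt (fun q : ℝ × Rd d => smoothExt ε u (q.2, q.1))
      (∫ z, (u z - u x) • fderiv ℝ (fun q : ℝ × Rd d => extKernel d ε q.1 q.2) (t, x - z))
      (t, x) := by
  have h := hasFDerivAt_convolution_right_with_param (μ := volume)
    (ContinuousLinearMap.mul ℝ ℝ) (g := extKernel d ε) Metric.isOpen_ball
    (isCompact_closedBall (0 : Rd d) (|t| + 1 + ε)) (extKernel_param hε t)
    (hu.sub (locallyIntegrable_const (u x)))
    ((contDiff_extKernel hε).of_le (by exact_mod_cast le_top)).contDiffOn (t, x)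
    (Metric.mem_ball_self one_pos)
  have e : (fun q : ℝ × Rd d => convolution (u - fun _ => u x) (extKernel d ε q.1)
      (ContinuousLinearMap.mul ℝ ℝ) volume q.2) = fun q => smoothExt ε u (q.2, q.1) - u x := by
    funext q
    exact convolution_sub_const hε hu (u x) q.1 q.2
  rw [e] at h
  have h2 := h.add_const (u x)
  simp only [sub_add_cancel] at h2
  refine h2.congr_fderiv ?_
  simp only [convolution]
  refine integral_congr_ae (Eventually.of_forall fun z => ?_)
  ext v <;> simp [ContinuousLinearMap.precompR, ContinuousLinearMap.compL] <;>
    exact (sub_mul _ _ _).symm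

theorem exists_enorm_classicalGrad_smoothExt_sq_le (d : ℕ) :
    ∃ M : ℝ≥0∞, M ≠ ⊤ ∧ ∀ (ε : ℝ), 0 < ε → ∀ u : Rd d → ℝ, Measurable u → LocallyIntegrable u →
      ∀ (x : Rd d) (t : ℝ), ‖classicalGrad (smoothExt ε u) (x, t)‖ₑ ^ 2 ≤
        M * (ENNReal.ofReal ((smoothHeight ε t ^ (d + 2))⁻¹) *
          ∫⁻ z in Metric.closedBall x (smoothHeight ε t), ‖u z - u x‖ₑ ^ 2) := by
  obtain ⟨M, hM0, hM⟩ := exists_norm_fderiv_extKernel_le d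
  refine ⟨ENNReal.ofReal (M ^ 2) * volume (Metric.ball (0 : Rd d) 1), ENNReal.mul_ne_top
    ENNReal.ofReal_ne_top measure_ball_lt_top.ne, fun ε hε u hum hu x t => ?_⟩
  have hpos := smoothHeight_pos hε t
  have hd := hasFDerivAt_smoothExt_swap hε hu x t
  have h1 : ‖classicalGrad (smoothExt ε u) (x, t)‖ₑ ≤ ‖∫ z, (u z - u x) •
      fderiv ℝ (fun q : ℝ × Rd d => extKernel d ε q.1 q.2) (t, x - z)‖ₑ := by
    rw [enorm_le_iff_norm_le]
    refine (norm_classicalGrad_le ((contDiff_smoothExt hε hu).differentiable (by simp) _)).trans ?_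
    have h2 := HasFDerivAt.comp (f := fun p : Rd d × ℝ => (p.2, p.1)) (x, t) hd
      (hasFDerivAt_snd.prodMk hasFDerivAt_fst)
    have h3 : fderiv ℝ (smoothExt ε u) (x, t) = _ := h2.fderiv
    rw [h3]
    refine (ContinuousLinearMap.opNorm_comp_le _ _).trans
      (mul_le_of_le_one_right (norm_nonneg _) ?_)
    refine ContinuousLinearMap.opNorm_le_bound _ zero_le_one fun v => ?_
    rw [one_mul]
    exact max_le (norm_snd_le v) (norm_fst_le v)
  refine (pow_le_pow_left' h1 2).trans ((enorm_integral_smul_sq_le hum x hpos.le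
    (by positivity) (fun z => (hM ε hε t (x - z)).1) (fun z => (hM ε hε t (x - z)).2)).trans_eq ?_)
  rw [mul_assoc _ _ (ENNReal.ofReal _ * _), mul_left_comm (volume _), ← mul_assoc, ← mul_assoc,
    ← ENNReal.ofReal_mul (sq_nonneg M)]
  congr 3
  field_simp
  ring

theorem exists_enorm_smoothExt_zero_sub_sq_le (d : ℕ) :
    ∃ M : ℝ≥0∞, M ≠ ⊤ ∧ ∀ (ε : ℝ), 0 < ε → ∀ u : Rd d → ℝ, Measurable u → LocallyIntegrable u →
      ∀ x : Rd d, ‖smoothExt ε u (x, 0) - u x‖ₑ ^ 2 ≤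
        M * (ENNReal.ofReal ((ε ^ d)⁻¹) *
          ∫⁻ z in Metric.closedBall x ε, ‖u z - u x‖ₑ ^ 2) := by
  obtain ⟨M, hM0, hM⟩ := exists_norm_scaledBump_le d
  refine ⟨ENNReal.ofReal (M ^ 2) * volume (Metric.ball (0 : Rd d) 1), ENNReal.mul_ne_top
    ENNReal.ofReal_ne_top measure_ball_lt_top.ne, fun ε hε u hum hu x => ?_⟩
  rw [← convolution_sub_const hε hu]
  refine (enorm_integral_smul_sq_le hum x hε.le (c := M * (ε ^ d)⁻¹) (by positivity)
    (w := fun z => extKernel d ε 0 (x - z)) (fun z => ?_) (fun z hz => ?_)).trans_eq ?_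
  · rw [extKernel, smoothHeight_zero hε]
    exact hM ε hε _
  · exact extKernel_eq_zero hε (by rw [smoothHeight_zero hε]; exact hz.le)
  · rw [mul_assoc _ _ (ENNReal.ofReal _ * _), mul_left_comm (volume _), ← mul_assoc, ← mul_assoc,
      ← ENNReal.ofReal_mul (sq_nonneg M)]
    congr 3
    field_simp

/-! ### Bounds for the extension by averages -/

/-- For a pair of points at distance `r`, only heights with `smoothHeight ε t ≥ r` matter. Use this
lower bound for `t ≤ r` and `smoothHeight ε t ≥ t` for `t > r`; the two integrals converge by `s <
1` and `0 < d + 2s`, and nothing depends on `ε`. -/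
theorem exists_lintegral_height_le {d : ℕ} {s : ℝ} (hs0 : 0 < s) (hs1 : s < 1) :
    ∃ C : ℝ≥0∞, C ≠ ⊤ ∧ ∀ (ε r : ℝ), 0 < r →
      ∫⁻ t in Set.Ioi (0 : ℝ), ENNReal.ofReal (t ^ (1 - 2 * s)) *
        (if r ≤ smoothHeight ε t then ENNReal.ofReal ((smoothHeight ε t ^ (d + 2))⁻¹) else 0) ≤
      C * ENNReal.ofReal (r ^ (-((d : ℝ) + 2 * s))) := by
  refine ⟨ENNReal.ofReal (2 - 2 * s)⁻¹ + ENNReal.ofReal ((d : ℝ) + 2 * s)⁻¹, by simp,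
    fun ε r hr => ?_⟩
  have hd : 0 < (d : ℝ) + 2 * s := by positivity
  rw [← Set.Ioc_union_Ioi_eq_Ioi hr.le]
  refine (lintegral_union_le _ _ _).trans ?_
  rw [add_mul]
  refine add_le_add ?_ ?_
  · calc ∫⁻ t in Set.Ioc 0 r, ENNReal.ofReal (t ^ (1 - 2 * s)) *
        (if r ≤ smoothHeight ε t then ENNReal.ofReal ((smoothHeight ε t ^ (d + 2))⁻¹) else 0)
        ≤ ∫⁻ t in Set.Ioc 0 r, ENNReal.ofReal (t ^ (1 - 2 * s)) *
          ENNReal.ofReal ((r ^ (d + 2))⁻¹) := by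
          refine lintegral_mono fun t => ?_
          gcongr
          split_ifs with h
          · exact ENNReal.ofReal_le_ofReal (by gcongr)
          · exact zero_le
      _ = ENNReal.ofReal (2 - 2 * s)⁻¹ * ENNReal.ofReal (r ^ (-((d : ℝ) + 2 * s))) := by
          rw [lintegral_mul_const _ (by fun_prop), ← Measure.restrict_congr_set Ioo_ae_eq_Ioc,
            lintegral_rpow_Ioo (by linarith) hr.le,
            ← ENNReal.ofReal_mul (div_nonneg (by positivity) (by linarith)),
            ← ENNReal.ofReal_mul (by rw [inv_nonneg]; linarith)]
          congr 1
          rw [show 1 - 2 * s + 1 = 2 - 2 * s by ring, ← Real.rpow_natCast r, ← Real.rpow_neg hr.le,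
            div_mul_eq_mul_div, ← Real.rpow_add hr, div_eq_inv_mul]
          congr 2
          push_cast
          ring
  · calc ∫⁻ t in Set.Ioi r, ENNReal.ofReal (t ^ (1 - 2 * s)) *
        (if r ≤ smoothHeight ε t then ENNReal.ofReal ((smoothHeight ε t ^ (d + 2))⁻¹) else 0)
        ≤ ∫⁻ t in Set.Ioi r, ENNReal.ofReal (t ^ (-1 - 2 * s - d)) := by
          refine setLIntegral_mono' measurableSet_Ioi fun t (ht : r < t) => ?_
          have ht0 : 0 < t := hr.trans ht
          calc _ ≤ ENNReal.ofReal (t ^ (1 - 2 * s)) * ENNReal.ofReal ((t ^ (d + 2))⁻¹) := by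
                gcongr
                split_ifs with h
                · refine ENNReal.ofReal_le_ofReal ?_
                  gcongr
                  exact le_smoothHeight ε t
                · exact zero_le
            _ = _ := by
                rw [← ENNReal.ofReal_mul (by positivity), ← Real.rpow_natCast t,
                  ← Real.rpow_neg ht0.le, ← Real.rpow_add ht0]
                congr 2
                push_cast
                ring
      _ = ENNReal.ofReal ((d : ℝ) + 2 * s)⁻¹ * ENNReal.ofReal (r ^ (-((d : ℝ) + 2 * s))) := by
          rw [lintegral_rpow_Ioi (by linarith) hr, ← ENNReal.ofReal_mul (by positivity)]
          congr 1
          rw [div_eq_inv_mul]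
          ring_nf

theorem lintegral_closedBall_eq {d : ℕ} (x : Rd d) (ρ : ℝ) (f : Rd d → ℝ≥0∞) :
    ∫⁻ z in Metric.closedBall x ρ, f z = ∫⁻ z, if ‖x - z‖ ≤ ρ then f z else 0 := by
  rw [← lintegral_indicator Metric.isClosed_closedBall.measurableSet]
  refine lintegral_congr fun z => ?_
  simp only [Set.indicator, Metric.mem_closedBall, dist_comm z x, dist_eq_norm]

theorem lintegral_slobodeckij_eq {d : ℕ} (s : ℝ) (u : Rd d → ℝ) :
    ∫⁻ x, ∫⁻ z, ENNReal.ofReal (‖x - z‖ ^ (-((d : ℝ) + 2 * s))) * ‖u z - u x‖ₑ ^ 2 =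
      slobodeckijSq s u := by
  unfold slobodeckijSq
  refine lintegral_congr fun x => lintegral_congr fun z => ?_
  by_cases h : x = z
  · simp [h]
  · rw [ofReal_slobodeckij_integrand s _ _ (sub_ne_zero.mpr h), enorm_sub_rev]

/-- Insert the pointwise gradient bound and integrate in `t` first: the height integral reproduces
the kernel `‖x - z‖^(-(d+2s))` uniformly in `ε`. -/
theorem exists_lintegral_smoothExt_le {d : ℕ} {s : ℝ} (hs0 : 0 < s) (hs1 : s < 1) :
    ∃ C : ℝ≥0∞, C ≠ ⊤ ∧ ∀ (ε : ℝ), 0 < ε → ∀ u : Rd d → ℝ, Measurable u → LocallyIntegrable u →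
      ∫⁻ p, ‖classicalGrad (smoothExt ε u) p‖ₑ ^ 2 ∂weightedMeasure d (1 - 2 * s) ≤
        C * slobodeckijSq s u := by
  obtain ⟨M, hM, hMu⟩ := exists_enorm_classicalGrad_smoothExt_sq_le d
  obtain ⟨C, hC, hCr⟩ := exists_lintegral_height_le (d := d) hs0 hs1
  refine ⟨M * C, ENNReal.mul_ne_top hM hC, fun ε hε u hum hu => ?_⟩
  have hcg := (continuous_classicalGrad (contDiff_smoothExt hε hu)).measurable
  have hρ : Measurable (smoothHeight ε) := (contDiff_smoothHeight hε).continuous.measurable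
  set k : ℝ → ℝ → ℝ≥0∞ := fun t r =>
    if r ≤ smoothHeight ε t then ENNReal.ofReal ((smoothHeight ε t ^ (d + 2))⁻¹) else 0 with hk
  have hkm : Measurable fun q : ℝ × ℝ => k q.1 q.2 :=
    Measurable.ite (measurableSet_le measurable_snd (by fun_prop)) (by fun_prop) measurable_const
  have hkm' : ∀ x : Rd d, Measurable fun q : ℝ × Rd d => k q.1 ‖x - q.2‖ := fun x =>
    hkm.comp (by fun_prop : Measurable fun q : ℝ × Rd d => (q.1, ‖x - q.2‖))
  rw [lintegral_weightedMeasure _ (by fun_prop)]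
  calc ∫⁻ x, ∫⁻ t in Set.Ioi (0 : ℝ), ENNReal.ofReal (t ^ (1 - 2 * s)) *
        ‖classicalGrad (smoothExt ε u) (x, t)‖ₑ ^ 2
      ≤ ∫⁻ x, ∫⁻ t in Set.Ioi (0 : ℝ), M * ∫⁻ z,
          ENNReal.ofReal (t ^ (1 - 2 * s)) * k t ‖x - z‖ * ‖u z - u x‖ₑ ^ 2 := by
        refine lintegral_mono fun x => lintegral_mono fun t => ?_
        refine (mul_le_mul_right (hMu ε hε u hum hu x t) _).trans_eq ?_
        simp_rw [mul_assoc]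
        rw [mul_left_comm, lintegral_const_mul' _ _ ENNReal.ofReal_ne_top,
          lintegral_closedBall_eq, ← lintegral_const_mul' _ _ ENNReal.ofReal_ne_top]
        congr 2
        refine lintegral_congr fun z => ?_
        simp only [hk]
        split_ifs <;> simp
    _ = M * ∫⁻ x, ∫⁻ z, (∫⁻ t in Set.Ioi (0 : ℝ), ENNReal.ofReal (t ^ (1 - 2 * s)) *
          k t ‖x - z‖) * ‖u z - u x‖ₑ ^ 2 := by
        rw [← lintegral_const_mul' _ _ hM]
        refine lintegral_congr fun x => ?_
        rw [lintegral_const_mul' _ _ hM, lintegral_lintegral_swap]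
        · congr 1
          refine lintegral_congr fun z => ?_
          rw [lintegral_mul_const' _ _ (by simp)]
        · have := hkm' x
          exact Measurable.aemeasurable (by fun_prop)
    _ ≤ M * ∫⁻ x, ∫⁻ z, C * (ENNReal.ofReal (‖x - z‖ ^ (-((d : ℝ) + 2 * s))) *
          ‖u z - u x‖ₑ ^ 2) := by
        refine mul_le_mul_right (lintegral_mono fun x => lintegral_mono fun z => ?_) _
        by_cases h : x = z
        · simp [h]
        · rw [← mul_assoc]
          gcongr
          exact hCr ε _ (norm_pos_iff.mpr (sub_ne_zero.mpr h))
    _ = M * C * slobodeckijSq s u := by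
        simp_rw [lintegral_const_mul' _ _ hC]
        rw [lintegral_slobodeckij_eq, mul_assoc]

/-- On the ball of averaging `‖x - z‖ ≤ ε`, so `ε^(-d) = ε^(2s) ε^(-(d+2s)) ≤ ε^(2s) ‖x -
z‖^(-(d+2s))`. -/
theorem exists_lintegral_smoothExt_zero_sub_le {d : ℕ} {s : ℝ} (hs0 : 0 < s) :
    ∃ C : ℝ≥0∞, C ≠ ⊤ ∧ ∀ (ε : ℝ), 0 < ε → ∀ u : Rd d → ℝ, Measurable u → LocallyIntegrable u →
      ∫⁻ x, ‖smoothExt ε u (x, 0) - u x‖ₑ ^ 2 ≤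
        C * ENNReal.ofReal (ε ^ (2 * s)) * slobodeckijSq s u := by
  obtain ⟨M, hM, hMu⟩ := exists_enorm_smoothExt_zero_sub_sq_le d
  refine ⟨M, hM, fun ε hε u hum hu => ?_⟩
  calc ∫⁻ x, ‖smoothExt ε u (x, 0) - u x‖ₑ ^ 2
      ≤ ∫⁻ x, M * ENNReal.ofReal (ε ^ (2 * s)) *
          ∫⁻ z, ENNReal.ofReal (‖x - z‖ ^ (-((d : ℝ) + 2 * s))) * ‖u z - u x‖ₑ ^ 2 := by
        refine lintegral_mono fun x => (hMu ε hε u hum hu x).trans ?_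
        rw [mul_assoc]
        refine mul_le_mul_right ?_ _
        rw [lintegral_closedBall_eq, ← lintegral_const_mul' _ _ ENNReal.ofReal_ne_top,
          ← lintegral_const_mul' _ _ ENNReal.ofReal_ne_top]
        refine lintegral_mono fun z => ?_
        by_cases h : x = z
        · simp [h]
        have hxz : 0 < ‖x - z‖ := norm_pos_iff.mpr (sub_ne_zero.mpr h)
        simp only
        split_ifs with hle
        · rw [← mul_assoc, ← ENNReal.ofReal_mul (by positivity)]
          gcongr
          have e : (ε ^ d)⁻¹ = ε ^ (2 * s) * ε ^ (-((d : ℝ) + 2 * s)) := by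
            rw [← Real.rpow_add hε, ← Real.rpow_natCast, ← Real.rpow_neg hε.le]
            congr 1
            ring
          rw [e]
          refine mul_le_mul_of_nonneg_left ?_ (by positivity)
          exact Real.rpow_le_rpow_of_nonpos hxz hle
            (neg_nonpos.mpr (add_nonneg (Nat.cast_nonneg d) (by linarith)))
        · simp
    _ = _ := by
        rw [lintegral_const_mul' _ _ (ENNReal.mul_ne_top hM ENNReal.ofReal_ne_top),
          lintegral_slobodeckij_eq]

/-! ### Existence of an extension with finite energy -/

/-- Nested closed convex sets that meet a ball have a common point in that ball. -/
theorem exists_forall_mem_norm_le {H : Type*} [NormedAddCommGroup H] [InnerProductSpace ℝ H]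
    [CompleteSpace H] {K : ℕ → Set H} (hanti : Antitone K) (hconv : ∀ n, Convex ℝ (K n))
    (hclosed : ∀ n, IsClosed (K n)) {M : ℝ} (hM : ∀ n, ∃ x ∈ K n, ‖x‖ ≤ M) :
    ∃ x, (∀ n, x ∈ K n) ∧ ‖x‖ ≤ M := by
  have hex : ∀ n, ∃ v ∈ K n, ∀ w ∈ K n, ‖v‖ ≤ ‖w‖ := by
    intro n
    obtain ⟨x, hx, -⟩ := hM n
    obtain ⟨v, hv, he⟩ := exists_norm_eq_iInf_of_complete_convex ⟨x, hx⟩ (hclosed n).isComplete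
      (hconv n) 0
    refine ⟨v, hv, fun w hw => ?_⟩
    rw [zero_sub, norm_neg] at he
    rw [he]
    have : BddBelow (Set.range fun w : K n => ‖(0 : H) - w‖) :=
      ⟨0, by rintro _ ⟨w, rfl⟩; exact norm_nonneg _⟩
    simpa using ciInf_le this ⟨w, hw⟩
  choose v hv hmin using hex
  have hvM : ∀ n, ‖v n‖ ≤ M := fun n => by
    obtain ⟨x, hx, hxM⟩ := hM n
    exact (hmin n x hx).trans hxM
  have hmono : Monotone fun n => ‖v n‖ ^ 2 := fun m n hmn =>
    pow_le_pow_left₀ (norm_nonneg _) (hmin m _ (hanti hmn (hv n))) 2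
  have hbdd : BddAbove (Set.range fun n => ‖v n‖ ^ 2) :=
    ⟨M ^ 2, by rintro _ ⟨n, rfl⟩; exact pow_le_pow_left₀ (norm_nonneg _) (hvM n) 2⟩
  set S := ⨆ n, ‖v n‖ ^ 2
  have hlim : Tendsto (fun n => ‖v n‖ ^ 2) atTop (𝓝 S) := tendsto_atTop_ciSup hmono hbdd
  -- The elements `v n` of minimal norm have increasing bounded norms. The midpoint of `v n` and `v
  -- m` lies in `K n`, so its norm is at least `‖v n‖`, and the parallelogram law gives `‖v n - v
  -- m‖² ≤ 2 (S - ‖v n‖²)`.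
  have hcauchy : CauchySeq v := by
    refine cauchySeq_of_le_tendsto_0' (fun n => √(2 * (S - ‖v n‖ ^ 2))) (fun n m hnm => ?_) ?_
    · refine Real.le_sqrt_of_sq_le ?_
      have h1 : (1 / 2 : ℝ) • v n + (1 / 2 : ℝ) • v m ∈ K n :=
        hconv n (hv n) (hanti hnm (hv m)) (by norm_num) (by norm_num) (by norm_num)
      have h2 := pow_le_pow_left₀ (norm_nonneg _) (hmin n _ h1) 2
      rw [← smul_add, norm_smul, mul_pow] at h2
      have h3 := parallelogram_law_with_norm ℝ (v n) (v m)
      have h4 : ‖v m‖ ^ 2 ≤ S := le_ciSup hbdd m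
      rw [dist_eq_norm]
      norm_num at h2
      nlinarith
    · have h := ((tendsto_const_nhds (x := S)).sub hlim).const_mul 2
      rw [sub_self, mul_zero] at h
      simpa using h.sqrt
  obtain ⟨x, hx⟩ := cauchySeq_tendsto_of_complete hcauchy
  refine ⟨x, fun n => (hclosed n).mem_of_tendsto hx ?_, le_of_tendsto' hx.norm hvM⟩
  filter_upwards [eventually_ge_atTop n] with m hm
  exact hanti hm (hv m)

theorem gradL_toLp_mem_gradTrace {d : ℕ} {α : ℝ} (φ : smoothFun d α)
    (h : MemLp (fun x => φ.1 (x, 0)) 2 volume) : (gradL φ, h.toLp _) ∈ gradTrace d α := by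
  intro ε _ R
  refine ⟨φ, by simp, ?_⟩
  have : eLpNorm (fun x => φ.1 (x, 0) - h.toLp _ x) 2 (volume.restrict (Metric.ball 0 R)) =
      eLpNorm (0 : Rd d → ℝ) 2 (volume.restrict (Metric.ball 0 R)) := by
    refine eLpNorm_congr_ae (ae_restrict_of_ae ?_)
    filter_upwards [h.coeFn_toLp] with x hx
    rw [hx, sub_self, Pi.zero_apply]
  exact (this.trans eLpNorm_zero).le.trans zero_le

/-- Take `smoothExt ε u` with `ε` small in terms of `δ`. The essential point is that the gradient
bound does not depend on `δ`. -/
theorem exists_smooth_gradTrace {d : ℕ} {s : ℝ} (hs0 : 0 < s) (hs1 : s < 1) :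
    ∃ C : ℝ, 0 ≤ C ∧ ∀ u ∈ sobolevHs d s, ∀ δ : ℝ, 0 < δ →
      ∃ (G : GradL2 d (1 - 2 * s)) (g : Lp ℝ 2 (volume : Measure (Rd d))),
        (G, g) ∈ gradTrace d (1 - 2 * s) ∧ ‖g - u‖ ≤ δ ∧
          ‖G‖ ≤ C * √(slobodeckijSq s u).toReal := by
  obtain ⟨C₁, hC₁, h₁⟩ := exists_lintegral_smoothExt_le (d := d) hs0 hs1
  obtain ⟨C₂, hC₂, h₂⟩ := exists_lintegral_smoothExt_zero_sub_le (d := d) hs0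
  refine ⟨√C₁.toReal, Real.sqrt_nonneg _, fun u hu δ hδ => ?_⟩
  have hfin : slobodeckijSq s u ≠ ⊤ := ne_of_lt hu
  have hum : Measurable u := (Lp.stronglyMeasurable u).measurable
  have hul : LocallyIntegrable u := (Lp.memLp u).locallyIntegrable one_le_two
  obtain ⟨ε, hε, hεδ⟩ : ∃ ε : ℝ, 0 < ε ∧
      C₂ * ENNReal.ofReal (ε ^ (2 * s)) * slobodeckijSq s u ≤ ENNReal.ofReal δ ^ 2 := by
    have hl : Tendsto (fun ε : ℝ => C₂ * ENNReal.ofReal (ε ^ (2 * s)) * slobodeckijSq s u)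
        (𝓝[>] 0) (𝓝 0) := by
      have h3 : Tendsto (fun ε : ℝ => ε ^ (2 * s)) (𝓝[>] 0) (𝓝 0) := by
        have h4 := (Real.continuousAt_rpow_const 0 (2 * s) (Or.inr (by linarith))).tendsto
        rw [Real.zero_rpow (by linarith)] at h4
        exact h4.mono_left nhdsWithin_le_nhds
      have h5 := ENNReal.Tendsto.mul_const (ENNReal.Tendsto.const_mul (ENNReal.tendsto_ofReal h3)
        (Or.inr hC₂)) (Or.inr hfin)
      simpa using h5
    have h6 : (0 : ℝ≥0∞) < ENNReal.ofReal δ ^ 2 := by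
      have : ENNReal.ofReal δ ≠ 0 := by simpa using hδ
      positivity
    obtain ⟨ε, h7, h8⟩ := ((hl.eventually (ge_mem_nhds h6)).and self_mem_nhdsWithin).exists
    exact ⟨ε, h8, h7⟩
  have hsm := contDiff_smoothExt hε hul
  have hG := h₁ ε hε u hum hul
  rw [← eLpNorm_two_sq] at hG
  have hGm : MemLp (classicalGrad (smoothExt ε u)) 2 (weightedMeasure d (1 - 2 * s)) := by
    refine ⟨(continuous_classicalGrad hsm).aestronglyMeasurable, lt_top_iff_ne_top.mpr fun h => ?_⟩
    rw [h] at hG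
    exact ENNReal.mul_ne_top hC₁ hfin (top_le_iff.mp (by simpa using hG))
  have hg := (h₂ ε hε u hum hul).trans hεδ
  rw [← eLpNorm_two_sq, ENNReal.pow_le_pow_left_iff two_ne_zero] at hg
  have hc0 : Continuous fun x => smoothExt ε u (x, 0) := hsm.continuous.comp (by fun_prop)
  have hdiff : MemLp (fun x => smoothExt ε u (x, 0) - u x) 2 volume :=
    ⟨hc0.aestronglyMeasurable.sub hum.aestronglyMeasurable,
      hg.trans_lt ENNReal.ofReal_lt_top⟩
  have hgm : MemLp (fun x => smoothExt ε u (x, 0)) 2 volume := by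
    have := hdiff.add (Lp.memLp u)
    refine this.ae_eq (Eventually.of_forall fun x => ?_)
    simp
  refine ⟨gradL ⟨smoothExt ε u, hsm, hGm⟩, hgm.toLp _, gradL_toLp_mem_gradTrace _ hgm, ?_, ?_⟩
  · rw [← ENNReal.ofReal_le_ofReal_iff hδ.le, ofReal_norm, Lp.enorm_def]
    refine le_trans (le_of_eq (eLpNorm_congr_ae ?_)) hg
    filter_upwards [Lp.coeFn_sub (hgm.toLp _) u, hgm.coeFn_toLp] with x h3 h4
    rw [h3, Pi.sub_apply, h4]
  · rw [← Real.sqrt_mul ENNReal.toReal_nonneg]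
    refine Real.le_sqrt_of_sq_le ?_
    have h3 : ‖gradL ⟨smoothExt ε u, hsm, hGm⟩‖ₑ ^ 2 ≤ C₁ * slobodeckijSq s u := by
      rw [Lp.enorm_def, eLpNorm_congr_ae (coeFn_gradL _)]
      exact hG
    have := ENNReal.toReal_mono (ENNReal.mul_ne_top hC₁ hfin) h3
    simpa using this

/-- The gradients for `ε → 0` are bounded but are not shown to converge. Instead, the gradients with
trace within `1/(n+1)` of `u` form nested convex sets that meet a fixed ball, and their closures
have a common point there. Closedness of `gradTrace` gives this point the trace `u`. -/
theorem exists_gradTrace {d : ℕ} {s : ℝ} (hs0 : 0 < s) (hs1 : s < 1) :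
    ∃ C : ℝ, 0 ≤ C ∧ ∀ u ∈ sobolevHs d s, ∃ G : GradL2 d (1 - 2 * s),
      (G, u) ∈ gradTrace d (1 - 2 * s) ∧ ‖G‖ ≤ C * √(slobodeckijSq s u).toReal := by
  obtain ⟨C, hC0, hC⟩ := exists_smooth_gradTrace (d := d) hs0 hs1
  refine ⟨C, hC0, fun u hu => ?_⟩
  set K : ℕ → Set (GradL2 d (1 - 2 * s)) := fun n =>
    {G | ∃ g, (G, g) ∈ gradTrace d (1 - 2 * s) ∧ ‖g - u‖ ≤ 1 / ((n : ℝ) + 1)} with hK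
  have hKconv : ∀ n, Convex ℝ (K n) := by
    rintro n G ⟨g, hg, hgu⟩ G' ⟨g', hg', hgu'⟩ a b ha hb hab
    refine ⟨a • g + b • g', ?_, ?_⟩
    · have h1 := (gradTrace d (1 - 2 * s)).add_mem ((gradTrace d (1 - 2 * s)).smul_mem a hg)
        ((gradTrace d (1 - 2 * s)).smul_mem b hg')
      rwa [Prod.smul_mk, Prod.smul_mk, Prod.mk_add_mk] at h1
    · have e : a • g + b • g' - u = a • (g - u) + b • (g' - u) := by
        rw [smul_sub, smul_sub, sub_add_sub_comm, ← add_smul, hab, one_smul]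
      rw [e]
      refine (norm_add_le _ _).trans ?_
      rw [norm_smul, norm_smul, Real.norm_of_nonneg ha, Real.norm_of_nonneg hb]
      calc a * ‖g - u‖ + b * ‖g' - u‖ ≤ a * (1 / ((n : ℝ) + 1)) + b * (1 / ((n : ℝ) + 1)) := by
            gcongr
        _ = _ := by rw [← add_mul, hab, one_mul]
  have hKanti : Antitone K := by
    rintro m n hmn G ⟨g, hg, hgu⟩
    refine ⟨g, hg, hgu.trans ?_⟩
    gcongr
  obtain ⟨G, hG, hGn⟩ := exists_forall_mem_norm_le (K := fun n => closure (K n))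
    (fun m n hmn => closure_mono (hKanti hmn)) (fun n => (hKconv n).closure)
    (fun n => isClosed_closure) (M := C * √(slobodeckijSq s u).toReal) fun n => by
      obtain ⟨G, g, h1, h2, h3⟩ := hC u hu (1 / ((n : ℝ) + 1)) (by positivity)
      exact ⟨G, subset_closure ⟨g, h1, h2⟩, h3⟩
  refine ⟨G, ?_, hGn⟩
  have hcl : (G, u) ∈ closure (gradTrace d (1 - 2 * s) :
      Set (GradL2 d (1 - 2 * s) × Lp ℝ 2 (volume : Measure (Rd d)))) := by
    refine Metric.mem_closure_iff.mpr fun δ hδ => ?_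
    obtain ⟨n, hn⟩ := exists_nat_one_div_lt hδ
    obtain ⟨G', ⟨g, hg, hgu⟩, hGG⟩ := Metric.mem_closure_iff.mp (hG n) δ hδ
    refine ⟨(G', g), hg, ?_⟩
    rw [Prod.dist_eq, max_lt_iff]
    refine ⟨hGG, ?_⟩
    rw [dist_comm, dist_eq_norm]
    exact hgu.trans_lt hn
  rwa [(isClosed_gradTrace d (1 - 2 * s)).closure_eq] at hcl

/-! ### The harmonic extension and the bilinear form -/

theorem exists_isMinGrad_of_mem_sobolevHs {d : ℕ} {s : ℝ} (hs0 : 0 < s) (hs1 : s < 1)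
    {u : Lp ℝ 2 (volume : Measure (Rd d))} (hu : u ∈ sobolevHs d s) :
    ∃ G : GradL2 d (1 - 2 * s), IsMinGrad u G := by
  obtain ⟨C, -, hC⟩ := exists_gradTrace (d := d) hs0 hs1
  obtain ⟨G, hG, -⟩ := hC u hu
  exact exists_isMinGrad hG

theorem existsUnique_isMinNormExtension {d : ℕ} {s : ℝ} (hs0 : 0 < s) (hs1 : s < 1)
    {u : Lp ℝ 2 (volume : Measure (Rd d))} (hu : u ∈ sobolevHs d s) :
    ∃! T : 𝓓'(halfSpace d, ℝ), IsMinNormExtension s u T := by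
  obtain ⟨G, hG⟩ := exists_isMinGrad_of_mem_sobolevHs hs0 hs1 hu
  refine ⟨distOfFun (primitive G u), (isMinNormExtension_iff hs0 hs1).mpr ⟨G, hG, rfl⟩,
    fun T hT => ?_⟩
  obtain ⟨G', hG', rfl⟩ := (isMinNormExtension_iff hs0 hs1).mp hT
  rw [hG'.unique hG]

theorem distGrad_harmonicExtension {d : ℕ} {s : ℝ} (hs0 : 0 < s) (hs1 : s < 1)
    {u : Lp ℝ 2 (volume : Measure (Rd d))} {G : GradL2 d (1 - 2 * s)} (hG : IsMinGrad u G) :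
    distGrad (harmonicExtension s u) =ᵐ[weightedMeasure d (1 - 2 * s)] G := by
  have h : ∃ T : 𝓓'(halfSpace d, ℝ), IsMinNormExtension s u T :=
    ⟨_, (isMinNormExtension_iff hs0 hs1).mpr ⟨G, hG, rfl⟩⟩
  rw [harmonicExtension, dif_pos h]
  obtain ⟨G', hG', hT⟩ := (isMinNormExtension_iff hs0 hs1).mp h.choose_spec
  rw [hT, hG'.unique hG]
  exact (isGradient_distOfFun_primitive (by linarith) (by linarith) hG.1).distGrad_ae_eq _

/-- The choices in `harmonicExtension` and `distGrad` affect the integrand only on a null set,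
because minimal gradients are unique. -/
theorem extensionForm_eq_inner {d : ℕ} {s : ℝ} (hs0 : 0 < s) (hs1 : s < 1)
    {u v : Lp ℝ 2 (volume : Measure (Rd d))} {G G' : GradL2 d (1 - 2 * s)} (hG : IsMinGrad u G)
    (hG' : IsMinGrad v G') : extensionForm s u v = inner ℝ G G' := by
  have h1 : extensionForm s u v = ∫ p, inner ℝ (distGrad (harmonicExtension s u) p)
      (distGrad (harmonicExtension s v) p) ∂weightedMeasure d (1 - 2 * s) := by
    rw [extensionForm, weightedMeasure, integral_withDensity_eq_integral_toReal_smul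
      (by fun_prop) (Eventually.of_forall fun p => ENNReal.ofReal_lt_top)]
    refine setIntegral_congr_fun (measurableSet_halfSpace d) fun p (hp : 0 < p.2) => ?_
    rw [ENNReal.toReal_ofReal (Real.rpow_nonneg hp.le _), smul_eq_mul]
  rw [h1, L2.inner_def]
  refine integral_congr_ae ?_
  filter_upwards [distGrad_harmonicExtension hs0 hs1 hG,
    distGrad_harmonicExtension hs0 hs1 hG'] with p h2 h3
  rw [h2, h3]

/-- The map that takes `u ∈ H^s_0(ℝ^d; Ω)` to the gradient of its harmonic extension. -/
noncomputable def minGrad {d : ℕ} {s : ℝ} (hs0 : 0 < s) (hs1 : s < 1) (Ω : Set (Rd d)) :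
    HsZero s Ω →ₗ[ℝ] GradL2 d (1 - 2 * s) where
  toFun u := (exists_isMinGrad_of_mem_sobolevHs hs0 hs1 (u := u.toL2) u.2.1).choose
  -- Sums and multiples of minimal gradients are minimal, so uniqueness identifies them with the
  -- chosen ones.
  map_add' u v := IsMinGrad.unique
    (exists_isMinGrad_of_mem_sobolevHs hs0 hs1 (u := (u + v).toL2) (u + v).2.1).choose_spec
    ((exists_isMinGrad_of_mem_sobolevHs hs0 hs1 (u := u.toL2) u.2.1).choose_spec.add
      (exists_isMinGrad_of_mem_sobolevHs hs0 hs1 (u := v.toL2) v.2.1).choose_spec)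
  map_smul' c u := IsMinGrad.unique
    (exists_isMinGrad_of_mem_sobolevHs hs0 hs1 (u := (c • u).toL2) (c • u).2.1).choose_spec
    ((exists_isMinGrad_of_mem_sobolevHs hs0 hs1 (u := u.toL2) u.2.1).choose_spec.smul c)

theorem isMinGrad_minGrad {d : ℕ} {s : ℝ} (hs0 : 0 < s) (hs1 : s < 1) {Ω : Set (Rd d)}
    (u : HsZero s Ω) : IsMinGrad u.toL2 (minGrad hs0 hs1 Ω u) :=
  (exists_isMinGrad_of_mem_sobolevHs hs0 hs1 (u := u.toL2) u.2.1).choose_spec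

/-! ### Coercivity and the closed range. -/

theorem HsZero.norm_toL2_le {d : ℕ} {s : ℝ} {Ω : Set (Rd d)} (u : HsZero s Ω) :
    ‖u.toL2‖ ≤ ‖u‖ :=
  Real.le_sqrt_of_sq_le (le_add_of_nonneg_right ENNReal.toReal_nonneg)

theorem exists_norm_le_minGrad {d : ℕ} (hd : 1 ≤ d) {s : ℝ} (hs0 : 0 < s) (hs1 : s < 1)
    {Ω : Set (Rd d)} (hΩb : Bornology.IsBounded Ω) :
    ∃ C : ℝ, 0 < C ∧ ∀ u : HsZero s Ω, ‖u‖ ≤ C * ‖minGrad hs0 hs1 Ω u‖ := by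
  obtain ⟨C, hC, h⟩ := exists_eLpNorm_le_gradTrace hd hs0 hΩb.closure
  exact ⟨C, hC, fun u => (h u.toL2 _ u.2.2 (isMinGrad_minGrad hs0 hs1 u).1).2.2⟩

theorem ae_eq_zero_of_tendsto {d : ℕ} {K : Set (Rd d)} (hK : MeasurableSet K)
    {v : ℕ → Lp ℝ 2 (volume : Measure (Rd d))} {u : Lp ℝ 2 (volume : Measure (Rd d))}
    (hv : ∀ n, ∀ᵐ x, x ∉ K → v n x = 0) (h : Tendsto v atTop (𝓝 u)) :
    ∀ᵐ x, x ∉ K → u x = 0 := by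
  have h0 : eLpNorm u 2 (volume.restrict Kᶜ) = 0 := by
    rw [tendsto_iff_edist_tendsto_0] at h
    refine le_antisymm (ge_of_tendsto' h fun n => ?_) zero_le
    rw [edist_comm, edist_eq_enorm_sub, Lp.enorm_def]
    refine le_trans (le_of_eq (eLpNorm_congr_ae ?_)) (eLpNorm_mono_measure _
      (Measure.restrict_le_self (s := Kᶜ)))
    filter_upwards [ae_restrict_of_ae (Lp.coeFn_sub u (v n)), ae_restrict_of_ae (hv n),
      ae_restrict_mem hK.compl] with x h1 h2 h3
    rw [h1, Pi.sub_apply, h2 h3, sub_zero]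
  rw [eLpNorm_eq_zero_iff (Lp.stronglyMeasurable u).aestronglyMeasurable two_ne_zero,
    Filter.EventuallyEq, ae_restrict_iff' hK.compl] at h0
  exact h0

/-- If the minimal gradients converge, coercivity makes their traces Cauchy in `L²`. The limit pair
stays in `gradTrace` and the limit gradient stays orthogonal to `zeroTraceGrad`. The trace
inequality puts the limit trace into `H^s`, so completeness of `HsZero` is not required. -/
theorem isClosed_range_minGrad {d : ℕ} (hd : 1 ≤ d) {s : ℝ} (hs0 : 0 < s) (hs1 : s < 1)
    {Ω : Set (Rd d)} (hΩb : Bornology.IsBounded Ω) :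
    IsClosed (LinearMap.range (minGrad hs0 hs1 Ω) : Set (GradL2 d (1 - 2 * s))) := by
  obtain ⟨C, hC, hle⟩ := exists_norm_le_minGrad hd hs0 hs1 hΩb
  obtain ⟨_, -, hfin⟩ := exists_eLpNorm_le_gradTrace hd hs0 hΩb.closure
  refine isClosed_of_closure_subset fun G hG => ?_
  obtain ⟨w, hw, hwG⟩ := mem_closure_iff_seq_limit.mp hG
  choose v hv using hw
  have hcauchy : CauchySeq fun n => (v n).toL2 := by
    rw [Metric.cauchySeq_iff]
    intro ε hε
    obtain ⟨N, hN⟩ := Metric.cauchySeq_iff.mp hwG.cauchySeq (ε / C) (by positivity)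
    refine ⟨N, fun m hm n hn => ?_⟩
    have h1 := hN m hm n hn
    rw [dist_eq_norm, ← hv, ← hv, ← map_sub, lt_div_iff₀' hC] at h1
    rw [dist_eq_norm]
    exact ((v m - v n).norm_toL2_le.trans (hle _)).trans_lt h1
  obtain ⟨u, hu⟩ := cauchySeq_tendsto_of_complete hcauchy
  have hmem : (G, u) ∈ gradTrace d (1 - 2 * s) := by
    refine (isClosed_gradTrace d (1 - 2 * s)).mem_of_tendsto (hwG.prodMk_nhds hu)
      (Eventually.of_forall fun n => ?_)
    rw [← hv n]
    exact (isMinGrad_minGrad hs0 hs1 (v n)).1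
  have hort : G ∈ (zeroTraceGrad d (1 - 2 * s))ᗮ := by
    refine (Submodule.isClosed_orthogonal _).mem_of_tendsto hwG (Eventually.of_forall fun n => ?_)
    rw [← hv n]
    exact (isMinGrad_iff.mp (isMinGrad_minGrad hs0 hs1 (v n))).2
  have hzero := ae_eq_zero_of_tendsto isClosed_closure.measurableSet (fun n => (v n).2.2) hu
  let u' : HsZero s Ω := ⟨u, (hfin u G hzero hmem).1, hzero⟩
  exact ⟨u', (isMinGrad_minGrad hs0 hs1 u').unique (isMinGrad_iff.mpr ⟨hmem, hort⟩)⟩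

/-! ### Solvability, a priori bound and uniqueness. -/

theorem isSolution_iff {d : ℕ} {s : ℝ} (hs0 : 0 < s) (hs1 : s < 1) {Ω : Set (Rd d)}
    {f : StrongDual ℝ (HsZero s Ω)} {u : HsZero s Ω} :
    IsSolution f u ↔ ∀ v, inner ℝ (minGrad hs0 hs1 Ω u) (minGrad hs0 hs1 Ω v) = f v :=
  forall_congr' fun v => by
    rw [extensionForm_eq_inner hs0 hs1 (isMinGrad_minGrad hs0 hs1 u)
      (isMinGrad_minGrad hs0 hs1 v)]

/-- Coercivity makes `A = minGrad` injective and `f ∘ A⁻¹` bounded on its range, which is a Hilbert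
space because it is closed. The Riesz representative lies in the range, and its preimage is the
solution. Boundedness of the form in the `H^s` norm is not needed. -/
theorem exists_isSolution {d : ℕ} (hd : 1 ≤ d) {s : ℝ} (hs0 : 0 < s) (hs1 : s < 1)
    {Ω : Set (Rd d)} (hΩb : Bornology.IsBounded Ω) (f : StrongDual ℝ (HsZero s Ω)) :
    ∃ u : HsZero s Ω, IsSolution f u := by
  obtain ⟨C, hC, hle⟩ := exists_norm_le_minGrad hd hs0 hs1 hΩb
  set A := minGrad hs0 hs1 Ω
  have hinj : Function.Injective A := by
    rw [injective_iff_map_eq_zero]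
    intro u hu
    have := hle u
    rw [hu, norm_zero, mul_zero] at this
    exact norm_le_zero_iff.mp this
  let e := LinearEquiv.ofInjective A hinj
  have : CompleteSpace (LinearMap.range A) :=
    (isClosed_range_minGrad hd hs0 hs1 hΩb).completeSpace_coe
  let ℓ : StrongDual ℝ (LinearMap.range A) :=
    ((f : HsZero s Ω →ₗ[ℝ] ℝ) ∘ₗ e.symm.toLinearMap).mkContinuous (‖f‖ * C) fun y => by
      have h1 := hle (e.symm y)
      have h2 : A (e.symm y) = y := congrArg Subtype.val (e.apply_symm_apply y)
      rw [h2] at h1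
      refine (f.le_opNorm (e.symm y)).trans ?_
      rw [mul_assoc]
      gcongr
      exact h1
  let y := (InnerProductSpace.toDual ℝ (LinearMap.range A)).symm ℓ
  refine ⟨e.symm y, (isSolution_iff hs0 hs1).mpr fun v => ?_⟩
  have h2 : A (e.symm y) = y := congrArg Subtype.val (e.apply_symm_apply y)
  have h3 : inner ℝ y (e v) = ℓ (e v) := InnerProductSpace.toDual_symm_apply
  have h4 : ℓ (e v) = f v := congrArg f (e.symm_apply_apply v)
  rw [← h4, ← h3]
  exact congrArg (fun G => inner ℝ G (A v)) h2

/-- Testing with `u` gives `‖∇ℒu‖² = f u ≤ ‖f‖ ‖u‖`. Coercivity is squared, which produces `C ^ 2`,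
and one factor `‖u‖` is cancelled. -/
theorem IsSolution.norm_le {d : ℕ} {s : ℝ} (hs0 : 0 < s) (hs1 : s < 1) {Ω : Set (Rd d)} {C : ℝ}
    (hC : 0 < C) (hle : ∀ u : HsZero s Ω, ‖u‖ ≤ C * ‖minGrad hs0 hs1 Ω u‖)
    {f : StrongDual ℝ (HsZero s Ω)} {u : HsZero s Ω} (hu : IsSolution f u) :
    ‖u‖ ≤ C ^ 2 * ‖f‖ := by
  have h1 := (isSolution_iff hs0 hs1).mp hu u
  rw [real_inner_self_eq_norm_sq] at h1
  have h2 : ‖minGrad hs0 hs1 Ω u‖ ^ 2 ≤ ‖f‖ * ‖u‖ := by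
    rw [h1]
    exact (le_abs_self _).trans (f.le_opNorm u)
  have h3 : ‖u‖ ^ 2 ≤ C ^ 2 * ‖f‖ * ‖u‖ := by
    calc ‖u‖ ^ 2 ≤ (C * ‖minGrad hs0 hs1 Ω u‖) ^ 2 := by
          gcongr
          exact hle u
      _ = C ^ 2 * ‖minGrad hs0 hs1 Ω u‖ ^ 2 := by ring
      _ ≤ C ^ 2 * (‖f‖ * ‖u‖) := by gcongr
      _ = _ := by ring
  rcases (norm_nonneg u).eq_or_lt with h0 | h0
  · rw [← h0]
    positivity
  · nlinarith

/-- Testing both equations with the difference shows that its minimal gradient vanishes; coercivity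
does the rest. -/
theorem IsSolution.unique {d : ℕ} {s : ℝ} (hs0 : 0 < s) (hs1 : s < 1) {Ω : Set (Rd d)} {C : ℝ}
    (hle : ∀ u : HsZero s Ω, ‖u‖ ≤ C * ‖minGrad hs0 hs1 Ω u‖)
    {f : StrongDual ℝ (HsZero s Ω)} {u v : HsZero s Ω} (hu : IsSolution f u)
    (hv : IsSolution f v) : u = v := by
  have h1 := (isSolution_iff hs0 hs1).mp hu (u - v)
  have h2 := (isSolution_iff hs0 hs1).mp hv (u - v)
  have h3 : minGrad hs0 hs1 Ω (u - v) = 0 := by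
    rw [← inner_self_eq_zero (𝕜 := ℝ)]
    nth_rewrite 1 [map_sub]
    rw [inner_sub_left, h1, h2, sub_self]
  have h4 := hle (u - v)
  rw [h3, norm_zero, mul_zero] at h4
  exact sub_eq_zero.mp (norm_le_zero_iff.mp h4)

/-! ### Square integrable functions as functionals -/

theorem exists_dual_of_memLp {d : ℕ} {s : ℝ} {Ω : Set (Rd d)} {f : Rd d → ℝ}
    (hf : MemLp f 2 (volume.restrict Ω)) :
    ∃ F : StrongDual ℝ (HsZero s Ω), ∀ v : HsZero s Ω, F v = ∫ x in Ω, f x * v x := by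
  have hv : ∀ v : HsZero s Ω, MemLp v 2 (volume.restrict Ω) := fun v =>
    (Lp.memLp v.toL2).restrict Ω
  have hint : ∀ v : HsZero s Ω, IntegrableOn (fun x => f x * v x) Ω := fun v =>
    hf.integrable_mul (hv v)
  let F : HsZero s Ω →ₗ[ℝ] ℝ :=
    { toFun := fun v => ∫ x in Ω, f x * v x
      map_add' := fun v w => by
        rw [← integral_add (hint v) (hint w)]
        refine integral_congr_ae ?_
        filter_upwards [ae_restrict_of_ae (Lp.coeFn_add v.toL2 w.toL2)] with x hx
        rw [HsZero.toL2_add, hx, Pi.add_apply, mul_add]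
      map_smul' := fun c v => by
        rw [RingHom.id_apply, smul_eq_mul, ← integral_const_mul]
        refine integral_congr_ae ?_
        filter_upwards [ae_restrict_of_ae (Lp.coeFn_smul c v.toL2)] with x hx
        rw [HsZero.toL2_smul, hx, Pi.smul_apply, smul_eq_mul]
        ring }
  refine ⟨F.mkContinuous ‖hf.toLp f‖ fun v => ?_, fun v => rfl⟩
  have h1 : F v = inner ℝ ((hv v).toLp v) (hf.toLp f) := by
    rw [L2.inner_def]
    refine integral_congr_ae ?_
    filter_upwards [hf.coeFn_toLp, (hv v).coeFn_toLp] with x h2 h3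
    rw [h2, h3]
    simp
  rw [h1, mul_comm]
  refine (norm_inner_le_norm _ _).trans (mul_le_mul_of_nonneg_right ?_ (norm_nonneg _))
  refine le_trans ?_ v.norm_toL2_le
  rw [Lp.norm_toLp, Lp.norm_def]
  exact ENNReal.toReal_mono (Lp.memLp v.toL2).2.ne
    (eLpNorm_mono_measure _ Measure.restrict_le_self)

/-- Well-posedness of the variational problem. The first conjunct says that the extension `ℒ u`
in the bilinear form is well defined, the second that every `f ∈ L²(Ω)` is an element of
`H^{-s}(Ω)` through `⟨f, v⟩ = ∫_Ω f v`. -/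
theorem mainTheorem8 (d : ℕ) (hd : 1 ≤ d) (s : ℝ) (hs0 : 0 < s) (hs1 : s < 1)
    (Ω : Set (Rd d)) (hΩ : IsOpen Ω) (hΩb : Bornology.IsBounded Ω) :
    (∀ u ∈ sobolevHs d s, ∃! T : 𝓓'(halfSpace d, ℝ), IsMinNormExtension s u T) ∧
    (∀ f : Rd d → ℝ, MemLp f 2 (volume.restrict Ω) →
      ∃ F : StrongDual ℝ (HsZero s Ω), ∀ v : HsZero s Ω, F v = ∫ x in Ω, f x * v x) ∧
    ∃ C : ℝ, 0 < C ∧ ∀ f : StrongDual ℝ (HsZero s Ω),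
      (∃! u : HsZero s Ω, IsSolution f u) ∧
      ∀ u : HsZero s Ω, IsSolution f u → ‖u‖ ≤ C * ‖f‖ := by
  refine ⟨fun u hu => existsUnique_isMinNormExtension hs0 hs1 hu,
    fun f hf => exists_dual_of_memLp hf, ?_⟩
  obtain ⟨C, hC, hle⟩ := exists_norm_le_minGrad hd hs0 hs1 hΩb
  refine ⟨C ^ 2, by positivity, fun f => ⟨?_, fun u hu => hu.norm_le hs0 hs1 hC hle⟩⟩
  obtain ⟨u, hu⟩ := exists_isSolution hd hs0 hs1 hΩb f
  exact ⟨u, hu, fun v hv => hv.unique hs0 hs1 hle hu⟩
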